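/- Let $d\ge 1$ be an integer, let $\mathbb{R}^{d+1}_+=\mathbb{R}^d\times(0,\infty)$, and equip it with the measure $\frac{dy\,ds}{s}$. For $x\in\mathbb{R}^d$ let $\Gamma(x)=\{(y,t)\in\mathbb{R}^{d+1}_+:|y-x|<t\}$, and for an open ball $B\subset\mathbb{R}^d$ let $\widehat B=\mathbb{R}^{d+1}_+\setminus\bigcup_{x\notin B}\Gamma(x)$ be the tent over $B$. For a Banach space $X$ (real or complex), $1<q<\infty$ and a strongly measurable $f:\mathbb{R}^{d+1}_+\to X$ put \[ \mathcal{A}_q(f)(x)=\Big(\int_{\Gamma(x)}\|f(y,t)\|_X^q\,\frac{dy\,dt}{t^{d+1}}\Big)^{1/q},\qquad \mathcal{C}_q(f)(x)=\sup_{B\ni x}\Big(\frac1{|B|}\int_{\widehat B}\|f(y,t)\|_X^q\,\frac{dy\,dt}{t}\Big)^{1/q}, \] where the supremum runs over all balls $B$ containing $x$. For $1\le p<\infty$ let $T^p_q(\mathbb{R}^{d+1}_+;X)$ be the space of all strongly measurable $f$ (modulo equality almost everywhere) with $\|f\|_{T^p_q(X)}:=\|\mathcal{A}_q(f)\|_{L^p(\mathbb{R}^d)}<\infty$.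 Let $C_c(\mathbb{R}^{d+1}_+)\otimes X$ be the space of finite linear combinations of functions $z\mapsto\varphi(z)x$ with $\varphi\in C_c(\mathbb{R}^{d+1}_+)$ scalar-valued and $x\in X$. Let $\varepsilon,\kappa>0$. There is a constant $A>0$, depending only on $d,\varepsilon,\kappa$, such that the following holds for every Banach space $X$, every $1<q<\infty$, every $C>0$ and every jointly measurable kernel $(x,t),(y,s)\mapsto\mathcal{K}_{t,s}(x,y)\in\mathbb{R}$ on $\mathbb{R}^{d+1}_+\times\mathbb{R}^{d+1}_+$ with \[ |\mathcal{K}_{t,s}(x,y)|\le\frac{C\,\min\{\frac st,\frac ts\}^{\varepsilon}\,\min\{\frac1t,\frac1s\}^{d}}{\big(1+\min\{\frac1t,\frac1s\}|x-y|\big)^{d+\kappa}}\qquad\text{for all }x,y\in\mathbb{R}^d,\ s,t>0 . \] 1. For $f\in C_c(\mathbb{R}^{d+1}_+)\otimes X$ the integral \[ \mathcal{K}(f)(x,t)=\int_{\mathbb{R}^{d+1}_+}\mathcal{K}_{t,s}(x,y)f(y,s)\,\frac{dy\,ds}{s} \] converges absolutely for almost every $(x,t)\in\mathbb{R}^{d+1}_+$.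 2. For every $1\le p<\infty$, $C_c(\mathbb{R}^{d+1}_+)\otimes X\subset T^p_q(\mathbb{R}^{d+1}_+;X)$ and $\mathcal{K}$ extends from $C_c(\mathbb{R}^{d+1}_+)\otimes X$ to a bounded linear operator on $T^p_q(\mathbb{R}^{d+1}_+;X)$, again denoted by $\mathcal{K}$, with \[ \|\mathcal{K}(f)\|_{T^p_q(X)}\le A\,C\,p^{1/q}\,\|f\|_{T^p_q(X)}\qquad\text{for all }f\in T^p_q(\mathbb{R}^{d+1}_+;X). \] 3. For every $1\le p\le\infty$ and every $f\in C_c(\mathbb{R}^{d+1}_+)\otimes X$, \[ \|\mathcal{C}_q(\mathcal{K}(f))\|_{L^p(\mathbb{R}^d)}\le A\,C\,\|\mathcal{C}_q(f)\|_{L^p(\mathbb{R}^d)}, \] where both sides may be infinite. -/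

import Mathlib

open MeasureTheory
open scoped ENNReal

namespace Tent

/-- The upper half-space `ℝ^d × (0, ∞)`; a point is written `z = (y, t)`. -/
def halfSpace (d : ℕ) : Set (EuclideanSpace ℝ (Fin d) × ℝ) := {z | 0 < z.2}

/-- The measure `dy dt / t`, carried by the upper half-space. -/
noncomputable def halfMeasure (d : ℕ) : Measure (EuclideanSpace ℝ (Fin d) × ℝ) :=
  (volume : Measure (EuclideanSpace ℝ (Fin d))).prod
    (((volume : Measure ℝ).restrict (Set.Ioi 0)).withDensity fun t => ENNReal.ofReal t⁻¹)

instance (d : ℕ) : SFinite (halfMeasure d) := by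
  unfold halfMeasure; infer_instance

/-- The cone `Γ(x) = {(y, t) : |y - x| < t}` with vertex `x`. -/
def cone {d : ℕ} (x : EuclideanSpace ℝ (Fin d)) : Set (EuclideanSpace ℝ (Fin d) × ℝ) :=
  {z | 0 < z.2 ∧ dist z.1 x < z.2}

/-- The tent over `O`: the complement, in the upper half-space, of the union of the cones
with vertex outside `O`. -/
def tent {d : ℕ} (O : Set (EuclideanSpace ℝ (Fin d))) : Set (EuclideanSpace ℝ (Fin d) × ℝ) :=
  halfSpace d \ ⋃ x ∈ Oᶜ, cone x

variable {d : ℕ} {X : Type*} [NormedAddCommGroup X]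

/-- `A_q(f)(x) = (∫_{Γ(x)} ‖f(y,t)‖^q dy dt / t^{d+1})^{1/q}`. -/
noncomputable def areaFun (q : ℝ) (f : EuclideanSpace ℝ (Fin d) × ℝ → X)
    (x : EuclideanSpace ℝ (Fin d)) : ℝ≥0∞ :=
  (∫⁻ z in cone x, ‖f z‖ₑ ^ q * ENNReal.ofReal (z.2 ^ d)⁻¹ ∂halfMeasure d) ^ (1 / q)

/-- `C_q(f)(x) = sup_{B ∋ x} (|B|⁻¹ ∫_{tent B} ‖f(y,t)‖^q dy dt / t)^{1/q}`, the supremum being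
over all balls `B` containing `x`. -/
noncomputable def carlesonFun (q : ℝ) (f : EuclideanSpace ℝ (Fin d) × ℝ → X)
    (x : EuclideanSpace ℝ (Fin d)) : ℝ≥0∞ :=
  ⨆ (c : EuclideanSpace ℝ (Fin d)) (r : ℝ) (_ : 0 < r) (_ : x ∈ Metric.ball c r),
    ((volume (Metric.ball c r))⁻¹ *
      ∫⁻ z in tent (Metric.ball c r), ‖f z‖ₑ ^ q ∂halfMeasure d) ^ (1 / q)

/-- `‖f‖_{T^p_q(X)} = ‖A_q(f)‖_{L^p(ℝ^d)}`, with values in `[0, ∞]`, for finite `p`. -/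
noncomputable def tentENorm (p q : ℝ) (f : EuclideanSpace ℝ (Fin d) × ℝ → X) : ℝ≥0∞ :=
  eLpNorm (areaFun q f) (ENNReal.ofReal p) volume

theorem areaFun_congr (q : ℝ) {f g : EuclideanSpace ℝ (Fin d) × ℝ → X}
    (h : f =ᵐ[halfMeasure d] g) : areaFun q f = areaFun q g := by
  funext x
  unfold areaFun
  congr 1
  refine lintegral_congr_ae ?_
  filter_upwards [ae_restrict_of_ae h] with z hz
  rw [hz]

theorem tentENorm_congr (p q : ℝ) {f g : EuclideanSpace ℝ (Fin d) × ℝ → X}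
    (h : f =ᵐ[halfMeasure d] g) : tentENorm p q f = tentENorm p q g := by
  unfold tentENorm; rw [areaFun_congr q h]

theorem measurable_areaFun (q : ℝ) {f : EuclideanSpace ℝ (Fin d) × ℝ → X}
    (hf : AEStronglyMeasurable f (halfMeasure d)) : Measurable (areaFun q f) := by
  rw [areaFun_congr q hf.ae_eq_mk]
  set g := hf.mk f
  have hg : StronglyMeasurable g := hf.stronglyMeasurable_mk
  have hcone : ∀ x : EuclideanSpace ℝ (Fin d), MeasurableSet (cone x) := fun x =>
    (measurableSet_lt measurable_const measurable_snd).inter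
      (measurableSet_lt (measurable_fst.dist measurable_const) measurable_snd)
  have hS : MeasurableSet {w : EuclideanSpace ℝ (Fin d) × (EuclideanSpace ℝ (Fin d) × ℝ) |
      w.2 ∈ cone w.1} :=
    (measurableSet_lt measurable_const (measurable_snd.comp measurable_snd)).inter
      (measurableSet_lt ((measurable_fst.comp measurable_snd).dist measurable_fst)
        (measurable_snd.comp measurable_snd))
  have hF : Measurable fun z : EuclideanSpace ℝ (Fin d) × ℝ =>
      ‖g z‖ₑ ^ q * ENNReal.ofReal (z.2 ^ d)⁻¹ :=
    (hg.enorm.pow_const q).mul ((measurable_snd.pow_const d).inv.ennreal_ofReal)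
  have key := ((hF.comp measurable_snd).indicator hS).lintegral_prod_right' (ν := halfMeasure d)
  have : areaFun q g = fun x => (∫⁻ z, Set.indicator
      {w : EuclideanSpace ℝ (Fin d) × (EuclideanSpace ℝ (Fin d) × ℝ) | w.2 ∈ cone w.1}
      ((fun z : EuclideanSpace ℝ (Fin d) × ℝ => ‖g z‖ₑ ^ q * ENNReal.ofReal (z.2 ^ d)⁻¹) ∘ Prod.snd)
      (x, z) ∂halfMeasure d) ^ (1 / q) := by
    funext x
    unfold areaFun
    rw [← lintegral_indicator (hcone x)]
    rfl
  rw [this]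
  exact key.pow_const _

theorem areaFun_add_le {q : ℝ} (hq : 1 ≤ q) {f g : EuclideanSpace ℝ (Fin d) × ℝ → X}
    (hf : AEStronglyMeasurable f (halfMeasure d)) (hg : AEStronglyMeasurable g (halfMeasure d))
    (x : EuclideanSpace ℝ (Fin d)) :
    areaFun q (f + g) x ≤ areaFun q f x + areaFun q g x := by
  have hq0 : 0 < q := by linarith
  have hw : Measurable fun z : EuclideanSpace ℝ (Fin d) × ℝ =>
      ENNReal.ofReal (z.2 ^ d)⁻¹ ^ (1 / q) :=
    ((measurable_snd.pow_const d).inv.ennreal_ofReal).pow_const _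
  have e : ∀ h : EuclideanSpace ℝ (Fin d) × ℝ → X, areaFun q h x =
      (∫⁻ z in cone x, (‖h z‖ₑ * ENNReal.ofReal (z.2 ^ d)⁻¹ ^ (1 / q)) ^ q
        ∂halfMeasure d) ^ (1 / q) := by
    intro h
    unfold areaFun
    congr 2
    funext z
    rw [ENNReal.mul_rpow_of_nonneg _ _ hq0.le, ← ENNReal.rpow_mul, one_div,
      inv_mul_cancel₀ hq0.ne', ENNReal.rpow_one]
  rw [e, e, e]
  refine le_trans ?_ (ENNReal.lintegral_Lp_add_le (hf.restrict.enorm.mul hw.aemeasurable)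
    (hg.restrict.enorm.mul hw.aemeasurable) hq)
  refine ENNReal.rpow_le_rpow (lintegral_mono fun z => ENNReal.rpow_le_rpow ?_ hq0.le)
    (by positivity)
  simp only [Pi.add_apply, ← add_mul]
  gcongr
  exact enorm_add_le _ _

theorem areaFun_smul {𝕜 : Type*} [NormedField 𝕜] [NormedSpace 𝕜 X] {q : ℝ} (hq : 1 ≤ q) (c : 𝕜)
    (f : EuclideanSpace ℝ (Fin d) × ℝ → X) :
    areaFun q (c • f) = fun x => ‖c‖ₑ * areaFun q f x := by
  have hq0 : 0 < q := by linarith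
  funext x
  unfold areaFun
  have : ∀ z : EuclideanSpace ℝ (Fin d) × ℝ,
      ‖(c • f) z‖ₑ ^ q * ENNReal.ofReal (z.2 ^ d)⁻¹ =
        ‖c‖ₑ ^ q * (‖f z‖ₑ ^ q * ENNReal.ofReal (z.2 ^ d)⁻¹) := by
    intro z
    rw [Pi.smul_apply, enorm_smul, ENNReal.mul_rpow_of_nonneg _ _ hq0.le, mul_assoc]
  simp_rw [this]
  rw [lintegral_const_mul' _ _ (ENNReal.rpow_ne_top_of_nonneg hq0.le enorm_ne_top),
    ENNReal.mul_rpow_of_nonneg _ _ (by positivity), ← ENNReal.rpow_mul, mul_one_div_cancel hq0.ne',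
    ENNReal.rpow_one]

/-- The tent space `T^p_q(ℝ^{d+1}_+; X)`, `1 ≤ p < ∞`, `1 < q < ∞`, of (classes modulo null sets
of) strongly measurable functions `f` with `‖f‖_{T^p_q(X)} < ∞`. -/
noncomputable def tentSpace (𝕜 : Type*) [RCLike 𝕜] (d : ℕ) (X : Type*) [NormedAddCommGroup X]
    [NormedSpace 𝕜 X] {p q : ℝ} (hp : 1 ≤ p) (hq : 1 < q) :
    Submodule 𝕜 (EuclideanSpace ℝ (Fin d) × ℝ →ₘ[halfMeasure d] X) where
  carrier := {f | tentENorm p q f < ∞}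
  zero_mem' := by
    have h0 : tentENorm p q ((0 : EuclideanSpace ℝ (Fin d) × ℝ →ₘ[halfMeasure d] X) :
        EuclideanSpace ℝ (Fin d) × ℝ → X) = 0 := by
      rw [tentENorm_congr p q AEEqFun.coeFn_zero]
      have : areaFun q (0 : EuclideanSpace ℝ (Fin d) × ℝ → X) = 0 := by
        have hq0 : 0 < q := by linarith
        funext x
        simp [areaFun, hq0]
      rw [tentENorm, this, eLpNorm_zero]
    simp [h0]
  add_mem' := by
    intro f g hf hg
    rw [Set.mem_ofPred_eq] at hf hg ⊢
    rw [tentENorm_congr p q (AEEqFun.coeFn_add f g)]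
    refine lt_of_le_of_lt ?_ (ENNReal.add_lt_top.2 ⟨hf, hg⟩)
    unfold tentENorm
    refine le_trans (eLpNorm_mono_enorm (g := areaFun q f + areaFun q g) fun x => ?_)
      (eLpNorm_add_le (measurable_areaFun q f.aestronglyMeasurable).aestronglyMeasurable
        (measurable_areaFun q g.aestronglyMeasurable).aestronglyMeasurable ?_)
    · simpa using areaFun_add_le hq.le f.aestronglyMeasurable g.aestronglyMeasurable x
    · simpa using hp
  smul_mem' := by
    intro c f hf
    rw [Set.mem_ofPred_eq] at hf ⊢
    rw [tentENorm_congr p q (AEEqFun.coeFn_smul c f), tentENorm, areaFun_smul hq.le]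
    refine lt_of_le_of_lt (eLpNorm_le_nnreal_smul_eLpNorm_of_ae_le_mul' (c := ‖c‖₊)
      (g := areaFun q f) (Filter.Eventually.of_forall fun x => ?_) _) ?_
    · simp [enorm_eq_nnnorm]
    · exact ENNReal.mul_lt_top ENNReal.coe_lt_top hf

/-- `C_c(ℝ^{d+1}_+) ⊗ X`: finite linear combinations of the functions `z ↦ φ z • x`, where `φ` is a
scalar continuous function with compact support contained in the upper half-space and `x ∈ X`. -/
def ccTensor (𝕜 : Type*) [RCLike 𝕜] (d : ℕ) (X : Type*) [NormedAddCommGroup X]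
    [NormedSpace 𝕜 X] : Submodule 𝕜 (EuclideanSpace ℝ (Fin d) × ℝ → X) :=
  Submodule.span 𝕜 {f | ∃ (φ : EuclideanSpace ℝ (Fin d) × ℝ → 𝕜) (x : X), Continuous φ ∧
    HasCompactSupport φ ∧ tsupport φ ⊆ halfSpace d ∧ f = fun z => φ z • x}

/-- The integral operator `(𝒦 f)(z) = ∫ 𝒦(z, w) f(w) dy ds / s`, where `w = (y, s)`. -/
noncomputable def kernelOp [NormedSpace ℝ X]
    (K : EuclideanSpace ℝ (Fin d) × ℝ → EuclideanSpace ℝ (Fin d) × ℝ → ℝ)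
    (f : EuclideanSpace ℝ (Fin d) × ℝ → X) (z : EuclideanSpace ℝ (Fin d) × ℝ) : X :=
  ∫ w, K z w • f w ∂halfMeasure d

/-- The size condition on a kernel, `K (x, t) (y, s)` being `𝒦_{t,s}(x, y)`. -/
def KernelDecay (ε κ C : ℝ)
    (K : EuclideanSpace ℝ (Fin d) × ℝ → EuclideanSpace ℝ (Fin d) × ℝ → ℝ) : Prop :=
  ∀ (x y : EuclideanSpace ℝ (Fin d)) (t s : ℝ), 0 < t → 0 < s →
    |K (x, t) (y, s)| ≤ C * min (s / t) (t / s) ^ ε * min (1 / t) (1 / s) ^ d /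
      (1 + min (1 / t) (1 / s) * ‖x - y‖) ^ ((d : ℝ) + κ)

end Tent

/-!
The kernel is dominated by `C` times the positive kernel `ker γ`, with `γ = min(κ, ε/2)`, so that
`‖𝒦 f‖ ≤ C • posOp γ ‖f‖` pointwise and everything is a statement about the positive operator
`P = posOp γ` acting on functions with values in `[0, ∞]`. Since the tent space bound for `P` makes
the integral defining `𝒦 f` converge absolutely almost everywhere for *every* `f` in the tent space,
the extension of `𝒦` is given by the same integral, and no density argument is needed.

Schur's test gives `(P F)^q ≤ A^{q-1} P(F^q)`, and integrals of the kernel over tents and over cones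
are explicit (`setLIntegral_tent_ker_le`, `coneInt_ker_le`).

* Carleson functions: the integral of the kernel over the tent over a ball `B` decays like
  `2^{-j(d+γ)}` off the tent over `2^j B`, which beats the growth `2^{jd}` of the volume. Hence
  `C_q(𝒦 f) ≤ A C C_q(f)` pointwise (`setLIntegral_tent_posOp_rpow_le`).
* Tent spaces, `p ≥ q`: the square function of `P F` is integrated against a power of itself. The
  kernel moves onto this weight as a Poisson-type average, which the maximal function dominates
  (`lintegral_mul_coneInt_posOp_le`). The norm of the maximal function on `L^{(p/q)'}` is
  `O(p/q)`, whence the factor `p^{1/q}` after taking `q`-th roots.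
* `p = 1`: with `a` the square function of `H ≤ P F`, the norm of `a` in `L^1` is the pairing of
  `H` with `G = H^{q-1} • (averages of a^{1-q})`, and `G` has a bounded Carleson function with
  exponent `q'` by Jensen's inequality (`setLIntegral_tent_dual_le`). As `P` is symmetric and
  preserves Carleson bounds, the claim follows from the duality between tent spaces and Carleson
  functions (`lintegral_mul_le_of_carleson`).
* `1 < p < q`: a function in the tent space is factored explicitly as `F₀^{1-θ} F₁^θ` with `F₀` and
  `F₁` in the tent spaces with exponents `1` and `q`, and a positive operator respects such products
  by Hölder's inequality (`lintegral_coneInt_posOp_le_of_lt`). This keeps all constants uniform in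
  `p` and `q`.
-/

namespace Tent

/-! ### Cones, balls and the measure of the half-space -/

/-- The Euclidean space `ℝ^d`. -/
abbrev Pt (d : ℕ) := EuclideanSpace ℝ (Fin d)

/-- The ambient space `ℝ^d × ℝ` of the upper half-space; a point is written `w = (y, s)`. -/
abbrev Up (d : ℕ) := EuclideanSpace ℝ (Fin d) × ℝ

variable {d : ℕ}

/-- The measure `ds / s` on `(0, ∞)`. -/
noncomputable def vertMeasure : Measure ℝ :=
  ((volume : Measure ℝ).restrict (Set.Ioi 0)).withDensity fun t => ENNReal.ofReal t⁻¹

instance : SFinite vertMeasure := by unfold vertMeasure; infer_instance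

theorem halfMeasure_eq (d : ℕ) :
    halfMeasure d = (volume : Measure (Pt d)).prod vertMeasure := rfl

theorem lintegral_vertMeasure {h : ℝ → ℝ≥0∞} (hh : Measurable h) :
    ∫⁻ t, h t ∂vertMeasure = ∫⁻ t in Set.Ioi 0, ENNReal.ofReal t⁻¹ * h t := by
  unfold vertMeasure
  rw [lintegral_withDensity_eq_lintegral_mul _ (by fun_prop) hh]
  rfl

theorem ae_vertMeasure_pos : ∀ᵐ t ∂vertMeasure, 0 < t := by
  unfold vertMeasure
  exact (withDensity_absolutelyContinuous _ _) (ae_restrict_mem measurableSet_Ioi)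

theorem ae_halfMeasure_pos (d : ℕ) : ∀ᵐ w ∂halfMeasure d, 0 < w.2 := by
  rw [halfMeasure_eq]
  exact Measure.quasiMeasurePreserving_snd.ae ae_vertMeasure_pos

theorem lintegral_halfMeasure_mul {b : Pt d → ℝ≥0∞} {h : ℝ → ℝ≥0∞} (hb : Measurable b)
    (hh : Measurable h) :
    ∫⁻ w, b w.1 * h w.2 ∂halfMeasure d = (∫⁻ x, b x) * ∫⁻ t, h t ∂vertMeasure := by
  rw [halfMeasure_eq]
  exact lintegral_prod_mul hb.aemeasurable hh.aemeasurable

/-- The volume of the unit ball of `ℝ^d`. -/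
noncomputable def unitVol (d : ℕ) : ℝ≥0∞ := volume (Metric.ball (0 : Pt d) 1)

theorem unitVol_ne_top (d : ℕ) : unitVol d ≠ ∞ := measure_ball_lt_top.ne

theorem unitVol_ne_zero (d : ℕ) : unitVol d ≠ 0 :=
  (Metric.measure_ball_pos volume _ one_pos).ne'

theorem volume_ball_eq (c : Pt d) {r : ℝ} (hr : 0 < r) :
    volume (Metric.ball c r) = ENNReal.ofReal (r ^ d) * unitVol d := by
  rw [Measure.addHaar_ball_of_pos volume c hr, finrank_euclideanSpace_fin]
  rfl

theorem volume_ball_ne_zero (c : Pt d) {r : ℝ} (hr : 0 < r) : volume (Metric.ball c r) ≠ 0 :=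
  (Metric.measure_ball_pos volume _ hr).ne'

theorem volume_ball_ne_top (c : Pt d) (r : ℝ) : volume (Metric.ball c r) ≠ ∞ :=
  measure_ball_lt_top.ne

theorem inv_pow_mul_volume_ball (c : Pt d) {r : ℝ} (hr : 0 < r) :
    ENNReal.ofReal (r ^ d)⁻¹ * volume (Metric.ball c r) = unitVol d := by
  have hrd : 0 < r ^ d := by positivity
  rw [volume_ball_eq c hr, ← mul_assoc, ← ENNReal.ofReal_mul (by positivity),
    inv_mul_cancel₀ hrd.ne', ENNReal.ofReal_one, one_mul]

theorem measurableSet_cone (x : Pt d) : MeasurableSet (cone x) :=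
  (measurableSet_lt measurable_const measurable_snd).inter
    (measurableSet_lt (measurable_fst.dist measurable_const) measurable_snd)

theorem measurableSet_cone_rel : MeasurableSet {p : Pt d × Up d | p.2 ∈ cone p.1} :=
  (measurableSet_lt measurable_const (measurable_snd.comp measurable_snd)).inter
    (measurableSet_lt ((measurable_fst.comp measurable_snd).dist measurable_fst)
      (measurable_snd.comp measurable_snd))

theorem mem_cone_iff {x : Pt d} {w : Up d} (hw : 0 < w.2) :
    w ∈ cone x ↔ x ∈ Metric.ball w.1 w.2 := by
  simp [cone, hw, dist_comm]

/-- The integral `∫_{Γ(x)} Φ(y, s) dy ds / s^{d+1}` over the cone with vertex `x`. -/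
noncomputable def coneInt (Φ : Up d → ℝ≥0∞) (x : Pt d) : ℝ≥0∞ :=
  ∫⁻ w in cone x, Φ w * ENNReal.ofReal (w.2 ^ d)⁻¹ ∂halfMeasure d

/-- The integral of `g` over the ball `B(y, s)`, divided by `s^d`. It is the average of `g` over
that ball, up to the volume of the unit ball. -/
noncomputable def ballMean (g : Pt d → ℝ≥0∞) (w : Up d) : ℝ≥0∞ :=
  ENNReal.ofReal (w.2 ^ d)⁻¹ * ∫⁻ x in Metric.ball w.1 w.2, g x

theorem measurable_weight : Measurable fun w : Up d => ENNReal.ofReal (w.2 ^ d)⁻¹ :=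
  (measurable_snd.pow_const d).inv.ennreal_ofReal

theorem coneInt_eq (Φ : Up d → ℝ≥0∞) (x : Pt d) :
    coneInt Φ x = ∫⁻ w, (cone x).indicator (fun w => Φ w * ENNReal.ofReal (w.2 ^ d)⁻¹) w
      ∂halfMeasure d := by
  rw [lintegral_indicator (measurableSet_cone x)]
  rfl

theorem measurable_coneInt_prod {α : Type*} [MeasurableSpace α] {Φ : α → Up d → ℝ≥0∞}
    (hΦ : Measurable (Function.uncurry Φ)) :
    Measurable fun p : α × Pt d => coneInt (Φ p.1) p.2 := by
  simp_rw [coneInt_eq]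
  have h1 : Measurable fun q : (α × Pt d) × Up d =>
      Φ q.1.1 q.2 * ENNReal.ofReal (q.2.2 ^ d)⁻¹ :=
    (hΦ.comp (f := fun q : (α × Pt d) × Up d => (q.1.1, q.2)) (by fun_prop)).mul
      (measurable_weight.comp measurable_snd)
  have h2 : MeasurableSet {q : (α × Pt d) × Up d | q.2 ∈ cone q.1.2} :=
    measurableSet_cone_rel.preimage
      (f := fun q : (α × Pt d) × Up d => (q.1.2, q.2)) (by fun_prop)
  exact (h1.indicator h2).lintegral_prod_right' (ν := halfMeasure d)

theorem measurable_coneInt {Φ : Up d → ℝ≥0∞} (hΦ : Measurable Φ) : Measurable (coneInt Φ) :=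
  (measurable_coneInt_prod (α := Unit) (Φ := fun _ => Φ) (hΦ.comp measurable_snd)).comp
    (f := fun x => ((), x)) (by fun_prop)

theorem measurableSet_ball_rel :
    MeasurableSet {q : Up d × Pt d | q.2 ∈ Metric.ball q.1.1 q.1.2} :=
  measurableSet_lt (measurable_snd.dist (measurable_fst.comp measurable_fst))
    (measurable_snd.comp measurable_fst)

theorem measurable_ballMean {g : Pt d → ℝ≥0∞} (hg : Measurable g) : Measurable (ballMean g) := by
  refine measurable_weight.mul ?_
  have h := ((hg.comp (measurable_snd (α := Up d))).indicator
    measurableSet_ball_rel).lintegral_prod_right' (ν := (volume : Measure (Pt d)))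
  convert h using 2 with w
  rw [← lintegral_indicator Metric.isOpen_ball.measurableSet]
  rfl

/-- Fubini's theorem for the incidence relation `w ∈ Γ(x) ↔ x ∈ B(y, s)`. -/
theorem lintegral_coneInt {Φ : Pt d → Up d → ℝ≥0∞} (hΦ : Measurable (Function.uncurry Φ)) :
    ∫⁻ x, coneInt (Φ x) x =
      ∫⁻ w, ENNReal.ofReal (w.2 ^ d)⁻¹ * (∫⁻ x in Metric.ball w.1 w.2, Φ x w) ∂halfMeasure d := by
  simp_rw [coneInt_eq]
  rw [lintegral_lintegral_swap]
  · refine lintegral_congr_ae ?_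
    filter_upwards [ae_halfMeasure_pos d] with w hw
    rw [← lintegral_const_mul' _ _ ENNReal.ofReal_ne_top,
      ← lintegral_indicator Metric.isOpen_ball.measurableSet]
    refine lintegral_congr fun x => ?_
    by_cases h : w ∈ cone x
    · rw [Set.indicator_of_mem h, Set.indicator_of_mem ((mem_cone_iff hw).1 h), mul_comm]
    · rw [Set.indicator_of_notMem h, Set.indicator_of_notMem fun h' => h ((mem_cone_iff hw).2 h')]
  · exact ((hΦ.mul (measurable_weight.comp measurable_snd)).indicator
      measurableSet_cone_rel).aemeasurable

/-- Averages over balls and integrals over cones are adjoint to each other. -/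
theorem lintegral_mul_coneInt {g : Pt d → ℝ≥0∞} {Φ : Up d → ℝ≥0∞} (hg : Measurable g)
    (hΦ : Measurable Φ) :
    ∫⁻ x, g x * coneInt Φ x = ∫⁻ w, Φ w * ballMean g w ∂halfMeasure d := by
  have h := lintegral_coneInt (Φ := fun x w => g x * Φ w)
    ((hg.comp measurable_fst).mul (hΦ.comp measurable_snd))
  have e1 : ∀ x, coneInt (fun w => g x * Φ w) x = g x * coneInt Φ x := by
    intro x
    unfold coneInt
    simp_rw [mul_assoc]
    exact lintegral_const_mul _ (hΦ.mul measurable_weight)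
  simp_rw [e1] at h
  rw [h]
  refine lintegral_congr fun w => ?_
  rw [lintegral_mul_const _ hg, ballMean]
  ring

theorem ballMean_one {w : Up d} (hw : 0 < w.2) : ballMean (fun _ => 1) w = unitVol d := by
  rw [ballMean, setLIntegral_const, one_mul, inv_pow_mul_volume_ball _ hw]

theorem lintegral_coneInt_eq {Φ : Up d → ℝ≥0∞} (hΦ : Measurable Φ) :
    ∫⁻ x, coneInt Φ x = unitVol d * ∫⁻ w, Φ w ∂halfMeasure d := by
  have h := lintegral_mul_coneInt (g := fun _ => 1) measurable_const hΦ
  simp only [one_mul] at h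
  rw [h, ← lintegral_const_mul' _ _ (unitVol_ne_top d)]
  refine lintegral_congr_ae ?_
  filter_upwards [ae_halfMeasure_pos d] with w hw
  rw [ballMean_one hw, mul_comm]

theorem coneInt_mono {Φ Ψ : Up d → ℝ≥0∞} (h : ∀ w, 0 < w.2 → Φ w ≤ Ψ w) (x : Pt d) :
    coneInt Φ x ≤ coneInt Ψ x :=
  setLIntegral_mono' (measurableSet_cone x) fun w hw => mul_le_mul_left (h w hw.1) _

theorem coneInt_const_mul {c : ℝ≥0∞} (hc : c ≠ ∞) (Φ : Up d → ℝ≥0∞) (x : Pt d) :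
    coneInt (fun w => c * Φ w) x = c * coneInt Φ x := by
  unfold coneInt
  simp_rw [mul_assoc]
  rw [lintegral_const_mul' _ _ hc]

/-- Hölder's inequality for integrals over cones. -/
theorem coneInt_mul_rpow_le {Φ Ψ : Up d → ℝ≥0∞} (hΦ : Measurable Φ) (hΨ : Measurable Ψ) {a b : ℝ}
    (ha : 0 ≤ a) (hb : 0 ≤ b) (hab : a + b = 1) (x : Pt d) :
    coneInt (fun w => Φ w ^ a * Ψ w ^ b) x ≤ coneInt Φ x ^ a * coneInt Ψ x ^ b := by
  refine le_trans (le_of_eq ?_) (ENNReal.lintegral_mul_norm_pow_le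
    (hΦ.mul measurable_weight).aemeasurable (hΨ.mul measurable_weight).aemeasurable ha hb hab)
  refine lintegral_congr fun w => ?_
  simp only [Pi.mul_apply]
  have hW : ENNReal.ofReal (w.2 ^ d)⁻¹ =
      ENNReal.ofReal (w.2 ^ d)⁻¹ ^ a * ENNReal.ofReal (w.2 ^ d)⁻¹ ^ b := by
    rw [← ENNReal.rpow_add_of_nonneg _ _ ha hb, hab, ENNReal.rpow_one]
  rw [ENNReal.mul_rpow_of_nonneg _ _ ha, ENNReal.mul_rpow_of_nonneg _ _ hb, mul_mul_mul_comm,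
    ← hW]

theorem coneInt_vert {h : ℝ → ℝ≥0∞} (hh : Measurable h) (x : Pt d) :
    coneInt (fun w => h w.2) x = unitVol d * ∫⁻ t, h t ∂vertMeasure := by
  rw [coneInt_eq, halfMeasure_eq, lintegral_prod_symm,
    ← lintegral_const_mul' _ _ (unitVol_ne_top d)]
  · refine lintegral_congr_ae ?_
    filter_upwards [ae_vertMeasure_pos] with t ht
    have e : ∀ y : Pt d, (cone x).indicator
        (fun w => h w.2 * ENNReal.ofReal (w.2 ^ d)⁻¹) (y, t) =
        (Metric.ball x t).indicator (fun _ => h t * ENNReal.ofReal (t ^ d)⁻¹) y := by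
      intro y
      by_cases hy : dist y x < t
      · rw [Set.indicator_of_mem (show (y, t) ∈ cone x from ⟨ht, hy⟩),
          Set.indicator_of_mem (show y ∈ Metric.ball x t from hy)]
      · rw [Set.indicator_of_notMem (show (y, t) ∉ cone x from fun h => hy h.2),
          Set.indicator_of_notMem (show y ∉ Metric.ball x t from hy)]
    simp_rw [e]
    rw [lintegral_indicator Metric.isOpen_ball.measurableSet, setLIntegral_const, mul_assoc,
      inv_pow_mul_volume_ball x ht, mul_comm]
  · exact (((hh.comp measurable_snd).mul measurable_weight).indicator
      (measurableSet_cone x)).aemeasurable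

/-! ### Tents -/

theorem isOpen_cone (x : Pt d) : IsOpen (cone x) :=
  (isOpen_lt continuous_const continuous_snd).inter
    (isOpen_lt (continuous_fst.dist continuous_const) continuous_snd)

theorem measurableSet_tent (O : Set (Pt d)) : MeasurableSet (tent O) :=
  (isOpen_lt continuous_const continuous_snd).measurableSet.diff
    (isOpen_biUnion fun x _ => isOpen_cone x).measurableSet

theorem mem_tent_iff {O : Set (Pt d)} {w : Up d} :
    w ∈ tent O ↔ 0 < w.2 ∧ Metric.ball w.1 w.2 ⊆ O := by
  simp only [tent, Set.mem_sdiff, halfSpace, Set.mem_ofPred_eq, Set.mem_iUnion, not_exists]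
  refine and_congr_right fun hw => ⟨fun h x hx => ?_, fun h x hx hx' => ?_⟩
  · by_contra hxO
    exact h x hxO ((mem_cone_iff hw).2 hx)
  · exact hx (h ((mem_cone_iff hw).1 hx'))

theorem mem_tent_ball {c : Pt d} {r : ℝ} {w : Up d} (hw : 0 < w.2) (h : w.2 + dist w.1 c ≤ r) :
    w ∈ tent (Metric.ball c r) :=
  mem_tent_iff.2 ⟨hw, Metric.ball_subset_ball' h⟩

theorem exists_dist_eq (hd : 1 ≤ d) (c : Pt d) {r : ℝ} (hr : 0 ≤ r) : ∃ x, dist x c = r := by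
  have : Nonempty (Fin d) := ⟨⟨0, hd⟩⟩
  exact (NormedSpace.sphere_nonempty (x := c)).2 hr

theorem dist_lt_and_lt_of_mem_tent_ball (hd : 1 ≤ d) {c : Pt d} {r : ℝ} (hr : 0 < r) {w : Up d}
    (h : w ∈ tent (Metric.ball c r)) : dist w.1 c < r ∧ w.2 < 2 * r := by
  obtain ⟨h0, h1⟩ := mem_tent_iff.1 h
  have h2 : dist w.1 c < r := h1 (Metric.mem_ball_self h0)
  refine ⟨h2, ?_⟩
  obtain ⟨x, hx⟩ := exists_dist_eq hd c hr.le
  by_contra hcon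
  have h3 : x ∈ Metric.ball w.1 w.2 := by
    rw [Metric.mem_ball]
    have := dist_triangle_right x w.1 c
    linarith
  have := h1 h3
  rw [Metric.mem_ball] at this
  linarith

/-! ### The Hardy–Littlewood maximal function -/

/-- The uncentred Hardy–Littlewood maximal function, over open balls. -/
noncomputable def maxFun (g : Pt d → ℝ≥0∞) (x : Pt d) : ℝ≥0∞ :=
  ⨆ (c : Pt d) (r : ℝ) (_ : 0 < r) (_ : x ∈ Metric.ball c r),
    (volume (Metric.ball c r))⁻¹ * ∫⁻ y in Metric.ball c r, g y

theorem le_maxFun (g : Pt d → ℝ≥0∞) {x c : Pt d} {r : ℝ} (hx : x ∈ Metric.ball c r) :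
    (volume (Metric.ball c r))⁻¹ * ∫⁻ y in Metric.ball c r, g y ≤ maxFun g x := by
  have hr : 0 < r := Metric.pos_of_mem_ball hx
  exact le_iSup₂_of_le c r (le_iSup₂_of_le hr hx le_rfl)

theorem setLIntegral_ball_le_maxFun (g : Pt d → ℝ≥0∞) {x c : Pt d} {r : ℝ}
    (hx : x ∈ Metric.ball c r) :
    ∫⁻ y in Metric.ball c r, g y ≤ volume (Metric.ball c r) * maxFun g x := by
  have hr : 0 < r := Metric.pos_of_mem_ball hx
  calc ∫⁻ y in Metric.ball c r, g y
      = volume (Metric.ball c r) *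
          ((volume (Metric.ball c r))⁻¹ * ∫⁻ y in Metric.ball c r, g y) := by
        rw [← mul_assoc, ENNReal.mul_inv_cancel (volume_ball_ne_zero c hr)
          (volume_ball_ne_top c r), one_mul]
    _ ≤ _ := by gcongr; exact le_maxFun g hx

theorem ballMean_le_maxFun (g : Pt d → ℝ≥0∞) {x : Pt d} {w : Up d}
    (hx : x ∈ Metric.ball w.1 w.2) : ballMean g w ≤ unitVol d * maxFun g x := by
  have hr : 0 < w.2 := Metric.pos_of_mem_ball hx
  rw [ballMean, ← inv_pow_mul_volume_ball w.1 hr, mul_assoc]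
  gcongr
  exact setLIntegral_ball_le_maxFun g hx

theorem maxFun_one_le (x : Pt d) : maxFun (fun _ => 1) x ≤ 1 := by
  refine iSup₂_le fun c r => iSup₂_le fun hr _ => ?_
  rw [setLIntegral_const, one_mul,
    ENNReal.inv_mul_cancel (volume_ball_ne_zero c hr) (volume_ball_ne_top c r)]

theorem isOpen_lt_maxFun (g : Pt d → ℝ≥0∞) (a : ℝ≥0∞) : IsOpen {x | a < maxFun g x} := by
  have : {x | a < maxFun g x} = ⋃ (c : Pt d) (r : ℝ) (_ : 0 < r)
      (_ : a < (volume (Metric.ball c r))⁻¹ * ∫⁻ y in Metric.ball c r, g y), Metric.ball c r := by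
    ext x
    simp only [maxFun, Set.mem_ofPred_eq, lt_iSup_iff, Set.mem_iUnion, exists_prop]
    refine exists_congr fun c => exists_congr fun r => ?_
    tauto
  rw [this]
  exact isOpen_iUnion fun c => isOpen_iUnion fun r => isOpen_iUnion fun _ =>
    isOpen_iUnion fun _ => Metric.isOpen_ball

theorem measurable_maxFun (g : Pt d → ℝ≥0∞) : Measurable (maxFun g) :=
  measurable_of_Ioi fun a => (isOpen_lt_maxFun g a).measurableSet

/-- The weak type `(1, 1)` bound, by the Vitali covering lemma. -/
theorem mul_volume_lt_maxFun_le (hd : 1 ≤ d) (g : Pt d → ℝ≥0∞) {a : ℝ≥0∞} (ha : a ≠ 0) :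
    a * volume {x | a < maxFun g x} ≤ 4 ^ d * ∫⁻ x, g x := by
  rcases eq_or_ne (∫⁻ x, g x) ∞ with hg | hg
  · rw [hg, ENNReal.mul_top (by positivity)]; exact le_top
  let t : Set (Pt d × ℝ) := {p | 0 < p.2 ∧
    a * volume (Metric.ball p.1 p.2) < ∫⁻ y in Metric.ball p.1 p.2, g y}
  have hbd : ∃ R : ℝ, ∀ p ∈ t, p.2 ≤ R := by
    set D : ℝ≥0∞ := (∫⁻ x, g x) / (a * unitVol d) with hD
    have hau : a * unitVol d ≠ 0 := mul_ne_zero ha (unitVol_ne_zero d)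
    have hDt : D ≠ ∞ := ENNReal.div_ne_top hg hau
    refine ⟨max 1 D.toReal, fun p hp => ?_⟩
    rcases le_or_gt p.2 1 with h1 | h1
    · exact h1.trans (le_max_left _ _)
    refine le_max_of_le_right ?_
    have h2 : ENNReal.ofReal (p.2 ^ d) ≤ D := by
      rw [hD, ENNReal.le_div_iff_mul_le (Or.inl hau) (Or.inr hg)]
      calc ENNReal.ofReal (p.2 ^ d) * (a * unitVol d) = a * volume (Metric.ball p.1 p.2) := by
            rw [volume_ball_eq _ hp.1]; ring
        _ ≤ _ := hp.2.le.trans (setLIntegral_le_lintegral _ _)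
    have h3 := (ENNReal.ofReal_le_iff_le_toReal hDt).1 h2
    exact (le_self_pow₀ h1.le (by lia)).trans h3
  obtain ⟨R, hR⟩ := hbd
  obtain ⟨u, hut, hdisj, hcov⟩ := Vitali.exists_disjoint_subfamily_covering_enlargement_ball t
    (fun p => p.1) (fun p => p.2) R hR 4 (by norm_num)
  have hcount : u.Countable := hdisj.countable_of_isOpen (fun p _ => Metric.isOpen_ball)
    fun p hp => Metric.nonempty_ball.2 (hut hp).1
  have hsub : {x | a < maxFun g x} ⊆ ⋃ p ∈ u, Metric.ball p.1 (4 * p.2) := by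
    intro x hx
    simp only [maxFun, Set.mem_ofPred_eq, lt_iSup_iff] at hx
    obtain ⟨c, r, hr, hxc, hlt⟩ := hx
    have hmem : (c, r) ∈ t := by
      refine ⟨hr, ?_⟩
      rw [← ENNReal.div_eq_inv_mul] at hlt
      exact (ENNReal.lt_div_iff_mul_lt (Or.inl (volume_ball_ne_zero c hr))
        (Or.inl (volume_ball_ne_top c r))).1 hlt
    obtain ⟨b, hb, hsub⟩ := hcov _ hmem
    exact Set.mem_biUnion hb (hsub hxc)
  calc a * volume {x | a < maxFun g x}
      ≤ a * ∑' p : u, volume (Metric.ball p.1.1 (4 * p.1.2)) := by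
        gcongr
        exact (measure_mono hsub).trans (measure_biUnion_le _ hcount _)
    _ = 4 ^ d * ∑' p : u, a * volume (Metric.ball p.1.1 p.1.2) := by
        rw [← ENNReal.tsum_mul_left, ← ENNReal.tsum_mul_left]
        refine tsum_congr fun p => ?_
        have hp := (hut p.2).1
        rw [volume_ball_eq _ hp, volume_ball_eq _ (by positivity), mul_pow,
          ENNReal.ofReal_mul (by positivity), ENNReal.ofReal_pow (by norm_num)]
        norm_num
        ring
    _ ≤ 4 ^ d * ∑' p : u, ∫⁻ y in Metric.ball p.1.1 p.1.2, g y := by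
        gcongr with p
        exact (hut p.2).2.le
    _ = 4 ^ d * ∫⁻ y in ⋃ p ∈ u, Metric.ball p.1 p.2, g y := by
        rw [lintegral_biUnion hcount (fun p _ => Metric.isOpen_ball.measurableSet) hdisj]
    _ ≤ _ := by gcongr; exact Measure.restrict_le_self

/-- Values of `g` up to `b` raise the maximal function by at most `b`; with `b` half the level, this
turns the weak type bound into one that integrates over the levels. -/
theorem maxFun_le_add_truncation (g : Pt d → ℝ≥0∞) (b : ℝ≥0∞) (x : Pt d) :
    maxFun g x ≤ maxFun ({x | b < g x}.indicator g) x + b := by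
  refine iSup₂_le fun c r => iSup₂_le fun hr hx => ?_
  have h1 : ∀ y, g y ≤ {x | b < g x}.indicator g y + b := by
    intro y
    by_cases hy : b < g y
    · rw [Set.indicator_of_mem (show y ∈ {x | b < g x} from hy)]; exact le_self_add
    · exact (not_lt.1 hy).trans le_add_self
  calc (volume (Metric.ball c r))⁻¹ * ∫⁻ y in Metric.ball c r, g y
      ≤ (volume (Metric.ball c r))⁻¹ *
          ∫⁻ y in Metric.ball c r, ({x | b < g x}.indicator g y + b) := by
        gcongr with y; exact h1 y
    _ = (volume (Metric.ball c r))⁻¹ * (∫⁻ y in Metric.ball c r, {x | b < g x}.indicator g y) +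
          b := by
        rw [lintegral_add_right _ measurable_const, setLIntegral_const, mul_add, mul_comm b,
          ← mul_assoc _ _ b, ENNReal.inv_mul_cancel (volume_ball_ne_zero c hr)
          (volume_ball_ne_top c r), one_mul]
    _ ≤ _ := by gcongr; exact le_maxFun _ hx

/-- The layer cake formula for a single value. -/
theorem lintegral_layer (s : ℝ) (hs : 0 < s) (a : ℝ≥0∞) :
    ∫⁻ t in Set.Ioi (0 : ℝ), {t : ℝ | ENNReal.ofReal t < a}.indicator
      (fun t => ENNReal.ofReal (s * t ^ (s - 1))) t = a ^ s := by
  have key : ∀ b : ℝ, 0 ≤ b → ∫⁻ t in Set.Ioo (0 : ℝ) b, ENNReal.ofReal (s * t ^ (s - 1)) =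
      ENNReal.ofReal b ^ s := by
    intro b hb
    rw [setLIntegral_congr Ioo_ae_eq_Ioc, ← ofReal_integral_eq_lintegral_ofReal,
      ← intervalIntegral.integral_of_le hb, intervalIntegral.integral_const_mul,
      integral_rpow (Or.inl (by linarith)), ENNReal.ofReal_rpow_of_nonneg hb hs.le]
    · congr 1
      rw [sub_add_cancel, Real.zero_rpow hs.ne', sub_zero]
      field_simp
    · exact ((intervalIntegral.intervalIntegrable_rpow' (by linarith)).1).const_mul _
    · refine (ae_restrict_mem measurableSet_Ioc).mono fun t ht => ?_
      have := ht.1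
      positivity
  have hmeas : MeasurableSet {t : ℝ | ENNReal.ofReal t < a} :=
    measurableSet_lt ENNReal.measurable_ofReal measurable_const
  rw [lintegral_indicator hmeas, Measure.restrict_restrict hmeas]
  rcases eq_or_ne a ∞ with rfl | ha
  · rw [ENNReal.top_rpow_of_pos hs]
    refine ENNReal.eq_top_of_forall_nnreal_le fun r => ?_
    have h0 : (0 : ℝ) ≤ (r : ℝ) ^ (1 / s) := by positivity
    have := key ((r : ℝ) ^ (1 / s)) h0
    rw [ENNReal.ofReal_rpow_of_nonneg h0 hs.le, ← Real.rpow_mul r.coe_nonneg, one_div,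
      inv_mul_cancel₀ hs.ne', Real.rpow_one, ENNReal.ofReal_coe_nnreal] at this
    rw [← this]
    refine lintegral_mono_set fun t ht => ⟨by simp, ht.1⟩
  · have e : {t : ℝ | ENNReal.ofReal t < a} ∩ Set.Ioi 0 = Set.Ioo 0 a.toReal := by
      ext t
      simp only [Set.mem_inter_iff, Set.mem_ofPred_eq, Set.mem_Ioi, Set.mem_Ioo]
      rw [and_comm]
      refine and_congr_right fun ht => ?_
      rw [ENNReal.ofReal_lt_iff_lt_toReal ht.le ha]
    rw [e, key _ ENNReal.toReal_nonneg, ENNReal.ofReal_toReal ha]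

/-- The strong type bound. The factor `s / (s - 1)` is what makes the growth in `p` of the main
estimate no worse than `p ^ (1 / q)`. -/
theorem lintegral_maxFun_rpow_le (hd : 1 ≤ d) {g : Pt d → ℝ≥0∞} (hg : Measurable g) {s : ℝ}
    (hs : 1 < s) :
    ∫⁻ x, maxFun g x ^ s ≤ ENNReal.ofReal (2 ^ s * 4 ^ d * (s / (s - 1))) * ∫⁻ x, g x ^ s := by
  have hs0 : 0 < s := by linarith
  have hs1 : 0 < s - 1 := by linarith
  have hmeasM : MeasurableSet {p : Pt d × ℝ | ENNReal.ofReal p.2 < maxFun g p.1} :=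
    measurableSet_lt (by fun_prop) ((measurable_maxFun g).comp measurable_fst)
  have hmeasG : MeasurableSet {p : ℝ × Pt d | ENNReal.ofReal p.1 < 2 * g p.2} :=
    measurableSet_lt (by fun_prop) (by fun_prop)
  have hpt : ∀ t : ℝ, 0 < t → ENNReal.ofReal (s * t ^ (s - 1)) *
      volume {x | ENNReal.ofReal t < maxFun g x} ≤
      ENNReal.ofReal (2 * 4 ^ d * (s / (s - 1))) *
        (∫⁻ x, {t : ℝ | ENNReal.ofReal t < 2 * g x}.indicator
        (fun t => g x * ENNReal.ofReal ((s - 1) * t ^ (s - 1 - 1))) t) := by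
    intro t ht
    set b : ℝ≥0∞ := ENNReal.ofReal (t / 2) with hb
    have hb0 : b ≠ 0 := by rw [hb]; simp [ht]
    have hbb : b + b = ENNReal.ofReal t := by
      rw [hb, ← ENNReal.ofReal_add (by positivity) (by positivity)]; congr 1; ring
    have h1 : {x | ENNReal.ofReal t < maxFun g x} ⊆
        {x | b < maxFun ({x | b < g x}.indicator g) x} := by
      intro x hx
      have h2 := lt_of_lt_of_le hx (maxFun_le_add_truncation g b x)
      rw [← hbb] at h2
      exact lt_of_add_lt_add_right h2
    have h3 := (mul_le_mul_right (measure_mono (μ := volume) h1) b).trans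
      (mul_volume_lt_maxFun_le hd ({x | b < g x}.indicator g) hb0)
    have e1 : ENNReal.ofReal (s * t ^ (s - 1)) =
        ENNReal.ofReal (2 * s * t ^ (s - 1 - 1)) * b := by
      rw [hb, ← ENNReal.ofReal_mul (by positivity), Real.rpow_sub_one ht.ne' (s - 1)]
      congr 1; field_simp
    have e2 : ∀ x, {t : ℝ | ENNReal.ofReal t < 2 * g x}.indicator
        (fun t => g x * ENNReal.ofReal ((s - 1) * t ^ (s - 1 - 1))) t =
        ENNReal.ofReal ((s - 1) * t ^ (s - 1 - 1)) * {x | b < g x}.indicator g x := by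
      intro x
      have : ENNReal.ofReal t < 2 * g x ↔ b < g x := by
        have : ENNReal.ofReal t = 2 * b := by rw [← hbb, two_mul]
        rw [this, ENNReal.mul_lt_mul_iff_right (by norm_num) (by norm_num)]
      by_cases h : b < g x
      · rw [Set.indicator_of_mem (show x ∈ {x | b < g x} from h),
          Set.indicator_of_mem (show t ∈ {t : ℝ | ENNReal.ofReal t < 2 * g x} from this.2 h),
          mul_comm]
      · rw [Set.indicator_of_notMem (show x ∉ {x | b < g x} from h),
          Set.indicator_of_notMem (show t ∉ {t : ℝ | ENNReal.ofReal t < 2 * g x} from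
            fun h' => h (this.1 h')), mul_zero]
    simp_rw [e2]
    rw [lintegral_const_mul' _ _ ENNReal.ofReal_ne_top, e1, mul_assoc]
    refine (mul_le_mul_right h3 _).trans (le_of_eq ?_)
    rw [← mul_assoc, ← mul_assoc]
    congr 1
    have h4 : (4 : ℝ≥0∞) ^ d = ENNReal.ofReal (4 ^ d) := by
      rw [ENNReal.ofReal_pow (by norm_num)]; norm_num
    rw [h4, ← ENNReal.ofReal_mul (by positivity), ← ENNReal.ofReal_mul (by positivity)]
    congr 1; field_simp
  calc ∫⁻ x, maxFun g x ^ s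
      = ∫⁻ x, ∫⁻ t in Set.Ioi (0 : ℝ), {t : ℝ | ENNReal.ofReal t < maxFun g x}.indicator
          (fun t => ENNReal.ofReal (s * t ^ (s - 1))) t := by
        simp_rw [lintegral_layer s hs0]
    _ = ∫⁻ t in Set.Ioi (0 : ℝ), ∫⁻ x, {t : ℝ | ENNReal.ofReal t < maxFun g x}.indicator
          (fun t => ENNReal.ofReal (s * t ^ (s - 1))) t := by
        refine lintegral_lintegral_swap (Measurable.aemeasurable ?_)
        have : Measurable fun p : Pt d × ℝ => ENNReal.ofReal (s * p.2 ^ (s - 1)) := by fun_prop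
        exact this.indicator hmeasM
    _ = ∫⁻ t in Set.Ioi (0 : ℝ), ENNReal.ofReal (s * t ^ (s - 1)) *
          volume {x | ENNReal.ofReal t < maxFun g x} := by
        refine lintegral_congr fun t => ?_
        rw [← lintegral_indicator_const (isOpen_lt_maxFun g _).measurableSet]
        rfl
    _ ≤ ∫⁻ t in Set.Ioi (0 : ℝ), ENNReal.ofReal (2 * 4 ^ d * (s / (s - 1))) *
          (∫⁻ x, {t : ℝ | ENNReal.ofReal t < 2 * g x}.indicator
        (fun t => g x * ENNReal.ofReal ((s - 1) * t ^ (s - 1 - 1))) t) :=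
        setLIntegral_mono' measurableSet_Ioi fun t ht => hpt t ht
    _ = ENNReal.ofReal (2 * 4 ^ d * (s / (s - 1))) * ∫⁻ x, g x * (2 * g x) ^ (s - 1) := by
        rw [lintegral_const_mul' _ _ ENNReal.ofReal_ne_top, lintegral_lintegral_swap]
        · congr 1
          refine lintegral_congr fun x => ?_
          have hm : MeasurableSet {t : ℝ | ENNReal.ofReal t < 2 * g x} :=
            measurableSet_lt ENNReal.measurable_ofReal measurable_const
          rw [← lintegral_layer (s - 1) hs1, ← lintegral_const_mul]
          · refine lintegral_congr fun t => ?_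
            by_cases h : t ∈ {t : ℝ | ENNReal.ofReal t < 2 * g x}
            · rw [Set.indicator_of_mem h, Set.indicator_of_mem h]
            · rw [Set.indicator_of_notMem h, Set.indicator_of_notMem h, mul_zero]
          · exact Measurable.indicator (by fun_prop) hm
        · have : Measurable fun p : ℝ × Pt d =>
            g p.2 * ENNReal.ofReal ((s - 1) * p.1 ^ (s - 1 - 1)) := by fun_prop
          exact (this.indicator hmeasG).aemeasurable
    _ = _ := by
        have h2 : ∀ x, g x * (2 * g x) ^ (s - 1) = ENNReal.ofReal (2 ^ (s - 1)) * g x ^ s := by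
          intro x
          rw [ENNReal.mul_rpow_of_nonneg _ _ hs1.le, mul_left_comm,
            ← ENNReal.ofReal_rpow_of_pos (by norm_num)]
          congr 1
          · norm_num
          · conv_lhs => rw [← ENNReal.rpow_one (g x), ← ENNReal.rpow_mul, one_mul,
              ← ENNReal.rpow_add_of_nonneg _ _ zero_le_one hs1.le]
            congr 1; ring
        simp_rw [h2]
        rw [lintegral_const_mul' _ _ ENNReal.ofReal_ne_top, ← mul_assoc,
          ← ENNReal.ofReal_mul (by positivity)]
        congr 2
        rw [Real.rpow_sub_one (by norm_num)]
        ring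

/-! ### The model kernel -/

/-- The vertical factor `(min(t, s) / max(t, s))^γ` of the model kernel. -/
noncomputable def vert (γ s t : ℝ) : ℝ≥0∞ := ENNReal.ofReal ((min t s / max t s) ^ γ)

/-- The Poisson-type kernel `s^γ / (s + |x - y|)^{d+γ}` at height `s`, where `w = (y, s)`. -/
noncomputable def pois (γ : ℝ) (w : Up d) (x : Pt d) : ℝ≥0∞ :=
  ENNReal.ofReal (w.2 ^ γ / (w.2 + dist x w.1) ^ ((d : ℝ) + γ))

/-- The model kernel `ρ^γ min(t, s)^γ / (max(t, s) + |x - y|)^{d+γ}`, where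
`ρ = min(t, s) / max(t, s)`, `z = (x, t)` and `w = (y, s)`. Every kernel with the decay
`KernelDecay ε κ C` is bounded by a multiple of it, with `γ = min(κ, ε/2)`. -/
noncomputable def ker (γ : ℝ) (z w : Up d) : ℝ≥0∞ :=
  vert γ w.2 z.2 *
    ENNReal.ofReal (min z.2 w.2 ^ γ / (max z.2 w.2 + dist z.1 w.1) ^ ((d : ℝ) + γ))

theorem ker_comm (γ : ℝ) (z w : Up d) : ker γ z w = ker γ w z := by
  simp only [ker, vert, min_comm z.2 w.2, max_comm z.2 w.2, dist_comm z.1 w.1]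

theorem measurable_vert (γ s : ℝ) : Measurable (vert γ s) := by unfold vert; fun_prop

theorem measurable_pois (γ : ℝ) (w : Up d) : Measurable (pois γ w) := by unfold pois; fun_prop

theorem measurable_pois_prod (γ : ℝ) :
    Measurable fun p : Pt d × Up d => pois γ p.2 p.1 := by
  have h1 : Measurable fun p : Pt d × Up d => p.2.2 := measurable_snd.comp measurable_snd
  have h2 : Measurable fun p : Pt d × Up d => dist p.1 p.2.1 :=
    measurable_fst.dist (measurable_fst.comp measurable_snd)
  exact ((h1.pow_const γ).div ((h1.add h2).pow_const _)).ennreal_ofReal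

theorem measurable_ker (γ : ℝ) : Measurable fun p : Up d × Up d => ker γ p.1 p.2 := by
  have h1 : Measurable fun p : Up d × Up d => p.1.2 := measurable_snd.comp measurable_fst
  have h2 : Measurable fun p : Up d × Up d => p.2.2 := measurable_snd.comp measurable_snd
  have h3 : Measurable fun p : Up d × Up d => dist p.1.1 p.2.1 :=
    (measurable_fst.comp measurable_fst).dist (measurable_fst.comp measurable_snd)
  exact (((h1.min h2).div (h1.max h2)).pow_const γ).ennreal_ofReal.mul
    (((h1.min h2).pow_const γ).div (((h1.max h2).add h3).pow_const _)).ennreal_ofReal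

theorem measurable_ker_right (γ : ℝ) (z : Up d) : Measurable fun w => ker γ z w :=
  (measurable_ker γ).comp (f := fun w : Up d => (z, w)) measurable_prodMk_left

theorem lintegral_vert_le {γ : ℝ} (hγ : 0 < γ) {s : ℝ} (hs : 0 < s) :
    ∫⁻ t, vert γ s t ∂vertMeasure ≤ ENNReal.ofReal (2 / γ) := by
  rw [lintegral_vertMeasure (measurable_vert γ s), ← Set.Ioc_union_Ioi_eq_Ioi hs.le]
  refine (lintegral_union_le _ _ _).trans ?_
  have h1 : ∫⁻ t in Set.Ioc 0 s, ENNReal.ofReal t⁻¹ * vert γ s t = ENNReal.ofReal (1 / γ) := by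
    calc ∫⁻ t in Set.Ioc 0 s, ENNReal.ofReal t⁻¹ * vert γ s t
        = ∫⁻ t in Set.Ioc 0 s, ENNReal.ofReal (s ^ (-γ) * t ^ (γ - 1)) := by
          refine setLIntegral_congr_fun measurableSet_Ioc fun t ht => ?_
          have ht0 : 0 < t := ht.1
          simp only [vert]
          rw [min_eq_left ht.2, max_eq_right ht.2, ← ENNReal.ofReal_mul (by positivity),
            Real.div_rpow ht0.le hs.le, Real.rpow_neg hs.le, Real.rpow_sub_one ht0.ne']
          congr 1
          ring
      _ = ENNReal.ofReal (1 / γ) := by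
          rw [← ofReal_integral_eq_lintegral_ofReal, ← intervalIntegral.integral_of_le hs.le,
            intervalIntegral.integral_const_mul, integral_rpow (Or.inl (by linarith))]
          · congr 1
            rw [sub_add_cancel, Real.zero_rpow hγ.ne', sub_zero, ← mul_div_assoc,
              ← Real.rpow_add hs, neg_add_cancel, Real.rpow_zero]
          · exact ((intervalIntegral.intervalIntegrable_rpow' (by linarith)).1).const_mul _
          · refine (ae_restrict_mem measurableSet_Ioc).mono fun t ht => ?_
            have := ht.1
            positivity
  have h2 : ∫⁻ t in Set.Ioi s, ENNReal.ofReal t⁻¹ * vert γ s t = ENNReal.ofReal (1 / γ) := by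
    calc ∫⁻ t in Set.Ioi s, ENNReal.ofReal t⁻¹ * vert γ s t
        = ∫⁻ t in Set.Ioi s, ENNReal.ofReal (s ^ γ * t ^ (-γ - 1)) := by
          refine setLIntegral_congr_fun measurableSet_Ioi fun t ht => ?_
          have ht' : s < t := ht
          have ht0 : 0 < t := hs.trans ht'
          simp only [vert]
          rw [min_eq_right ht'.le, max_eq_left ht'.le, ← ENNReal.ofReal_mul (by positivity),
            Real.div_rpow hs.le ht0.le, Real.rpow_sub_one ht0.ne', Real.rpow_neg ht0.le]
          congr 1
          ring
      _ = ENNReal.ofReal (1 / γ) := by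
          rw [← ofReal_integral_eq_lintegral_ofReal, integral_const_mul,
            integral_Ioi_rpow_of_lt (by linarith) hs]
          · congr 1
            rw [sub_add_cancel, neg_div_neg_eq, ← mul_div_assoc, ← Real.rpow_add hs,
              add_neg_cancel, Real.rpow_zero]
          · exact (integrableOn_Ioi_rpow_of_lt (by linarith) hs).const_mul _
          · refine (ae_restrict_mem measurableSet_Ioi).mono fun t ht => ?_
            have : 0 < t := hs.trans ht
            positivity
  rw [h1, h2, ← ENNReal.ofReal_add (by positivity) (by positivity)]
  refine le_of_eq ?_
  congr 1
  ring

/-- A dyadic multiple of `r` comparable to `r + D`. -/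
theorem exists_dyadic {r D : ℝ} (hr : 0 < r) (hD : 0 ≤ D) :
    ∃ j : ℕ, D < 2 ^ j * r ∧ 2 ^ j * r ≤ 2 * (r + D) := by
  have hex : ∃ j : ℕ, D < 2 ^ j * r := by
    obtain ⟨j, hj⟩ := pow_unbounded_of_one_lt (D / r) (one_lt_two (α := ℝ))
    exact ⟨j, (div_lt_iff₀ hr).1 hj⟩
  classical
  refine ⟨Nat.find hex, Nat.find_spec hex, ?_⟩
  rcases Nat.eq_zero_or_pos (Nat.find hex) with h | h
  · rw [h]; linarith
  · have h1 := Nat.find_min hex (Nat.sub_lt h one_pos)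
    have h2 : (2 : ℝ) ^ Nat.find hex = 2 * 2 ^ (Nat.find hex - 1) := by
      rw [← pow_succ', Nat.sub_add_cancel h]
    rw [h2]
    linarith

/-- The sum of the geometric series with ratio `2^{-γ}`. -/
noncomputable def geo (γ : ℝ) : ℝ≥0∞ := ∑' j : ℕ, ENNReal.ofReal ((2 : ℝ) ^ (-γ)) ^ j

theorem geo_ne_top {γ : ℝ} (hγ : 0 < γ) : geo γ ≠ ∞ := by
  rw [geo, ENNReal.tsum_geometric, ENNReal.inv_ne_top]
  refine (tsub_pos_of_lt ?_).ne'
  rw [ENNReal.ofReal_lt_one]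
  exact Real.rpow_lt_one_of_one_lt_of_neg one_lt_two (by linarith)

/-- Volume growth against kernel decay on dyadic balls. -/
theorem ofReal_decay_mul_volume_ball (γ : ℝ) (c : Pt d) {s : ℝ} (hs : 0 < s) (j : ℕ) :
    ENNReal.ofReal (s ^ γ / (2 ^ j * s / 2) ^ ((d : ℝ) + γ)) * volume (Metric.ball c (2 ^ j * s)) =
      ENNReal.ofReal (2 ^ ((d : ℝ) + γ)) * unitVol d * ENNReal.ofReal ((2 : ℝ) ^ (-γ)) ^ j := by
  have hu : (0 : ℝ) < 2 ^ j * s := by positivity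
  have h2 : (0 : ℝ) < 2 ^ j := by positivity
  rw [volume_ball_eq c hu, ← ENNReal.ofReal_pow (by positivity), ← mul_assoc,
    ← ENNReal.ofReal_mul (by positivity), mul_right_comm, ← ENNReal.ofReal_mul (by positivity)]
  congr 2
  rw [Real.div_rpow hu.le (by norm_num), Real.rpow_add hu, Real.rpow_natCast,
    Real.mul_rpow h2.le hs.le, ← Real.rpow_natCast (2 ^ (-γ)) j, ← Real.rpow_mul (by norm_num),
    mul_comm (-γ) j, Real.rpow_mul (by norm_num), Real.rpow_natCast, Real.rpow_neg h2.le]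
  field_simp

/-- The constant in `lintegral_mul_pois_le`. -/
noncomputable def poisConst (d : ℕ) (γ : ℝ) : ℝ≥0∞ :=
  ENNReal.ofReal (2 ^ ((d : ℝ) + γ)) * unitVol d * geo γ

theorem poisConst_ne_top (d : ℕ) {γ : ℝ} (hγ : 0 < γ) : poisConst d γ ≠ ∞ :=
  ENNReal.mul_ne_top (ENNReal.mul_ne_top ENNReal.ofReal_ne_top (unitVol_ne_top d)) (geo_ne_top hγ)

/-- Poisson-type averages at height `s` are dominated by the maximal function at every point of
the ball of radius `s`. -/
theorem lintegral_mul_pois_le {γ : ℝ} (hγ : 0 < γ) {g : Pt d → ℝ≥0∞} (hg : Measurable g)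
    {w : Up d} {x' : Pt d} (hx' : x' ∈ Metric.ball w.1 w.2) :
    ∫⁻ x, g x * pois γ w x ≤ poisConst d γ * maxFun g x' := by
  have hs : 0 < w.2 := Metric.pos_of_mem_ball hx'
  set c : ℕ → ℝ≥0∞ := fun j => ENNReal.ofReal (w.2 ^ γ / (2 ^ j * w.2 / 2) ^ ((d : ℝ) + γ)) with hc
  have hpt : ∀ x, g x * pois γ w x ≤
      ∑' j, (Metric.ball w.1 (2 ^ j * w.2)).indicator (fun x => c j * g x) x := by
    intro x
    obtain ⟨j, hj1, hj2⟩ := exists_dyadic hs (dist_nonneg (x := x) (y := w.1))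
    refine le_trans ?_ (ENNReal.le_tsum j)
    rw [Set.indicator_of_mem (Metric.mem_ball.2 hj1), mul_comm]
    gcongr
    refine ENNReal.ofReal_le_ofReal ?_
    gcongr
    linarith
  calc ∫⁻ x, g x * pois γ w x
      ≤ ∫⁻ x, ∑' j, (Metric.ball w.1 (2 ^ j * w.2)).indicator (fun x => c j * g x) x :=
        lintegral_mono hpt
    _ = ∑' j, c j * ∫⁻ x in Metric.ball w.1 (2 ^ j * w.2), g x := by
        rw [lintegral_tsum fun j => ((hg.const_mul _).indicator
          Metric.isOpen_ball.measurableSet).aemeasurable]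
        refine tsum_congr fun j => ?_
        rw [lintegral_indicator Metric.isOpen_ball.measurableSet, lintegral_const_mul _ hg]
    _ ≤ ∑' j, c j * (volume (Metric.ball w.1 (2 ^ j * w.2)) * maxFun g x') := by
        refine ENNReal.tsum_le_tsum fun j => ?_
        gcongr
        refine setLIntegral_ball_le_maxFun g (Metric.ball_subset_ball ?_ hx')
        exact le_mul_of_one_le_left hs.le (one_le_pow₀ one_le_two)
    _ = poisConst d γ * maxFun g x' := by
        simp_rw [← mul_assoc, hc, ofReal_decay_mul_volume_ball γ w.1 hs]
        rw [ENNReal.tsum_mul_right, ENNReal.tsum_mul_left]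
        rfl

theorem lintegral_pois_le {γ : ℝ} (hγ : 0 < γ) {w : Up d} (hw : 0 < w.2) :
    ∫⁻ x, pois γ w x ≤ poisConst d γ := by
  have h := lintegral_mul_pois_le hγ (g := fun _ => 1) measurable_const
    (Metric.mem_ball_self (x := w.1) hw)
  simp only [one_mul] at h
  exact h.trans (mul_le_of_le_one_right' (maxFun_one_le _))

theorem ker_le_vert_mul_pois {γ : ℝ} (hγ : 0 < γ) {z w : Up d} (hz : 0 < z.2) (hw : 0 < w.2) :
    ker γ z w ≤ vert γ w.2 z.2 * pois γ w z.1 := by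
  have hm : 0 < min z.2 w.2 := lt_min hz hw
  unfold ker pois
  gcongr
  · exact min_le_right _ _
  · exact le_max_right _ _

/-- The constant in `lintegral_ker_le`. -/
noncomputable def schurConst (d : ℕ) (γ : ℝ) : ℝ≥0∞ := poisConst d γ * ENNReal.ofReal (2 / γ)

theorem schurConst_ne_top (d : ℕ) {γ : ℝ} (hγ : 0 < γ) : schurConst d γ ≠ ∞ :=
  ENNReal.mul_ne_top (poisConst_ne_top d hγ) ENNReal.ofReal_ne_top

theorem lintegral_ker_le {γ : ℝ} (hγ : 0 < γ) {w : Up d} (hw : 0 < w.2) :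
    ∫⁻ z, ker γ z w ∂halfMeasure d ≤ schurConst d γ := by
  calc ∫⁻ z, ker γ z w ∂halfMeasure d ≤ ∫⁻ z, pois γ w z.1 * vert γ w.2 z.2 ∂halfMeasure d := by
        refine lintegral_mono_ae ?_
        filter_upwards [ae_halfMeasure_pos d] with z hz
        rw [mul_comm]
        exact ker_le_vert_mul_pois hγ hz hw
    _ = _ := lintegral_halfMeasure_mul (measurable_pois γ w) (measurable_vert γ w.2)
    _ ≤ _ := by
      unfold schurConst
      gcongr
      · exact lintegral_pois_le hγ hw
      · exact lintegral_vert_le hγ hw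

/-- Integrating the kernel over the cone with vertex `x` gives a Poisson-type kernel. -/
theorem coneInt_ker_le {γ : ℝ} (hγ : 0 < γ) {w : Up d} (hw : 0 < w.2) (x : Pt d) :
    coneInt (fun z => ker γ z w) x ≤
      ENNReal.ofReal (2 ^ ((d : ℝ) + γ)) * unitVol d * ENNReal.ofReal (2 / γ) * pois γ w x := by
  set c : ℝ≥0∞ := ENNReal.ofReal (2 ^ ((d : ℝ) + γ)) * pois γ w x with hc
  have hct : c ≠ ∞ := ENNReal.mul_ne_top ENNReal.ofReal_ne_top ENNReal.ofReal_ne_top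
  have hpt : ∀ z ∈ cone x, ker γ z w ≤ c * vert γ w.2 z.2 := by
    intro z hz
    have hz0 : 0 < z.2 := hz.1
    have hzx : dist z.1 x < z.2 := hz.2
    have hm : 0 < min z.2 w.2 := lt_min hz0 hw
    have hM : 0 < max z.2 w.2 := lt_max_of_lt_left hz0
    have h1 : z.2 ≤ max z.2 w.2 := le_max_left _ _
    have h2 : w.2 ≤ max z.2 w.2 := le_max_right _ _
    have h3 := dist_triangle_left x w.1 z.1
    have h4 : (w.2 + dist x w.1) / 2 ≤ max z.2 w.2 + dist z.1 w.1 := by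
      have := dist_nonneg (x := z.1) (y := w.1)
      linarith
    have hp : 0 < w.2 + dist x w.1 := by positivity
    unfold ker
    rw [mul_comm c]
    gcongr
    rw [hc, pois, ← ENNReal.ofReal_mul (by positivity)]
    refine ENNReal.ofReal_le_ofReal ?_
    calc min z.2 w.2 ^ γ / (max z.2 w.2 + dist z.1 w.1) ^ ((d : ℝ) + γ)
        ≤ w.2 ^ γ / ((w.2 + dist x w.1) / 2) ^ ((d : ℝ) + γ) := by
          gcongr
          exact min_le_right _ _
      _ = _ := by
          rw [Real.div_rpow hp.le (by norm_num)]
          field_simp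
  calc coneInt (fun z => ker γ z w) x ≤ coneInt (fun z => c * vert γ w.2 z.2) x :=
        setLIntegral_mono' (measurableSet_cone x) fun z hz => mul_le_mul_left (hpt z hz) _
    _ = c * (unitVol d * ∫⁻ t, vert γ w.2 t ∂vertMeasure) := by
        rw [coneInt_const_mul hct, coneInt_vert (measurable_vert γ w.2)]
    _ ≤ c * (unitVol d * ENNReal.ofReal (2 / γ)) := by
        gcongr
        exact lintegral_vert_le hγ hw
    _ = _ := by rw [hc]; ring

/-- Integrating the kernel over a tent: decay away from the tent. -/
theorem setLIntegral_tent_ker_le (hd : 1 ≤ d) {γ : ℝ} (hγ : 0 < γ) :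
    ∃ A : ℝ≥0∞, A ≠ ∞ ∧ ∀ (c : Pt d) (r : ℝ), 0 < r → ∀ w : Up d, 0 < w.2 →
      ∫⁻ z in tent (Metric.ball c r), ker γ z w ∂halfMeasure d ≤
        A * ENNReal.ofReal ((r / (r + (w.2 + dist w.1 c))) ^ ((d : ℝ) + γ)) := by
  set l : ℝ := (d : ℝ) + γ with hl
  have hl0 : 0 < l := by positivity
  refine ⟨schurConst d γ * ENNReal.ofReal (3 ^ l) +
    unitVol d * ENNReal.ofReal (2 / γ) * ENNReal.ofReal (2 ^ γ * 3 ^ l), ?_, ?_⟩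
  · exact ENNReal.add_ne_top.2 ⟨ENNReal.mul_ne_top (schurConst_ne_top d hγ) ENNReal.ofReal_ne_top,
      ENNReal.mul_ne_top (ENNReal.mul_ne_top (unitVol_ne_top d) ENNReal.ofReal_ne_top)
        ENNReal.ofReal_ne_top⟩
  intro c r hr w hw
  set D := w.2 + dist w.1 c with hD
  have hD0 : 0 < D := by positivity
  rw [add_mul]
  rcases le_or_gt D (2 * r) with hDr | hDr
  · refine le_add_right ?_
    calc ∫⁻ z in tent (Metric.ball c r), ker γ z w ∂halfMeasure d
        ≤ ∫⁻ z, ker γ z w ∂halfMeasure d := setLIntegral_le_lintegral _ _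
      _ ≤ schurConst d γ * 1 := by rw [mul_one]; exact lintegral_ker_le hγ hw
      _ ≤ _ := by
        rw [mul_assoc, ← ENNReal.ofReal_mul (by positivity), ← Real.mul_rpow (by norm_num)
          (by positivity)]
        gcongr
        rw [ENNReal.one_le_ofReal]
        refine Real.one_le_rpow ?_ hl0.le
        rw [← mul_div_assoc, one_le_div (by positivity)]
        linarith
  · refine le_add_left ?_
    set b : ℝ≥0∞ := ENNReal.ofReal ((2 * r) ^ γ / ((r + D) / 3) ^ l) with hb
    have hpt : ∀ z ∈ tent (Metric.ball c r), ker γ z w ≤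
        (Metric.ball c r).indicator (fun _ => b) z.1 * vert γ w.2 z.2 := by
      intro z hz
      obtain ⟨h1, h2⟩ := dist_lt_and_lt_of_mem_tent_ball hd hr hz
      have hz0 : 0 < z.2 := (mem_tent_iff.1 hz).1
      have hm : 0 < min z.2 w.2 := lt_min hz0 hw
      rw [Set.indicator_of_mem (Metric.mem_ball.2 h1), mul_comm]
      unfold ker
      gcongr
      refine ENNReal.ofReal_le_ofReal ?_
      gcongr
      · exact (min_le_left _ _).trans h2.le
      · have h3 := dist_triangle_left w.1 c z.1
        have h4 : w.2 ≤ max z.2 w.2 := le_max_right _ _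
        linarith
    calc ∫⁻ z in tent (Metric.ball c r), ker γ z w ∂halfMeasure d
        ≤ ∫⁻ z in tent (Metric.ball c r),
            (Metric.ball c r).indicator (fun _ => b) z.1 * vert γ w.2 z.2 ∂halfMeasure d :=
          setLIntegral_mono' (measurableSet_tent _) hpt
      _ ≤ ∫⁻ z, (Metric.ball c r).indicator (fun _ => b) z.1 * vert γ w.2 z.2 ∂halfMeasure d :=
          setLIntegral_le_lintegral _ _
      _ = b * volume (Metric.ball c r) * ∫⁻ t, vert γ w.2 t ∂vertMeasure := by
          rw [lintegral_halfMeasure_mul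
            (measurable_const.indicator Metric.isOpen_ball.measurableSet)
            (measurable_vert γ w.2),
            lintegral_indicator_const Metric.isOpen_ball.measurableSet]
      _ ≤ b * volume (Metric.ball c r) * ENNReal.ofReal (2 / γ) := by
          gcongr
          exact lintegral_vert_le hγ hw
      _ = b * ENNReal.ofReal (r ^ d) * (unitVol d * ENNReal.ofReal (2 / γ)) := by
          rw [volume_ball_eq c hr]; ring
      _ = _ := by
          rw [mul_assoc (unitVol d * _), mul_comm, hb, ← ENNReal.ofReal_mul (by positivity),
            ← ENNReal.ofReal_mul (by positivity)]
          congr 2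
          rw [Real.div_rpow (by positivity) (by norm_num), Real.mul_rpow (by norm_num) hr.le,
            Real.div_rpow hr.le (by positivity), hl, Real.rpow_add hr, Real.rpow_natCast]
          field_simp

/-! ### The positive integral operator -/

/-- The positive integral operator with the model kernel. -/
noncomputable def posOp (γ : ℝ) (F : Up d → ℝ≥0∞) (z : Up d) : ℝ≥0∞ :=
  ∫⁻ w, ker γ z w * F w ∂halfMeasure d

theorem measurable_posOp (γ : ℝ) {F : Up d → ℝ≥0∞} (hF : Measurable F) :
    Measurable (posOp γ F) :=
  ((measurable_ker γ).mul (hF.comp measurable_snd)).lintegral_prod_right' (ν := halfMeasure d)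

theorem posOp_mono_ae (γ : ℝ) {F G : Up d → ℝ≥0∞} (h : ∀ᵐ w ∂halfMeasure d, F w ≤ G w)
    (z : Up d) : posOp γ F z ≤ posOp γ G z := by
  refine lintegral_mono_ae ?_
  filter_upwards [h] with w hw
  gcongr

theorem lintegral_posOp_mul (γ : ℝ) {F G : Up d → ℝ≥0∞} (hF : Measurable F) (hG : Measurable G) :
    ∫⁻ z, posOp γ F z * G z ∂halfMeasure d = ∫⁻ w, F w * posOp γ G w ∂halfMeasure d := by
  have h1 : ∀ z, posOp γ F z * G z = ∫⁻ w, ker γ z w * F w * G z ∂halfMeasure d := fun z => by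
    exact (lintegral_mul_const _ ((measurable_ker_right γ z).mul hF)).symm
  have h2 : ∀ w, F w * posOp γ G w = ∫⁻ z, ker γ z w * F w * G z ∂halfMeasure d := fun w => by
    refine (lintegral_const_mul _ ((measurable_ker_right γ w).mul hG)).symm.trans ?_
    refine lintegral_congr fun z => ?_
    rw [ker_comm γ z w, Pi.mul_apply]
    ring
  simp_rw [h1, h2]
  refine lintegral_lintegral_swap (Measurable.aemeasurable ?_)
  exact ((measurable_ker γ).mul (hF.comp measurable_snd)).mul (hG.comp measurable_fst)

/-- Hölder's inequality: the positive operator respects products `F ^ a * G ^ b` with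
`a + b = 1`. -/
theorem posOp_mul_rpow_le (γ : ℝ) {F G : Up d → ℝ≥0∞} (hF : Measurable F) (hG : Measurable G)
    {a b : ℝ} (ha : 0 ≤ a) (hb : 0 ≤ b) (hab : a + b = 1) (z : Up d) :
    posOp γ (fun w => F w ^ a * G w ^ b) z ≤ posOp γ F z ^ a * posOp γ G z ^ b := by
  have hk := measurable_ker_right γ z
  refine le_trans (le_of_eq ?_) (ENNReal.lintegral_mul_norm_pow_le (hk.mul hF).aemeasurable
    (hk.mul hG).aemeasurable ha hb hab)
  refine lintegral_congr fun w => ?_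
  simp only [Pi.mul_apply]
  rw [ENNReal.mul_rpow_of_nonneg _ _ ha, ENNReal.mul_rpow_of_nonneg _ _ hb]
  have : ker γ z w = ker γ z w ^ a * ker γ z w ^ b := by
    rw [← ENNReal.rpow_add_of_nonneg _ _ ha hb, hab, ENNReal.rpow_one]
  nth_rewrite 1 [this]
  ring

theorem posOp_rpow_le {γ : ℝ} (hγ : 0 < γ) {F : Up d → ℝ≥0∞} (hF : Measurable F) {q : ℝ}
    (hq : 1 < q) {z : Up d} (hz : 0 < z.2) :
    posOp γ F z ^ q ≤ schurConst d γ ^ (q - 1) * posOp γ (fun w => F w ^ q) z := by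
  have hq0 : 0 < q := by linarith
  have h := posOp_mul_rpow_le γ (F := fun _ => 1) (G := fun w => F w ^ q) measurable_const
    (hF.pow_const q) (a := 1 - 1 / q) (b := 1 / q)
    (by rw [sub_nonneg, div_le_one hq0]; exact hq.le) (by positivity) (by ring) z
  have e1 : (fun w => (1 : ℝ≥0∞) ^ (1 - 1 / q) * (F w ^ q) ^ (1 / q)) = F := by
    funext w
    rw [ENNReal.one_rpow, one_mul, ← ENNReal.rpow_mul, mul_one_div_cancel hq0.ne',
      ENNReal.rpow_one]
  rw [e1] at h
  have h1 : posOp γ (fun _ => 1) z ≤ schurConst d γ := by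
    refine le_trans (le_of_eq ?_) (lintegral_ker_le hγ hz)
    refine lintegral_congr fun w => ?_
    rw [mul_one, ker_comm]
  calc posOp γ F z ^ q ≤ (posOp γ (fun _ => 1) z ^ (1 - 1 / q) *
        posOp γ (fun w => F w ^ q) z ^ (1 / q)) ^ q := by gcongr
    _ = posOp γ (fun _ => 1) z ^ (q - 1) * posOp γ (fun w => F w ^ q) z := by
        rw [ENNReal.mul_rpow_of_nonneg _ _ hq0.le, ← ENNReal.rpow_mul, ← ENNReal.rpow_mul,
          one_div, inv_mul_cancel₀ hq0.ne', ENNReal.rpow_one]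
        congr 2
        field_simp
    _ ≤ _ := by
        gcongr

theorem rpow_sub_one_mul_le {x y A : ℝ≥0∞} {q : ℝ} (hq : 1 ≤ q) (hx : x ≤ A) (hy : y ≤ A) :
    x ^ (q - 1) * y ≤ A ^ q := by
  have hq' : 0 ≤ q - 1 := by linarith
  calc x ^ (q - 1) * y ≤ A ^ (q - 1) * A ^ (1 : ℝ) := by
        rw [ENNReal.rpow_one]; gcongr
    _ = A ^ q := by rw [← ENNReal.rpow_add_of_nonneg _ _ hq' zero_le_one, sub_add_cancel]

/-! ### The Carleson estimate -/

/-- The positive operator preserves Carleson-type bounds on the tents over concentric balls. -/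
theorem setLIntegral_tent_posOp_rpow_le (hd : 1 ≤ d) {γ : ℝ} (hγ : 0 < γ) :
    ∃ A : ℝ≥0∞, A ≠ ∞ ∧ ∀ (q : ℝ), 1 < q → ∀ (F : Up d → ℝ≥0∞), Measurable F →
      ∀ (c : Pt d) (r : ℝ), 0 < r → ∀ N : ℝ≥0∞,
      (∀ R, r ≤ R → ∫⁻ w in tent (Metric.ball c R), F w ^ q ∂halfMeasure d ≤
        volume (Metric.ball c R) * N) →
      ∫⁻ z in tent (Metric.ball c r), posOp γ F z ^ q ∂halfMeasure d ≤
        A ^ q * (volume (Metric.ball c r) * N) := by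
  obtain ⟨A₀, hA₀, hker⟩ := setLIntegral_tent_ker_le hd hγ
  set l : ℝ := (d : ℝ) + γ with hl
  set B : ℝ≥0∞ := A₀ * ENNReal.ofReal (2 ^ l) * geo γ with hB
  have hBt : B ≠ ∞ :=
    ENNReal.mul_ne_top (ENNReal.mul_ne_top hA₀ ENNReal.ofReal_ne_top) (geo_ne_top hγ)
  refine ⟨schurConst d γ + B, ENNReal.add_ne_top.2 ⟨schurConst_ne_top d hγ, hBt⟩, ?_⟩
  intro q hq F hF c r hr N hN
  have hq0 : 0 < q := by linarith
  set T := tent (Metric.ball c r) with hT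
  have hTm : MeasurableSet T := measurableSet_tent _
  have hFq : Measurable fun w => F w ^ q := hF.pow_const q
  set b : ℕ → ℝ≥0∞ := fun j => ENNReal.ofReal (r ^ γ / (2 ^ j * r / 2) ^ l) with hb
  set S : ℕ → Set (Up d) := fun j => tent (Metric.ball c (2 ^ j * r)) with hS
  have hpt : ∀ w : Up d, 0 < w.2 → F w ^ q * posOp γ (T.indicator fun _ => 1) w ≤
      ∑' j, A₀ * ENNReal.ofReal (r ^ d) * b j * (S j).indicator (fun w => F w ^ q) w := by
    intro w hw
    obtain ⟨j, hj1, hj2⟩ := exists_dyadic hr (D := w.2 + dist w.1 c) (by positivity)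
    refine le_trans ?_ (ENNReal.le_tsum j)
    rw [Set.indicator_of_mem (show w ∈ S j from mem_tent_ball hw hj1.le), mul_comm]
    gcongr
    have e : posOp γ (T.indicator fun _ => 1) w = ∫⁻ z in T, ker γ z w ∂halfMeasure d := by
      rw [← lintegral_indicator hTm, posOp]
      refine lintegral_congr fun z => ?_
      by_cases hz : z ∈ T
      · rw [Set.indicator_of_mem hz, Set.indicator_of_mem hz, mul_one, ker_comm]
      · rw [Set.indicator_of_notMem hz, Set.indicator_of_notMem hz, mul_zero]
    rw [e, mul_assoc]
    refine (hker c r hr w hw).trans ?_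
    gcongr
    rw [hb, ← ENNReal.ofReal_mul (by positivity)]
    refine ENNReal.ofReal_le_ofReal ?_
    have e2 : r ^ d * (r ^ γ / (2 ^ j * r / 2) ^ l) = (r / (2 ^ j * r / 2)) ^ l := by
      rw [Real.div_rpow hr.le (by positivity), hl, Real.rpow_add hr, Real.rpow_natCast]
      ring
    rw [e2]
    gcongr
    linarith
  have hposT : Measurable (T.indicator fun _ => (1 : ℝ≥0∞)) := measurable_const.indicator hTm
  calc ∫⁻ z in T, posOp γ F z ^ q ∂halfMeasure d
      ≤ ∫⁻ z in T, schurConst d γ ^ (q - 1) * posOp γ (fun w => F w ^ q) z ∂halfMeasure d := by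
        refine setLIntegral_mono' hTm fun z hz => ?_
        exact posOp_rpow_le hγ hF hq (mem_tent_iff.1 hz).1
    _ = schurConst d γ ^ (q - 1) *
          ∫⁻ z, posOp γ (fun w => F w ^ q) z * T.indicator (fun _ => 1) z ∂halfMeasure d := by
        rw [lintegral_const_mul _ (measurable_posOp γ hFq), ← lintegral_indicator hTm]
        congr 1
        refine lintegral_congr fun z => ?_
        by_cases hz : z ∈ T
        · rw [Set.indicator_of_mem hz, Set.indicator_of_mem hz, mul_one]
        · rw [Set.indicator_of_notMem hz, Set.indicator_of_notMem hz, mul_zero]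
    _ = schurConst d γ ^ (q - 1) *
          ∫⁻ w, F w ^ q * posOp γ (T.indicator fun _ => 1) w ∂halfMeasure d := by
        rw [lintegral_posOp_mul γ hFq hposT]
    _ ≤ schurConst d γ ^ (q - 1) *
          ∫⁻ w, ∑' j, A₀ * ENNReal.ofReal (r ^ d) * b j *
            (S j).indicator (fun w => F w ^ q) w ∂halfMeasure d := by
        gcongr 1
        refine lintegral_mono_ae ?_
        filter_upwards [ae_halfMeasure_pos d] with w hw using hpt w hw
    _ = schurConst d γ ^ (q - 1) *
          ∑' j, A₀ * ENNReal.ofReal (r ^ d) * b j * ∫⁻ w in S j, F w ^ q ∂halfMeasure d := by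
        congr 1
        rw [lintegral_tsum fun j =>
          ((hFq.indicator (measurableSet_tent _)).const_mul _).aemeasurable]
        refine tsum_congr fun j => ?_
        rw [lintegral_const_mul _ (hFq.indicator (measurableSet_tent _)),
          lintegral_indicator (measurableSet_tent _)]
    _ ≤ schurConst d γ ^ (q - 1) * ∑' j, A₀ * ENNReal.ofReal (r ^ d) * b j *
          (volume (Metric.ball c (2 ^ j * r)) * N) := by
        gcongr with j
        exact hN _ (le_mul_of_one_le_left hr.le (one_le_pow₀ one_le_two))
    _ = schurConst d γ ^ (q - 1) * B * (volume (Metric.ball c r) * N) := by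
        have e : ∀ j, A₀ * ENNReal.ofReal (r ^ d) * b j *
            (volume (Metric.ball c (2 ^ j * r)) * N) =
            A₀ * ENNReal.ofReal (r ^ d) * ENNReal.ofReal (2 ^ l) * unitVol d * N *
              ENNReal.ofReal ((2 : ℝ) ^ (-γ)) ^ j := by
          intro j
          rw [← mul_assoc, mul_assoc _ (b j), hb, hl, ofReal_decay_mul_volume_ball γ c hr]
          ring
        simp_rw [e]
        rw [ENNReal.tsum_mul_left, volume_ball_eq c hr, hB, geo]
        ring
    _ ≤ _ := by
        gcongr
        exact rpow_sub_one_mul_le hq.le le_self_add le_add_self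

/-! ### Duality with the maximal function -/

theorem coneInt_posOp {γ : ℝ} {Φ : Up d → ℝ≥0∞} (hΦ : Measurable Φ) (x : Pt d) :
    coneInt (posOp γ Φ) x = ∫⁻ w, Φ w * coneInt (fun z => ker γ z w) x ∂halfMeasure d := by
  have hG : Measurable ((cone x).indicator fun w : Up d => ENNReal.ofReal (w.2 ^ d)⁻¹) :=
    measurable_weight.indicator (measurableSet_cone x)
  have e : ∀ Ψ : Up d → ℝ≥0∞, coneInt Ψ x = ∫⁻ z, Ψ z * (cone x).indicator
      (fun w : Up d => ENNReal.ofReal (w.2 ^ d)⁻¹) z ∂halfMeasure d := by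
    intro Ψ
    rw [coneInt_eq]
    refine lintegral_congr fun z => ?_
    by_cases hz : z ∈ cone x
    · rw [Set.indicator_of_mem hz, Set.indicator_of_mem hz]
    · rw [Set.indicator_of_notMem hz, Set.indicator_of_notMem hz, mul_zero]
  rw [e, lintegral_posOp_mul γ hΦ hG]
  refine lintegral_congr fun w => ?_
  rw [e, posOp]
  simp_rw [ker_comm γ w]

/-- For fixed `g` the square function of `posOp γ F`, integrated against `g`, is controlled by
that of `F`, integrated against the maximal function of `g`. -/
theorem lintegral_mul_coneInt_posOp_le (d : ℕ) {γ : ℝ} (hγ : 0 < γ) :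
    ∃ A : ℝ≥0∞, A ≠ ∞ ∧ ∀ (q : ℝ), 1 < q → ∀ (F : Up d → ℝ≥0∞), Measurable F →
      ∀ g : Pt d → ℝ≥0∞, Measurable g →
      ∫⁻ x, g x * coneInt (fun z => posOp γ F z ^ q) x ≤
        A ^ q * ∫⁻ x, maxFun g x * coneInt (fun w => F w ^ q) x := by
  set c₁ : ℝ≥0∞ := ENNReal.ofReal (2 ^ ((d : ℝ) + γ)) * unitVol d * ENNReal.ofReal (2 / γ)
    with hc₁
  have hc₁t : c₁ ≠ ∞ := ENNReal.mul_ne_top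
    (ENNReal.mul_ne_top ENNReal.ofReal_ne_top (unitVol_ne_top d)) ENNReal.ofReal_ne_top
  set c₂ : ℝ≥0∞ := (unitVol d)⁻¹ * poisConst d γ with hc₂
  have hc₂t : c₂ ≠ ∞ :=
    ENNReal.mul_ne_top (ENNReal.inv_ne_top.2 (unitVol_ne_zero d)) (poisConst_ne_top d hγ)
  refine ⟨schurConst d γ + c₁ * c₂, ENNReal.add_ne_top.2
    ⟨schurConst_ne_top d hγ, ENNReal.mul_ne_top hc₁t hc₂t⟩, ?_⟩
  intro q hq F hF g hg
  have hFq : Measurable fun w => F w ^ q := hF.pow_const q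
  have hst : schurConst d γ ^ (q - 1) ≠ ∞ :=
    ENNReal.rpow_ne_top_of_nonneg (by linarith) (schurConst_ne_top d hγ)
  have hcone : ∀ x, coneInt (fun z => posOp γ F z ^ q) x ≤
      schurConst d γ ^ (q - 1) * c₁ * ∫⁻ w, F w ^ q * pois γ w x ∂halfMeasure d := by
    intro x
    calc coneInt (fun z => posOp γ F z ^ q) x
        ≤ coneInt (fun z => schurConst d γ ^ (q - 1) * posOp γ (fun w => F w ^ q) z) x :=
          coneInt_mono (fun z hz => posOp_rpow_le hγ hF hq hz) x
      _ = schurConst d γ ^ (q - 1) *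
          ∫⁻ w, F w ^ q * coneInt (fun z => ker γ z w) x ∂halfMeasure d := by
          rw [coneInt_const_mul hst, coneInt_posOp hFq]
      _ ≤ schurConst d γ ^ (q - 1) * ∫⁻ w, c₁ * (F w ^ q * pois γ w x) ∂halfMeasure d := by
          gcongr 1
          refine lintegral_mono_ae ?_
          filter_upwards [ae_halfMeasure_pos d] with w hw
          rw [mul_left_comm]
          gcongr
          exact coneInt_ker_le hγ hw x
      _ = _ := by rw [lintegral_const_mul' _ _ hc₁t, ← mul_assoc]
  have havg : ∀ w : Up d, 0 < w.2 → ∫⁻ x, g x * pois γ w x ≤ c₂ * ballMean (maxFun g) w := by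
    intro w hw
    have h1 : unitVol d * ∫⁻ x, g x * pois γ w x ≤ poisConst d γ * ballMean (maxFun g) w := by
      calc unitVol d * ∫⁻ x, g x * pois γ w x
          = ENNReal.ofReal (w.2 ^ d)⁻¹ *
              ∫⁻ _ in Metric.ball w.1 w.2, (∫⁻ x, g x * pois γ w x) := by
            rw [setLIntegral_const, ← inv_pow_mul_volume_ball w.1 hw]; ring
        _ ≤ ENNReal.ofReal (w.2 ^ d)⁻¹ *
              ∫⁻ x in Metric.ball w.1 w.2, poisConst d γ * maxFun g x := by
            gcongr 1
            exact setLIntegral_mono' Metric.isOpen_ball.measurableSet fun x hx =>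
              lintegral_mul_pois_le hγ hg hx
        _ = _ := by
            rw [lintegral_const_mul _ (measurable_maxFun g), ballMean]; ring
    calc ∫⁻ x, g x * pois γ w x
        = (unitVol d)⁻¹ * (unitVol d * ∫⁻ x, g x * pois γ w x) := by
          rw [← mul_assoc, ENNReal.inv_mul_cancel (unitVol_ne_zero d) (unitVol_ne_top d), one_mul]
      _ ≤ (unitVol d)⁻¹ * (poisConst d γ * ballMean (maxFun g) w) := by gcongr
      _ = _ := by rw [hc₂, mul_assoc]
  have hKt : schurConst d γ ^ (q - 1) * c₁ ≠ ∞ := ENNReal.mul_ne_top hst hc₁t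
  have hpois : ∀ w : Up d, Measurable (pois γ w) := measurable_pois γ
  calc ∫⁻ x, g x * coneInt (fun z => posOp γ F z ^ q) x
      ≤ ∫⁻ x, schurConst d γ ^ (q - 1) * c₁ *
          (∫⁻ w, g x * (F w ^ q * pois γ w x) ∂halfMeasure d) := by
        refine lintegral_mono fun x => ?_
        have hm : Measurable fun w : Up d => F w ^ q * pois γ w x :=
          hFq.mul ((measurable_pois_prod γ).comp (f := fun w : Up d => (x, w))
            measurable_prodMk_left)
        rw [lintegral_const_mul _ hm, mul_left_comm]
        gcongr
        exact hcone x
    _ = schurConst d γ ^ (q - 1) * c₁ *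
          ∫⁻ w, F w ^ q * (∫⁻ x, g x * pois γ w x) ∂halfMeasure d := by
        rw [lintegral_const_mul' _ _ hKt, lintegral_lintegral_swap]
        · congr 1
          refine lintegral_congr fun w => ?_
          refine Eq.trans ?_ (lintegral_const_mul (F w ^ q) (hg.mul (hpois w)))
          exact lintegral_congr fun x => mul_left_comm _ _ _
        · exact ((hg.comp measurable_fst).mul
            ((hFq.comp measurable_snd).mul (measurable_pois_prod γ))).aemeasurable
    _ ≤ schurConst d γ ^ (q - 1) * c₁ *
          ∫⁻ w, c₂ * (F w ^ q * ballMean (maxFun g) w) ∂halfMeasure d := by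
        gcongr 1
        refine lintegral_mono_ae ?_
        filter_upwards [ae_halfMeasure_pos d] with w hw
        rw [mul_left_comm]
        gcongr
        exact havg w hw
    _ = schurConst d γ ^ (q - 1) * (c₁ * c₂) *
          ∫⁻ x, maxFun g x * coneInt (fun w => F w ^ q) x := by
        rw [lintegral_const_mul' _ _ hc₂t, lintegral_mul_coneInt (measurable_maxFun g) hFq]
        ring
    _ ≤ _ := by
        gcongr
        exact rpow_sub_one_mul_le hq.le le_self_add le_add_self

/-! ### Truncation -/

/-- The boxes `{|y| ≤ n, 1/(n+1) ≤ s ≤ n}` exhaust the upper half-space. -/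
def box (d n : ℕ) : Set (Up d) := {w | dist w.1 0 ≤ n ∧ ((n : ℝ) + 1)⁻¹ ≤ w.2 ∧ w.2 ≤ n}

/-- The truncation of `H` to the box of index `n` and to the height `n`. -/
noncomputable def trunc (n : ℕ) (H : Up d → ℝ≥0∞) (w : Up d) : ℝ≥0∞ :=
  (box d n).indicator (fun w => min (H w) n) w

theorem measurableSet_box (d n : ℕ) : MeasurableSet (box d n) :=
  (measurableSet_le (measurable_fst.dist measurable_const) measurable_const).inter
    ((measurableSet_le measurable_const measurable_snd).inter
      (measurableSet_le measurable_snd measurable_const))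

theorem box_mono (d : ℕ) : Monotone (box d) := by
  intro m n hmn w hw
  have h : (m : ℝ) ≤ n := by exact_mod_cast hmn
  refine ⟨hw.1.trans h, le_trans ?_ hw.2.1, hw.2.2.trans h⟩
  gcongr

theorem eventually_mem_box {w : Up d} (hw : 0 < w.2) : ∀ᶠ n in Filter.atTop, w ∈ box d n := by
  obtain ⟨m₁, h₁⟩ := exists_nat_ge (dist w.1 0)
  obtain ⟨m₂, h₂⟩ := exists_nat_ge w.2
  obtain ⟨m₃, h₃⟩ := exists_nat_one_div_lt hw
  filter_upwards [Filter.eventually_ge_atTop (max m₁ (max m₂ m₃))] with n hn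
  have e₁ : (m₁ : ℝ) ≤ n := by exact_mod_cast (le_max_left _ _).trans hn
  have e₂ : (m₂ : ℝ) ≤ n := by
    exact_mod_cast ((le_max_left _ _).trans (le_max_right _ _)).trans hn
  have e₃ : (m₃ : ℝ) ≤ n := by
    exact_mod_cast ((le_max_right _ _).trans (le_max_right _ _)).trans hn
  refine ⟨h₁.trans e₁, le_trans ?_ h₃.le, h₂.trans e₂⟩
  rw [one_div]
  gcongr

theorem measurable_trunc (n : ℕ) {H : Up d → ℝ≥0∞} (hH : Measurable H) :
    Measurable (trunc n H) :=
  (hH.min measurable_const).indicator (measurableSet_box d n)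

theorem trunc_le (n : ℕ) (H : Up d → ℝ≥0∞) (w : Up d) : trunc n H w ≤ H w :=
  (Set.indicator_le_self (box d n) (fun w => min (H w) n) w).trans (min_le_left _ _)

theorem trunc_le_indicator (n : ℕ) (H : Up d → ℝ≥0∞) (w : Up d) :
    trunc n H w ≤ (box d n).indicator (fun _ => (n : ℝ≥0∞)) w :=
  Set.indicator_le_indicator (min_le_right _ _)

theorem trunc_mono (H : Up d → ℝ≥0∞) (w : Up d) : Monotone fun n => trunc n H w := by
  intro m n hmn
  have h : (m : ℝ≥0∞) ≤ n := by exact_mod_cast hmn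
  refine (Set.indicator_le_indicator_of_subset (f := fun w => min (H w) m) (box_mono d hmn)
    (fun _ => zero_le) w).trans ?_
  exact Set.indicator_le_indicator (min_le_min_left _ h)

theorem tendsto_trunc (H : Up d → ℝ≥0∞) {w : Up d} (hw : 0 < w.2) :
    Filter.Tendsto (fun n => trunc n H w) Filter.atTop (nhds (H w)) := by
  have h : Filter.Tendsto (fun n : ℕ => min (H w) n) Filter.atTop (nhds (H w)) := by
    simpa using (tendsto_const_nhds (x := H w)).min ENNReal.tendsto_nat_nhds_top
  refine h.congr' ?_
  filter_upwards [eventually_mem_box hw] with n hn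
  exact (Set.indicator_of_mem hn fun w => min (H w) (n : ℝ≥0∞)).symm

theorem tendsto_coneInt_trunc {H : Up d → ℝ≥0∞} (hH : Measurable H) {q : ℝ} (hq : 0 ≤ q)
    (x : Pt d) :
    Filter.Tendsto (fun n => coneInt (fun w => trunc n H w ^ q) x) Filter.atTop
      (nhds (coneInt (fun w => H w ^ q) x)) := by
  refine lintegral_tendsto_of_tendsto_of_monotone
    (fun n => (((measurable_trunc n hH).pow_const q).mul measurable_weight).aemeasurable) ?_ ?_
  · refine Filter.Eventually.of_forall fun w m n hmn => ?_
    dsimp only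
    gcongr
    exact trunc_mono H w hmn
  · filter_upwards [ae_restrict_mem (measurableSet_cone x)] with w hw
    refine ENNReal.Tendsto.mul_const ?_ (Or.inr ENNReal.ofReal_ne_top)
    exact (ENNReal.continuous_rpow_const.tendsto _).comp (tendsto_trunc H hw.1)

/-- A bound on the truncations of `H` is a bound on `H`. -/
theorem lintegral_coneInt_rpow_le_of_trunc {H : Up d → ℝ≥0∞} (hH : Measurable H) {q r : ℝ}
    (hq : 0 ≤ q) (hr : 0 ≤ r) {K : ℝ≥0∞}
    (h : ∀ n, ∫⁻ x, coneInt (fun w => trunc n H w ^ q) x ^ r ≤ K) :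
    ∫⁻ x, coneInt (fun w => H w ^ q) x ^ r ≤ K := by
  refine le_of_tendsto' (lintegral_tendsto_of_tendsto_of_monotone (fun n =>
    ((measurable_coneInt ((measurable_trunc n hH).pow_const q)).pow_const r).aemeasurable) ?_ ?_) h
  · refine Filter.Eventually.of_forall fun x m n hmn => ?_
    dsimp only
    gcongr
    refine coneInt_mono (fun w _ => ?_) x
    gcongr
    exact trunc_mono H w hmn
  · exact Filter.Eventually.of_forall fun x =>
      (ENNReal.continuous_rpow_const.tendsto _).comp (tendsto_coneInt_trunc hH hq x)

/-- The square functions of bounded functions supported in a box are bounded with bounded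
support. -/
theorem coneInt_le_of_le_box {F : Up d → ℝ≥0∞} {n : ℕ} {M : ℝ≥0∞} (hM : M ≠ ∞)
    (h : ∀ w, F w ≤ (box d n).indicator (fun _ => M) w) {q : ℝ} (hq : 0 < q) :
    ∃ C : ℝ≥0∞, C ≠ ∞ ∧ ∀ x, coneInt (fun w => F w ^ q) x ≤
      (Metric.ball (0 : Pt d) (2 * n + 1)).indicator (fun _ => C) x := by
  set I : Set ℝ := Set.Icc ((n : ℝ) + 1)⁻¹ n with hI
  have hIt : vertMeasure I ≠ ∞ := by
    have e := lintegral_vertMeasure (h := I.indicator fun _ => 1)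
      (measurable_const.indicator measurableSet_Icc)
    rw [lintegral_indicator_const measurableSet_Icc, one_mul] at e
    rw [e]
    have h1 : ∫⁻ t in Set.Ioi (0 : ℝ), ENNReal.ofReal t⁻¹ * I.indicator (fun _ => 1) t ≤
        ∫⁻ t, I.indicator (fun _ => ENNReal.ofReal ((n : ℝ) + 1)) t := by
      refine (setLIntegral_le_lintegral _ _).trans (lintegral_mono fun t => ?_)
      by_cases ht : t ∈ I
      · rw [Set.indicator_of_mem ht, Set.indicator_of_mem ht, mul_one]
        refine ENNReal.ofReal_le_ofReal ?_
        exact inv_le_of_inv_le₀ (by positivity) ht.1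
      · rw [Set.indicator_of_notMem ht, mul_zero]; exact zero_le
    refine (h1.trans_lt ?_).ne
    rw [lintegral_indicator_const measurableSet_Icc, Real.volume_Icc]
    exact ENNReal.mul_lt_top ENNReal.ofReal_lt_top ENNReal.ofReal_lt_top
  refine ⟨M ^ q * (unitVol d * vertMeasure I), ENNReal.mul_ne_top
    (ENNReal.rpow_ne_top_of_nonneg hq.le hM) (ENNReal.mul_ne_top (unitVol_ne_top d) hIt), ?_⟩
  intro x
  have hMq : M ^ q ≠ ∞ := ENNReal.rpow_ne_top_of_nonneg hq.le hM
  have hzero : ∀ w, w ∉ box d n → F w ^ q = 0 := by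
    intro w hw
    have := h w
    rw [Set.indicator_of_notMem hw, nonpos_iff_eq_zero] at this
    rw [this, ENNReal.zero_rpow_of_pos hq]
  by_cases hx : x ∈ Metric.ball (0 : Pt d) (2 * n + 1)
  · rw [Set.indicator_of_mem hx]
    calc coneInt (fun w => F w ^ q) x
        ≤ coneInt (fun w => M ^ q * I.indicator (fun _ => 1) w.2) x := by
          refine coneInt_mono (fun w _ => ?_) x
          by_cases hw : w ∈ box d n
          · have h1 := h w
            rw [Set.indicator_of_mem hw] at h1
            rw [Set.indicator_of_mem (show w.2 ∈ I from hw.2), mul_one]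
            gcongr
          · rw [hzero w hw]; exact zero_le
      _ = _ := by
          rw [coneInt_const_mul hMq,
            coneInt_vert (measurable_const.indicator measurableSet_Icc),
            lintegral_indicator_const measurableSet_Icc, one_mul]
  · rw [Set.indicator_of_notMem hx]
    refine le_of_eq ((setLIntegral_congr_fun (measurableSet_cone x) fun w hw => ?_).trans
      lintegral_zero)
    have hwb : w ∉ box d n := by
      intro hwb
      refine hx ?_
      rw [Metric.mem_ball]
      have h1 := dist_triangle_left x 0 w.1
      have h2 : dist w.1 x < w.2 := hw.2
      have h3 := hwb.1
      have h4 := hwb.2.2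
      linarith
    simp only [hzero w hwb, zero_mul]

theorem lintegral_coneInt_rpow_ne_top_of_le_box {F : Up d → ℝ≥0∞} {n : ℕ} {M : ℝ≥0∞}
    (hM : M ≠ ∞) (h : ∀ w, F w ≤ (box d n).indicator (fun _ => M) w) {q r : ℝ} (hq : 0 < q)
    (hr : 0 < r) : ∫⁻ x, coneInt (fun w => F w ^ q) x ^ r ≠ ∞ := by
  obtain ⟨C, hC, hle⟩ := coneInt_le_of_le_box hM h hq
  have h1 : ∫⁻ x, coneInt (fun w => F w ^ q) x ^ r ≤
      ∫⁻ x, (Metric.ball (0 : Pt d) (2 * n + 1)).indicator (fun _ => C ^ r) x := by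
    refine lintegral_mono fun x => ?_
    have := hle x
    by_cases hx : x ∈ Metric.ball (0 : Pt d) (2 * n + 1)
    · rw [Set.indicator_of_mem hx] at this ⊢
      gcongr
    · rw [Set.indicator_of_notMem hx, nonpos_iff_eq_zero] at this
      rw [this, ENNReal.zero_rpow_of_pos hr]
      exact zero_le
  refine (h1.trans_lt ?_).ne
  rw [lintegral_indicator_const Metric.isOpen_ball.measurableSet]
  exact ENNReal.mul_lt_top (ENNReal.rpow_lt_top_of_nonneg hr.le hC) measure_ball_lt_top

/-! ### The tent space bound for exponents at least `q` -/

/-- Absorbing a power of a finite quantity into the left-hand side. -/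
theorem le_rpow_of_le_mul_rpow {I K : ℝ≥0∞} {r : ℝ} (hr : 1 ≤ r) (hI : I ≠ ∞)
    (h : I ≤ K * I ^ (1 - 1 / r)) : I ≤ K ^ r := by
  have hr0 : 0 < r := by linarith
  rcases eq_or_ne I 0 with h0 | h0
  · rw [h0]; exact zero_le
  have h1 : I ^ (1 / r) ≤ K := by
    have e : I ^ (1 / r) * I ^ (1 - 1 / r) = I := by
      rw [← ENNReal.rpow_add _ _ h0 hI, add_sub_cancel, ENNReal.rpow_one]
    have hc0 : I ^ (1 - 1 / r) ≠ 0 := by simp [ENNReal.rpow_eq_zero_iff, h0, hI]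
    have hct : I ^ (1 - 1 / r) ≠ ∞ := by
      refine ENNReal.rpow_ne_top_of_nonneg ?_ hI
      rw [sub_nonneg, div_le_one hr0]; exact hr
    refine (ENNReal.mul_le_mul_iff_left hc0 hct).1 ?_
    rw [e]
    exact h
  calc I = (I ^ (1 / r)) ^ r := by
        rw [← ENNReal.rpow_mul, one_div, inv_mul_cancel₀ hr0.ne', ENNReal.rpow_one]
    _ ≤ K ^ r := by gcongr

/-- If the square function `u` is integrated against its own power `u ^ (r - 1)`, the maximal
function costs a factor proportional to `r`. -/
theorem lintegral_maxFun_rpow_mul_le (hd : 1 ≤ d) {u v : Pt d → ℝ≥0∞} (hu : Measurable u)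
    (hv : Measurable v) {r : ℝ} (hr : 1 ≤ r) :
    ∫⁻ x, maxFun (fun y => u y ^ (r - 1)) x * v x ≤
      ENNReal.ofReal (2 * 4 ^ d * r) * (∫⁻ x, v x ^ r) ^ (1 / r) *
        (∫⁻ x, u x ^ r) ^ (1 - 1 / r) := by
  have hr0 : 0 < r := by linarith
  have h4 : (1 : ℝ) ≤ 4 ^ d := one_le_pow₀ (by norm_num)
  rcases eq_or_lt_of_le hr with rfl | hr1
  · simp only [sub_self, ENNReal.rpow_zero, ENNReal.rpow_one, div_one, mul_one]
    calc ∫⁻ x, maxFun (fun _ => 1) x * v x ≤ ∫⁻ x, v x :=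
          lintegral_mono fun x => mul_le_of_le_one_left' (maxFun_one_le x)
      _ ≤ _ := by
          refine le_mul_of_one_le_left' ?_
          rw [ENNReal.one_le_ofReal]
          linarith
  set r' : ℝ := r / (r - 1) with hr'
  have hr1' : 0 < r - 1 := by linarith
  have hr'1 : 1 < r' := by rw [hr', one_lt_div hr1']; linarith
  have hr'0 : 0 < r' := by linarith
  have hinv : 1 / r' = 1 - 1 / r := by rw [hr']; field_simp
  have hconj : r.HolderConjugate r' := by
    rw [Real.holderConjugate_iff]
    exact ⟨hr1, by rw [← one_div r', hinv, ← one_div]; ring⟩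
  have hM : Measurable (maxFun fun y => u y ^ (r - 1)) := measurable_maxFun _
  calc ∫⁻ x, maxFun (fun y => u y ^ (r - 1)) x * v x
      = ∫⁻ x, (v * maxFun fun y => u y ^ (r - 1)) x :=
        lintegral_congr fun x => by rw [Pi.mul_apply, mul_comm]
    _ ≤ (∫⁻ x, v x ^ r) ^ (1 / r) * (∫⁻ x, maxFun (fun y => u y ^ (r - 1)) x ^ r') ^ (1 / r') :=
        ENNReal.lintegral_mul_le_Lp_mul_Lq _ hconj hv.aemeasurable hM.aemeasurable
    _ ≤ (∫⁻ x, v x ^ r) ^ (1 / r) *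
          (ENNReal.ofReal (2 ^ r' * 4 ^ d * (r' / (r' - 1))) *
            ∫⁻ x, (u x ^ (r - 1)) ^ r') ^ (1 / r') := by
        gcongr
        exact lintegral_maxFun_rpow_le hd (hu.pow_const _) hr'1
    _ = (∫⁻ x, v x ^ r) ^ (1 / r) *
          (ENNReal.ofReal (2 ^ r' * (4 ^ d * r)) ^ (1 / r') *
            (∫⁻ x, u x ^ r) ^ (1 - 1 / r)) := by
        have e1 : r' / (r' - 1) = r := by rw [hr']; field_simp; ring
        have e2 : ∀ x, (u x ^ (r - 1)) ^ r' = u x ^ r := fun x => by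
          rw [← ENNReal.rpow_mul, hr', mul_div_cancel₀ _ hr1'.ne']
        simp_rw [e2]
        rw [e1, ENNReal.mul_rpow_of_nonneg _ _ (by positivity), ← hinv, mul_assoc (2 ^ r')]
    _ ≤ (∫⁻ x, v x ^ r) ^ (1 / r) *
          (ENNReal.ofReal (2 * 4 ^ d * r) * (∫⁻ x, u x ^ r) ^ (1 - 1 / r)) := by
        gcongr
        rw [ENNReal.ofReal_rpow_of_nonneg (by positivity) (by positivity)]
        refine ENNReal.ofReal_le_ofReal ?_
        rw [Real.mul_rpow (by positivity) (by positivity), ← Real.rpow_mul (by norm_num),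
          mul_one_div_cancel hr'0.ne', Real.rpow_one, mul_assoc 2]
        gcongr
        refine Real.rpow_le_self_of_one_le ?_ ?_
        · exact one_le_mul_of_one_le_of_one_le h4 hr
        · rw [div_le_one hr'0]; exact hr'1.le
    _ = _ := by ring

theorem lintegral_coneInt_posOp_le_of_ge (hd : 1 ≤ d) {γ : ℝ} (hγ : 0 < γ) :
    ∃ A : ℝ≥0∞, A ≠ ∞ ∧ ∀ (p q : ℝ), 1 < q → q ≤ p → ∀ (F : Up d → ℝ≥0∞), Measurable F →
      ∫⁻ x, coneInt (fun z => posOp γ F z ^ q) x ^ (p / q) ≤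
        (A * ENNReal.ofReal p ^ (1 / q)) ^ p * ∫⁻ x, coneInt (fun w => F w ^ q) x ^ (p / q) := by
  obtain ⟨A₀, hA₀, hdual⟩ := lintegral_mul_coneInt_posOp_le d hγ
  set B : ℝ := 2 * 4 ^ d with hB
  have hB1 : 1 ≤ B := by
    have h4 : (1 : ℝ) ≤ 4 ^ d := one_le_pow₀ (by norm_num)
    linarith
  refine ⟨A₀ * ENNReal.ofReal B, ENNReal.mul_ne_top hA₀ ENNReal.ofReal_ne_top, ?_⟩
  intro p q hq hqp F hF
  have hq0 : 0 < q := by linarith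
  have hp0 : 0 < p := by linarith
  set r := p / q with hr
  have hr1 : 1 ≤ r := (one_le_div hq0).2 hqp
  have hr0 : 0 < r := by linarith
  have hPF := measurable_posOp γ hF
  set J := ∫⁻ x, coneInt (fun w => F w ^ q) x ^ r with hJ
  -- The truncation makes `I` below finite, so that its power on the right can be absorbed.
  refine lintegral_coneInt_rpow_le_of_trunc hPF hq0.le hr0.le fun n => ?_
  set u : Pt d → ℝ≥0∞ := coneInt fun w => trunc n (posOp γ F) w ^ q with hu
  have hum : Measurable u := measurable_coneInt ((measurable_trunc n hPF).pow_const q)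
  have hvm : Measurable (coneInt fun w => F w ^ q) := measurable_coneInt (hF.pow_const q)
  set I := ∫⁻ x, u x ^ r with hI
  have hIt : I ≠ ∞ := lintegral_coneInt_rpow_ne_top_of_le_box (ENNReal.natCast_ne_top n)
    (trunc_le_indicator n _) hq0 hr0
  have h1 : I ≤ A₀ ^ q * ENNReal.ofReal (B * r) * J ^ (1 / r) * I ^ (1 - 1 / r) := by
    calc I = ∫⁻ x, u x ^ (r - 1) * u x := by
          refine lintegral_congr fun x => ?_
          nth_rewrite 3 [← ENNReal.rpow_one (u x)]
          rw [← ENNReal.rpow_add_of_nonneg _ _ (by linarith) zero_le_one, sub_add_cancel]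
      _ ≤ ∫⁻ x, u x ^ (r - 1) * coneInt (fun z => posOp γ F z ^ q) x := by
          refine lintegral_mono fun x => ?_
          gcongr
          refine coneInt_mono (fun w _ => ?_) x
          gcongr
          exact trunc_le n _ w
      _ ≤ A₀ ^ q * ∫⁻ x, maxFun (fun y => u y ^ (r - 1)) x * coneInt (fun w => F w ^ q) x :=
          hdual q hq F hF _ (hum.pow_const _)
      _ ≤ A₀ ^ q * (ENNReal.ofReal (B * r) * J ^ (1 / r) * I ^ (1 - 1 / r)) := by
          gcongr
          exact lintegral_maxFun_rpow_mul_le hd hum hvm hr1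
      _ = _ := by ring
  calc I ≤ (A₀ ^ q * ENNReal.ofReal (B * r) * J ^ (1 / r)) ^ r :=
        le_rpow_of_le_mul_rpow hr1 hIt h1
    _ = (A₀ ^ q * ENNReal.ofReal (B * r)) ^ r * J := by
        rw [ENNReal.mul_rpow_of_nonneg _ _ hr0.le, ← ENNReal.rpow_mul, one_div,
          inv_mul_cancel₀ hr0.ne', ENNReal.rpow_one]
    _ ≤ ((A₀ * ENNReal.ofReal B * ENNReal.ofReal p ^ (1 / q)) ^ q) ^ r * J := by
        gcongr
        rw [ENNReal.mul_rpow_of_nonneg _ _ hq0.le, ENNReal.mul_rpow_of_nonneg _ _ hq0.le,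
          ← ENNReal.rpow_mul, one_div, inv_mul_cancel₀ hq0.ne', ENNReal.rpow_one,
          mul_assoc (A₀ ^ q)]
        gcongr
        rw [ENNReal.ofReal_rpow_of_nonneg (by linarith) hq0.le,
          ← ENNReal.ofReal_mul (by positivity)]
        refine ENNReal.ofReal_le_ofReal ?_
        have : r ≤ p := div_le_self hp0.le hq.le
        gcongr
        exact Real.self_le_rpow_of_one_le hB1 hq.le
    _ = _ := by
        rw [← ENNReal.rpow_mul, hr, mul_div_cancel₀ _ hq0.ne']

/-! ### Pairing with Carleson functions -/

/-- A sublevel set of the distribution function of a measure has measure at most the level. -/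
theorem measure_sublevel_le (ν : Measure ℝ) (L : ℝ≥0∞) : ν {s | ν (Set.Iic s) ≤ L} ≤ L := by
  set S : Set ℝ := {s | ν (Set.Iic s) ≤ L} with hS
  have hdown : ∀ s ∈ S, ∀ t, t ≤ s → t ∈ S := fun s hs t hts =>
    (measure_mono (Set.Iic_subset_Iic.2 hts)).trans hs
  by_cases hmax : ∃ m ∈ S, ∀ s ∈ S, s ≤ m
  · obtain ⟨m, hm, hle⟩ := hmax
    exact (measure_mono hle).trans hm
  · push Not at hmax
    have hsub : S ⊆ ⋃ a : {a : ℚ // (a : ℝ) ∈ S}, Set.Iic ((a : ℚ) : ℝ) := by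
      intro s hs
      obtain ⟨s', hs', hlt⟩ := hmax s hs
      obtain ⟨a, ha1, ha2⟩ := exists_rat_btwn hlt
      exact Set.mem_iUnion.2 ⟨⟨a, hdown s' hs' a ha2.le⟩, ha1.le⟩
    refine (measure_mono hsub).trans ?_
    rw [Directed.measure_iUnion]
    · exact iSup_le fun a => a.2
    · refine Monotone.directed_le fun a b hab => Set.Iic_subset_Iic.2 ?_
      exact_mod_cast hab

/-- The part of `Φ` below height `s`. -/
noncomputable def below (Φ : Up d → ℝ≥0∞) (s : ℝ) : Up d → ℝ≥0∞ :=
  {w : Up d | w.2 ≤ s}.indicator Φ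

theorem measurable_coneInt_below {Φ : Up d → ℝ≥0∞} (hΦ : Measurable Φ) :
    Measurable fun p : ℝ × Pt d => coneInt (below Φ p.1) p.2 := by
  refine measurable_coneInt_prod (Φ := fun s => below Φ s) ?_
  have hm : MeasurableSet {p : ℝ × Up d | p.2.2 ≤ p.1} :=
    measurableSet_le (measurable_snd.comp measurable_snd) measurable_fst
  exact (hΦ.comp measurable_snd).indicator hm

/-- Stopping a cone integral at the heights where it is still at most `L` leaves at most `L`. -/
theorem coneInt_stopped_le {Φ : Up d → ℝ≥0∞} (hΦ : Measurable Φ) (x : Pt d) (L : ℝ≥0∞) :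
    coneInt ({w : Up d | coneInt (below Φ w.2) x ≤ L}.indicator Φ) x ≤ L := by
  set ν₀ : Measure (Up d) := ((halfMeasure d).restrict (cone x)).withDensity
    fun w => Φ w * ENNReal.ofReal (w.2 ^ d)⁻¹ with hν₀
  have key : ∀ T : Set (Up d), MeasurableSet T → ν₀ T = coneInt (T.indicator Φ) x := by
    intro T hT
    rw [hν₀, withDensity_apply _ hT, ← lintegral_indicator hT, coneInt]
    refine lintegral_congr fun w => ?_
    by_cases hw : w ∈ T
    · rw [Set.indicator_of_mem hw, Set.indicator_of_mem hw]
    · rw [Set.indicator_of_notMem hw, Set.indicator_of_notMem hw, zero_mul]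
  have hIic : ∀ s : ℝ, ν₀.map Prod.snd (Set.Iic s) = coneInt (below Φ s) x := by
    intro s
    rw [Measure.map_apply measurable_snd measurableSet_Iic,
      key _ (measurable_snd measurableSet_Iic)]
    rfl
  have hmeas : MeasurableSet {s : ℝ | coneInt (below Φ s) x ≤ L} :=
    measurableSet_le ((measurable_coneInt_below hΦ).comp (f := fun s : ℝ => (s, x))
      measurable_prodMk_right) measurable_const
  have h := measure_sublevel_le (ν₀.map Prod.snd) L
  simp_rw [hIic] at h
  rw [Measure.map_apply measurable_snd hmeas, key _ (measurable_snd hmeas)] at h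
  exact h

theorem setLIntegral_ball_coneInt_below_le {Φ : Up d → ℝ≥0∞} (hΦ : Measurable Φ) (w : Up d) :
    ∫⁻ x in Metric.ball w.1 w.2, coneInt (below Φ w.2) x ≤
      unitVol d * ∫⁻ z in tent (Metric.ball w.1 (3 * w.2)), Φ z ∂halfMeasure d := by
  set T := tent (Metric.ball w.1 (3 * w.2)) with hT
  have hTm : MeasurableSet T := measurableSet_tent _
  calc ∫⁻ x in Metric.ball w.1 w.2, coneInt (below Φ w.2) x
      ≤ ∫⁻ x in Metric.ball w.1 w.2, coneInt (T.indicator Φ) x := by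
        refine setLIntegral_mono' Metric.isOpen_ball.measurableSet fun x hx => ?_
        refine setLIntegral_mono' (measurableSet_cone x) fun z hz => ?_
        gcongr
        by_cases hzs : z.2 ≤ w.2
        · have hzT : z ∈ T := by
            refine mem_tent_ball hz.1 ?_
            have h1 := dist_triangle z.1 x w.1
            have h2 : dist z.1 x < z.2 := hz.2
            have h3 : dist x w.1 < w.2 := hx
            linarith
          rw [Set.indicator_of_mem hzT]
          exact Set.indicator_le_self _ _ _
        · rw [below, Set.indicator_of_notMem (show z ∉ {w' : Up d | w'.2 ≤ w.2} from hzs)]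
          exact zero_le
    _ ≤ ∫⁻ x, coneInt (T.indicator Φ) x := setLIntegral_le_lintegral _ _
    _ = _ := by rw [lintegral_coneInt_eq (hΦ.indicator hTm), lintegral_indicator hTm]

/-- Chebyshev's inequality, in the form that a set where `f` is small fills half of the space. -/
theorem measure_univ_le_two_mul {α : Type*} [MeasurableSpace α] {ν : Measure α} [IsFiniteMeasure ν]
    {f : α → ℝ≥0∞} (hf : Measurable f) {M : ℝ≥0∞} (hM0 : M ≠ 0) (hM : M ≠ ∞)
    (h : ∫⁻ x, f x ∂ν ≤ M * ν Set.univ) : ν Set.univ ≤ 2 * ν {x | f x ≤ 2 * M} := by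
  have h1 : 2 * M * ν {x | 2 * M ≤ f x} ≤ M * ν Set.univ :=
    (mul_meas_ge_le_lintegral hf _).trans h
  have h2 : 2 * ν {x | 2 * M ≤ f x} ≤ ν Set.univ := by
    rw [mul_comm 2 M, mul_assoc, mul_comm M 2] at h1
    exact (ENNReal.mul_le_mul_iff_right hM0 hM).1 h1
  have h3 : ν Set.univ ≤ ν {x | f x ≤ 2 * M} + ν {x | 2 * M ≤ f x} := by
    refine (measure_mono fun x _ => ?_).trans (measure_union_le _ _)
    exact le_total (f x) (2 * M)
  have h4 : ν Set.univ + ν Set.univ ≤ 2 * ν {x | f x ≤ 2 * M} + ν Set.univ := by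
    calc ν Set.univ + ν Set.univ = 2 * ν Set.univ := (two_mul _).symm
      _ ≤ 2 * (ν {x | f x ≤ 2 * M} + ν {x | 2 * M ≤ f x}) := by gcongr
      _ ≤ _ := by rw [mul_add]; gcongr
  exact (ENNReal.add_le_add_iff_right (measure_ne_top ν _)).1 h4

/-- Half of the duality between tent spaces and Carleson functions: if `U ^ q'` satisfies a
Carleson condition, then `F ↦ ∫ F U` is controlled by the `L^1` norm of the square function. The
cone with vertex `x` is stopped where the square function of `U` becomes too large; by
Chebyshev's inequality each `w` survives for at least half of the vertices. -/
theorem lintegral_mul_le_of_carleson (d : ℕ) :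
    ∃ A : ℝ≥0∞, A ≠ ∞ ∧ ∀ (q q' : ℝ), q.HolderConjugate q' → ∀ (F U : Up d → ℝ≥0∞),
      Measurable F → Measurable U → ∀ Θ : ℝ≥0∞, Θ ≠ 0 → Θ ≠ ∞ →
      (∀ (c : Pt d) (r : ℝ), 0 < r →
        ∫⁻ w in tent (Metric.ball c r), U w ^ q' ∂halfMeasure d ≤
          Θ ^ q' * volume (Metric.ball c r)) →
      ∫⁻ w, F w * U w ∂halfMeasure d ≤ A * Θ * ∫⁻ x, coneInt (fun w => F w ^ q) x ^ (1 / q) := by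
  have hu0 := unitVol_ne_zero d
  have hut := unitVol_ne_top d
  set b : ℝ≥0∞ := 1 + 2 * (3 ^ d * unitVol d) with hb
  have hbt : b ≠ ∞ := by rw [hb]; finiteness
  refine ⟨(unitVol d)⁻¹ * (2 * b), ENNReal.mul_ne_top (ENNReal.inv_ne_top.2 hu0)
    (ENNReal.mul_ne_top (by norm_num) hbt), ?_⟩
  intro q q' hqq F U hF hU Θ hΘ0 hΘ hcarl
  have hq0 : 0 < q := hqq.pos
  have hq'0 : 0 < q' := hqq.symm.pos
  have hq'1 : 1 < q' := hqq.symm.lt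
  set Φ : Up d → ℝ≥0∞ := fun w => U w ^ q' with hΦdef
  have hΦ : Measurable Φ := hU.pow_const q'
  set M : ℝ≥0∞ := 3 ^ d * unitVol d * Θ ^ q' with hMdef
  have hΘq0 : Θ ^ q' ≠ 0 := by simp [ENNReal.rpow_eq_zero_iff, hΘ0, hΘ]
  have hΘqt : Θ ^ q' ≠ ∞ := ENNReal.rpow_ne_top_of_nonneg hq'0.le hΘ
  have hM0 : M ≠ 0 := mul_ne_zero (mul_ne_zero (by positivity) hu0) hΘq0
  have hMt : M ≠ ∞ := by rw [hMdef]; finiteness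
  set L : ℝ≥0∞ := 2 * M with hL
  have hA := measurable_coneInt_below hΦ
  set E : Set (Pt d × Up d) := {p | coneInt (below Φ p.2.2) p.1 ≤ L} with hE
  have hEm : MeasurableSet E :=
    measurableSet_le (hA.comp (f := fun p : Pt d × Up d => (p.2.2, p.1))
      ((measurable_snd.comp measurable_snd).prodMk measurable_fst)) measurable_const
  have hhalf : ∀ w : Up d, 0 < w.2 → volume (Metric.ball w.1 w.2) ≤
      2 * ∫⁻ x in Metric.ball w.1 w.2, E.indicator (fun _ => 1) (x, w) := by
    intro w hw
    have hm : Measurable (coneInt (below Φ w.2)) :=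
      hA.comp (f := fun x : Pt d => (w.2, x)) measurable_prodMk_left
    have : IsFiniteMeasure (volume.restrict (Metric.ball w.1 w.2)) :=
      ⟨by rw [Measure.restrict_apply_univ]; exact measure_ball_lt_top⟩
    have h1 := measure_univ_le_two_mul (ν := volume.restrict (Metric.ball w.1 w.2)) hm hM0 hMt ?_
    · rw [Measure.restrict_apply_univ] at h1
      refine h1.trans (le_of_eq ?_)
      congr 1
      have hms : MeasurableSet {x | coneInt (below Φ w.2) x ≤ 2 * M} :=
        measurableSet_le hm measurable_const
      rw [← lintegral_indicator_one hms]
      rfl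
    · rw [Measure.restrict_apply_univ]
      refine (setLIntegral_ball_coneInt_below_le hΦ w).trans ?_
      calc unitVol d * ∫⁻ z in tent (Metric.ball w.1 (3 * w.2)), Φ z ∂halfMeasure d
          ≤ unitVol d * (Θ ^ q' * volume (Metric.ball w.1 (3 * w.2))) := by
            gcongr
            exact hcarl _ _ (by positivity)
        _ = M * volume (Metric.ball w.1 w.2) := by
            rw [volume_ball_eq _ hw, volume_ball_eq _ (by positivity), mul_pow,
              ENNReal.ofReal_mul (by positivity), ENNReal.ofReal_pow (by norm_num),
              ENNReal.ofReal_ofNat, hMdef]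
            ring
  have hcone : ∀ x, coneInt (fun w => E.indicator (fun p => F p.2 * U p.2) (x, w)) x ≤
      coneInt (fun w => F w ^ q) x ^ (1 / q) * L ^ (1 / q') := by
    intro x
    set S : Set (Up d) := {w : Up d | coneInt (below Φ w.2) x ≤ L} with hS
    have hSm : MeasurableSet S := measurableSet_le
      (hA.comp (f := fun w : Up d => (w.2, x)) (measurable_snd.prodMk measurable_const))
      measurable_const
    have hsum : 1 / q + 1 / q' = 1 := by rw [one_div, one_div, hqq.inv_add_inv_eq_one]
    calc coneInt (fun w => E.indicator (fun p => F p.2 * U p.2) (x, w)) x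
        ≤ coneInt (fun w => (F w ^ q) ^ (1 / q) * S.indicator Φ w ^ (1 / q')) x := by
          refine coneInt_mono (fun w _ => le_of_eq ?_) x
          by_cases hw : w ∈ S
          · rw [Set.indicator_of_mem hw, Set.indicator_of_mem (show (x, w) ∈ E from hw),
              ← ENNReal.rpow_mul, ← ENNReal.rpow_mul, mul_one_div_cancel hq0.ne',
              mul_one_div_cancel hq'0.ne', ENNReal.rpow_one, ENNReal.rpow_one]
          · rw [Set.indicator_of_notMem hw, Set.indicator_of_notMem (show (x, w) ∉ E from hw),
              ENNReal.zero_rpow_of_pos (by positivity), mul_zero]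
      _ ≤ coneInt (fun w => F w ^ q) x ^ (1 / q) * coneInt (S.indicator Φ) x ^ (1 / q') :=
          coneInt_mul_rpow_le (hF.pow_const q) (hΦ.indicator hSm) (by positivity) (by positivity)
            hsum x
      _ ≤ _ := by
          gcongr
          exact coneInt_stopped_le hΦ x L
  have hFU : Measurable fun p : Pt d × Up d => F p.2 * U p.2 := (hF.mul hU).comp measurable_snd
  have hLb : L ^ (1 / q') ≤ b * Θ := by
    rw [hL, hMdef, ← mul_assoc, ENNReal.mul_rpow_of_nonneg _ _ (by positivity), ← ENNReal.rpow_mul,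
      mul_one_div_cancel hq'0.ne', ENNReal.rpow_one]
    gcongr
    calc (2 * (3 ^ d * unitVol d)) ^ (1 / q') ≤ b ^ (1 / q') := by
          gcongr; exact le_add_self
      _ ≤ b ^ (1 : ℝ) := by
          refine ENNReal.rpow_le_rpow_of_exponent_le le_self_add ?_
          rw [div_le_one hq'0]; exact hq'1.le
      _ = b := ENNReal.rpow_one b
  calc ∫⁻ w, F w * U w ∂halfMeasure d
      = (unitVol d)⁻¹ * (unitVol d * ∫⁻ w, F w * U w ∂halfMeasure d) := by
        rw [← mul_assoc, ENNReal.inv_mul_cancel hu0 hut, one_mul]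
    _ ≤ (unitVol d)⁻¹ * (2 *
          ∫⁻ x, coneInt (fun w => E.indicator (fun p => F p.2 * U p.2) (x, w)) x) := by
        gcongr 1
        rw [lintegral_coneInt (Φ := fun x w => E.indicator (fun p => F p.2 * U p.2) (x, w))
          (hFU.indicator hEm), ← lintegral_const_mul' _ _ hut,
          ← lintegral_const_mul' _ _ (by norm_num)]
        refine lintegral_mono_ae ?_
        filter_upwards [ae_halfMeasure_pos d] with w hw
        have e : ∀ x, E.indicator (fun p => F p.2 * U p.2) (x, w) =
            F w * U w * E.indicator (fun _ => 1) (x, w) := by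
          intro x
          by_cases hx : (x, w) ∈ E
          · rw [Set.indicator_of_mem hx, Set.indicator_of_mem hx, mul_one]
          · rw [Set.indicator_of_notMem hx, Set.indicator_of_notMem hx, mul_zero]
        have hm1 : Measurable fun x : Pt d => E.indicator (fun _ => (1 : ℝ≥0∞)) (x, w) :=
          (measurable_const.indicator hEm).comp (f := fun x : Pt d => (x, w))
            measurable_prodMk_right
        simp_rw [e]
        rw [lintegral_const_mul _ hm1, ← inv_pow_mul_volume_ball w.1 hw]
        calc ENNReal.ofReal (w.2 ^ d)⁻¹ * volume (Metric.ball w.1 w.2) * (F w * U w)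
            ≤ ENNReal.ofReal (w.2 ^ d)⁻¹ *
              (2 * ∫⁻ x in Metric.ball w.1 w.2, E.indicator (fun _ => 1) (x, w)) *
                (F w * U w) := by
              gcongr
              exact hhalf w hw
          _ = _ := by ring
    _ ≤ (unitVol d)⁻¹ * (2 * ∫⁻ x, coneInt (fun w => F w ^ q) x ^ (1 / q) * (b * Θ)) := by
        gcongr with x
        refine (hcone x).trans ?_
        gcongr
    _ = _ := by
        rw [lintegral_mul_const' _ _ (ENNReal.mul_ne_top hbt hΘ)]
        ring

/-! ### The tent space bound for the exponent one -/

theorem ballMean_eq_lintegral (g : Pt d → ℝ≥0∞) (w : Up d) :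
    ballMean g w = ∫⁻ x, g x
      ∂(ENNReal.ofReal (w.2 ^ d)⁻¹ • (volume : Measure (Pt d)).restrict (Metric.ball w.1 w.2)) := by
  rw [lintegral_smul_measure]
  rfl

theorem ballMean_mul_rpow_le {f g : Pt d → ℝ≥0∞} (hf : Measurable f) (hg : Measurable g)
    {a b : ℝ} (ha : 0 ≤ a) (hb : 0 ≤ b) (hab : a + b = 1) (w : Up d) :
    ballMean (fun x => f x ^ a * g x ^ b) w ≤ ballMean f w ^ a * ballMean g w ^ b := by
  simp_rw [ballMean_eq_lintegral]
  exact ENNReal.lintegral_mul_norm_pow_le hf.aemeasurable hg.aemeasurable ha hb hab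

theorem ballMean_mono {f g : Pt d → ℝ≥0∞} {w : Up d}
    (h : ∀ x ∈ Metric.ball w.1 w.2, f x ≤ g x) : ballMean f w ≤ ballMean g w := by
  unfold ballMean
  gcongr 1
  exact setLIntegral_mono' Metric.isOpen_ball.measurableSet h

/-- Jensen's inequality for averages over balls. -/
theorem ballMean_rpow_le {f : Pt d → ℝ≥0∞} (hf : Measurable f) {q : ℝ} (hq : 1 ≤ q) {w : Up d}
    (hw : 0 < w.2) :
    ballMean f w ^ q ≤ unitVol d ^ (q - 1) * ballMean (fun x => f x ^ q) w := by
  have hq0 : 0 < q := by linarith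
  have h := ballMean_mul_rpow_le (f := fun _ => 1) measurable_const (hf.pow_const q)
    (a := 1 - 1 / q) (b := 1 / q) (by rw [sub_nonneg, div_le_one hq0]; exact hq) (by positivity)
    (by ring) w
  have e : (fun x => (1 : ℝ≥0∞) ^ (1 - 1 / q) * (f x ^ q) ^ (1 / q)) = f := by
    funext x
    rw [ENNReal.one_rpow, one_mul, ← ENNReal.rpow_mul, mul_one_div_cancel hq0.ne',
      ENNReal.rpow_one]
  rw [e, ballMean_one hw] at h
  calc ballMean f w ^ q
      ≤ (unitVol d ^ (1 - 1 / q) * ballMean (fun x => f x ^ q) w ^ (1 / q)) ^ q := by gcongr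
    _ = _ := by
        rw [ENNReal.mul_rpow_of_nonneg _ _ hq0.le, ← ENNReal.rpow_mul, ← ENNReal.rpow_mul,
          one_div, inv_mul_cancel₀ hq0.ne', ENNReal.rpow_one]
        congr 2
        field_simp

/-- The function `H ^ (q - 1)` times the averages of `(a + η) ^ (1 - q)`, where `a` is the square
function of `H`, satisfies a Carleson condition. -/
theorem setLIntegral_tent_dual_le {H : Up d → ℝ≥0∞} (hH : Measurable H) {q q' : ℝ}
    (hqq : q.HolderConjugate q') {a : Pt d → ℝ≥0∞} (ha : Measurable a)
    (hat : ∀ x, a x ≠ ∞) (haH : ∀ x, coneInt (fun w => H w ^ q) x = a x ^ q) {η : ℝ≥0∞}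
    (hη0 : η ≠ 0) (hη : η ≠ ∞) (c : Pt d) {r : ℝ} :
    ∫⁻ w in tent (Metric.ball c r),
        (H w ^ (q - 1) * ballMean (fun x => (a x + η) ^ (1 - q)) w) ^ q' ∂halfMeasure d ≤
      volume (Metric.ball c r) * (1 + unitVol d) ^ q' := by
  have hq0 : 0 < q := hqq.pos
  have hq'0 : 0 < q' := hqq.symm.pos
  have hq'1 : 1 < q' := hqq.symm.lt
  have e1 : (q - 1) * q' = q := hqq.sub_one_mul_conj
  have e2 : (1 - q) * q' = -q := by linarith
  set B := Metric.ball c r with hB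
  have hBm : MeasurableSet B := Metric.isOpen_ball.measurableSet
  have hTm : MeasurableSet (tent B) := measurableSet_tent _
  set φ : Pt d → ℝ≥0∞ := B.indicator fun x => (a x + η) ^ (-q) with hφ
  have hφm : Measurable φ := ((ha.add_const η).pow_const _).indicator hBm
  have hut : unitVol d ^ (q' - 1) ≠ ∞ :=
    ENNReal.rpow_ne_top_of_nonneg (by linarith) (unitVol_ne_top d)
  calc ∫⁻ w in tent B, (H w ^ (q - 1) * ballMean (fun x => (a x + η) ^ (1 - q)) w) ^ q'
        ∂halfMeasure d
      ≤ ∫⁻ w in tent B, unitVol d ^ (q' - 1) * (H w ^ q * ballMean φ w) ∂halfMeasure d := by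
        refine setLIntegral_mono' hTm fun w hw => ?_
        obtain ⟨hw0, hwB⟩ := mem_tent_iff.1 hw
        rw [ENNReal.mul_rpow_of_nonneg _ _ hq'0.le, ← ENNReal.rpow_mul, e1, mul_left_comm]
        gcongr
        refine (ballMean_rpow_le ((ha.add_const η).pow_const _) hq'1.le hw0).trans ?_
        gcongr
        refine ballMean_mono fun x hx => ?_
        rw [← ENNReal.rpow_mul, e2, hφ, Set.indicator_of_mem (hwB hx)]
    _ ≤ ∫⁻ w, unitVol d ^ (q' - 1) * (H w ^ q * ballMean φ w) ∂halfMeasure d :=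
        setLIntegral_le_lintegral _ _
    _ = unitVol d ^ (q' - 1) * ∫⁻ x, φ x * coneInt (fun w => H w ^ q) x := by
        rw [lintegral_const_mul' _ _ hut, lintegral_mul_coneInt hφm (hH.pow_const q)]
    _ ≤ unitVol d ^ (q' - 1) * ∫⁻ x, B.indicator (fun _ => 1) x := by
        gcongr with x
        by_cases hx : x ∈ B
        · rw [hφ, Set.indicator_of_mem hx, Set.indicator_of_mem hx, haH]
          calc (a x + η) ^ (-q) * a x ^ q ≤ (a x + η) ^ (-q) * (a x + η) ^ q := by
                gcongr; exact le_self_add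
            _ = 1 := by
                rw [← ENNReal.rpow_add _ _ (by simp [hη0]) (ENNReal.add_ne_top.2 ⟨hat x, hη⟩),
                  neg_add_cancel, ENNReal.rpow_zero]
        · rw [hφ, Set.indicator_of_notMem hx, zero_mul]; exact zero_le
    _ = volume B * unitVol d ^ (q' - 1) := by
        rw [lintegral_indicator_const hBm, one_mul, mul_comm]
    _ ≤ _ := by
        gcongr
        calc unitVol d ^ (q' - 1) ≤ (1 + unitVol d) ^ (q' - 1) := by
              gcongr
              exact le_add_self
          _ ≤ _ := ENNReal.rpow_le_rpow_of_exponent_le le_self_add (by linarith)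

theorem lintegral_coneInt_posOp_le_of_one (hd : 1 ≤ d) {γ : ℝ} (hγ : 0 < γ) :
    ∃ A : ℝ≥0∞, A ≠ ∞ ∧ ∀ q : ℝ, 1 < q → ∀ (F : Up d → ℝ≥0∞), Measurable F →
      ∫⁻ x, coneInt (fun z => posOp γ F z ^ q) x ^ (1 / q) ≤
        A * ∫⁻ x, coneInt (fun w => F w ^ q) x ^ (1 / q) := by
  obtain ⟨A₁, hA₁, hcarl⟩ := setLIntegral_tent_posOp_rpow_le hd hγ
  obtain ⟨A₂, hA₂, hpair⟩ := lintegral_mul_le_of_carleson d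
  set Θ : ℝ≥0∞ := (1 + A₁) * (1 + unitVol d) with hΘ
  have hut := unitVol_ne_top d
  have hΘt : Θ ≠ ∞ := by rw [hΘ]; finiteness
  have hΘ0 : Θ ≠ 0 := by rw [hΘ]; positivity
  refine ⟨A₂ * Θ, ENNReal.mul_ne_top hA₂ hΘt, ?_⟩
  intro q hq F hF
  have hq0 : 0 < q := by linarith
  set q' := q.conjExponent with hq'
  have hqq : q.HolderConjugate q' := Real.HolderConjugate.conjExponent hq
  have hPF := measurable_posOp γ hF
  refine lintegral_coneInt_rpow_le_of_trunc hPF hq0.le (by positivity) fun n => ?_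
  set H : Up d → ℝ≥0∞ := trunc n (posOp γ F) with hHdef
  have hH : Measurable H := measurable_trunc n hPF
  set a : Pt d → ℝ≥0∞ := fun x => coneInt (fun w => H w ^ q) x ^ (1 / q) with hadef
  have ha : Measurable a := (measurable_coneInt (hH.pow_const q)).pow_const _
  have haH : ∀ x, coneInt (fun w => H w ^ q) x = a x ^ q := fun x => by
    rw [hadef, ← ENNReal.rpow_mul, one_div, inv_mul_cancel₀ hq0.ne', ENNReal.rpow_one]
  have hat : ∀ x, a x ≠ ∞ := by
    obtain ⟨C, hC, hle⟩ := coneInt_le_of_le_box (ENNReal.natCast_ne_top n)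
      (trunc_le_indicator n (posOp γ F)) hq0
    intro x
    refine ENNReal.rpow_ne_top_of_nonneg (by positivity) (ne_top_of_le_ne_top hC ?_)
    refine (hle x).trans ?_
    exact Set.indicator_le_self _ _ _
  -- The shift by `η` keeps the negative powers of `a` finite where `a` vanishes; it is removed by
  -- Fatou's lemma at the end.
  set K : ℝ≥0∞ := A₂ * Θ * ∫⁻ x, coneInt (fun w => F w ^ q) x ^ (1 / q) with hK
  have hbound : ∀ η : ℝ≥0∞, η ≠ 0 → η ≠ ∞ → ∫⁻ x, (a x + η) ^ (1 - q) * a x ^ q ≤ K := by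
    intro η hη0 hη
    have hφm : Measurable fun x => (a x + η) ^ (1 - q) := (ha.add_const η).pow_const _
    set G : Up d → ℝ≥0∞ := fun w => H w ^ (q - 1) * ballMean (fun x => (a x + η) ^ (1 - q)) w
      with hG
    have hGm : Measurable G := (hH.pow_const _).mul (measurable_ballMean hφm)
    calc ∫⁻ x, (a x + η) ^ (1 - q) * a x ^ q
        = ∫⁻ x, (a x + η) ^ (1 - q) * coneInt (fun w => H w ^ q) x := by simp_rw [haH]
      _ = ∫⁻ w, H w * G w ∂halfMeasure d := by
          rw [lintegral_mul_coneInt hφm (hH.pow_const q)]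
          refine lintegral_congr fun w => ?_
          rw [hG]
          dsimp only
          rw [← mul_assoc]
          congr 1
          nth_rewrite 2 [← ENNReal.rpow_one (H w)]
          rw [← ENNReal.rpow_add_of_nonneg _ _ zero_le_one (by linarith), add_sub_cancel]
      _ ≤ ∫⁻ w, posOp γ F w * G w ∂halfMeasure d := by
          gcongr with w
          exact trunc_le n _ w
      _ = ∫⁻ w, F w * posOp γ G w ∂halfMeasure d := lintegral_posOp_mul γ hF hGm
      _ ≤ K := by
          refine hpair q q' hqq F _ hF (measurable_posOp γ hGm) Θ hΘ0 hΘt fun c r hr => ?_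
          refine (hcarl q' hqq.symm.lt G hGm c r hr ((1 + unitVol d) ^ q') fun R _ =>
            setLIntegral_tent_dual_le hH hqq ha hat haH hη0 hη c).trans ?_
          rw [hΘ, ENNReal.mul_rpow_of_nonneg _ _ hqq.symm.nonneg, mul_comm (volume _), ← mul_assoc]
          gcongr
          · exact hqq.symm.nonneg
          · exact le_add_self
  have hlim : ∀ x, Filter.Tendsto (fun m : ℕ => (a x + ((m : ℝ≥0∞) + 1)⁻¹) ^ (1 - q) * a x ^ q)
      Filter.atTop (nhds (a x)) := by
    intro x
    rcases eq_or_ne (a x) 0 with h0 | h0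
    · rw [h0, ENNReal.zero_rpow_of_pos hq0]
      simp
    · have h1 : Filter.Tendsto (fun m : ℕ => a x + ((m : ℝ≥0∞) + 1)⁻¹) Filter.atTop
          (nhds (a x)) := by
        have := (ENNReal.tendsto_inv_nat_nhds_zero.comp (Filter.tendsto_add_atTop_nat 1)).const_add
          (a x)
        simpa [Function.comp_def] using this
      have h2 := ENNReal.Tendsto.mul_const (b := a x ^ q)
        ((ENNReal.continuous_rpow_const (y := 1 - q)).continuousAt.tendsto.comp h1)
        (Or.inr (ENNReal.rpow_ne_top_of_nonneg hq0.le (hat x)))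
      rwa [← ENNReal.rpow_add _ _ h0 (hat x), sub_add_cancel, ENNReal.rpow_one] at h2
  calc ∫⁻ x, a x = ∫⁻ x, Filter.liminf
        (fun m : ℕ => (a x + ((m : ℝ≥0∞) + 1)⁻¹) ^ (1 - q) * a x ^ q) Filter.atTop :=
        lintegral_congr fun x => (hlim x).liminf_eq.symm
    _ ≤ Filter.liminf (fun m : ℕ => ∫⁻ x, (a x + ((m : ℝ≥0∞) + 1)⁻¹) ^ (1 - q) * a x ^ q)
        Filter.atTop := lintegral_liminf_le fun m =>
          ((ha.add_const _).pow_const _).mul (ha.pow_const q)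
    _ ≤ K := by
        refine Filter.liminf_le_of_le (by isBoundedDefault) fun b hb => ?_
        obtain ⟨m, hm⟩ := hb.exists
        refine hm.trans (hbound _ ?_ ?_)
        · rw [ENNReal.inv_ne_zero]; finiteness
        · rw [ENNReal.inv_ne_top]; positivity

/-! ### Interpolation between the exponents one and `q` -/

/-- Jensen's inequality for negative powers. -/
theorem lintegral_rpow_neg_le {α : Type*} [MeasurableSpace α] {ν : Measure α}
    [IsProbabilityMeasure ν] {f : α → ℝ≥0∞} (hf : Measurable f) {l : ℝ} (hl : 0 < l) :
    (∫⁻ x, f x ∂ν) ^ (-l) ≤ ∫⁻ x, f x ^ (-l) ∂ν := by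
  set I := ∫⁻ x, f x ∂ν with hI
  set J := ∫⁻ x, f x ^ (-l) ∂ν with hJ
  rcases eq_or_ne J ∞ with hJt | hJt
  · rw [hJt]; exact le_top
  rcases eq_or_ne I ∞ with hIt | hIt
  · rw [hIt, ENNReal.top_rpow_of_neg (by linarith)]; exact zero_le
  have hl1 : 0 < 1 + l := by linarith
  have h1 : (1 : ℝ≥0∞) ≤ I ^ (l / (1 + l)) * J ^ (1 / (1 + l)) := by
    calc (1 : ℝ≥0∞) = ∫⁻ _, 1 ∂ν := by simp
      _ = ∫⁻ x, f x ^ (l / (1 + l)) * (f x ^ (-l)) ^ (1 / (1 + l)) ∂ν := by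
          refine lintegral_congr_ae ?_
          filter_upwards [ae_lt_top hf hIt, ae_lt_top (hf.pow_const (-l)) hJt] with x hx1 hx2
          have hx0 : f x ≠ 0 := by
            intro h
            rw [h, ENNReal.zero_rpow_of_neg (by linarith)] at hx2
            exact lt_irrefl _ hx2
          rw [← ENNReal.rpow_mul, ← ENNReal.rpow_add _ _ hx0 hx1.ne]
          have : l / (1 + l) + -l * (1 / (1 + l)) = 0 := by ring
          rw [this, ENNReal.rpow_zero]
      _ ≤ _ := ENNReal.lintegral_mul_norm_pow_le hf.aemeasurable (hf.pow_const (-l)).aemeasurable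
          (by positivity) (by positivity) (by field_simp; ring)
  have h2 : (1 : ℝ≥0∞) ≤ I ^ l * J := by
    calc (1 : ℝ≥0∞) = 1 ^ (1 + l) := (ENNReal.one_rpow _).symm
      _ ≤ (I ^ (l / (1 + l)) * J ^ (1 / (1 + l))) ^ (1 + l) := by gcongr
      _ = I ^ l * J := by
          rw [ENNReal.mul_rpow_of_nonneg _ _ hl1.le, ← ENNReal.rpow_mul, ← ENNReal.rpow_mul,
            div_mul_cancel₀ _ hl1.ne', div_mul_cancel₀ _ hl1.ne', ENNReal.rpow_one]
  have hI0 : I ≠ 0 := by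
    intro h
    rw [h, ENNReal.zero_rpow_of_pos hl, zero_mul] at h2
    exact absurd h2 (by norm_num)
  calc I ^ (-l) = I ^ (-l) * 1 := (mul_one _).symm
    _ ≤ I ^ (-l) * (I ^ l * J) := by gcongr
    _ = J := by
        rw [← mul_assoc, ← ENNReal.rpow_add _ _ hI0 hIt, neg_add_cancel, ENNReal.rpow_zero, one_mul]

/-- The average of `g` over the ball `B(y, s)`. -/
noncomputable def ballAvg (g : Pt d → ℝ≥0∞) (w : Up d) : ℝ≥0∞ := (unitVol d)⁻¹ * ballMean g w

theorem measurable_ballAvg {g : Pt d → ℝ≥0∞} (hg : Measurable g) : Measurable (ballAvg g) :=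
  (measurable_ballMean hg).const_mul _

theorem ballAvg_le_maxFun (g : Pt d → ℝ≥0∞) {x : Pt d} {w : Up d}
    (hx : x ∈ Metric.ball w.1 w.2) : ballAvg g w ≤ maxFun g x := by
  calc ballAvg g w ≤ (unitVol d)⁻¹ * (unitVol d * maxFun g x) := by
        unfold ballAvg; gcongr; exact ballMean_le_maxFun g hx
    _ = _ := by
        rw [← mul_assoc, ENNReal.inv_mul_cancel (unitVol_ne_zero d) (unitVol_ne_top d), one_mul]

theorem ballAvg_rpow_neg_le {g : Pt d → ℝ≥0∞} (hg : Measurable g) {l : ℝ} (hl : 0 < l) {w : Up d}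
    (hw : 0 < w.2) : ballAvg g w ^ (-l) ≤ ballAvg (fun x => g x ^ (-l)) w := by
  set ν : Measure (Pt d) := (unitVol d)⁻¹ •
    (ENNReal.ofReal (w.2 ^ d)⁻¹ • (volume : Measure (Pt d)).restrict (Metric.ball w.1 w.2)) with hν
  have e : ∀ f : Pt d → ℝ≥0∞, ballAvg f w = ∫⁻ x, f x ∂ν := by
    intro f
    rw [hν, lintegral_smul_measure, ← ballMean_eq_lintegral]
    rfl
  have : IsProbabilityMeasure ν := by
    refine ⟨?_⟩
    have h := e fun _ => 1
    rw [lintegral_const, one_mul, ballAvg, ballMean_one hw,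
      ENNReal.inv_mul_cancel (unitVol_ne_zero d) (unitVol_ne_top d)] at h
    exact h.symm
  rw [e, e]
  exact lintegral_rpow_neg_le hg hl

theorem ballMean_ne_top {g : Pt d → ℝ≥0∞} (hg : Measurable g) (h : ∫⁻ x, g x ^ (2 : ℝ) ≠ ∞)
    {w : Up d} (hw : 0 < w.2) : ballMean g w ≠ ∞ := by
  have h1 := ballMean_rpow_le hg (q := 2) (by norm_num) hw
  have h2 : ballMean (fun x => g x ^ (2 : ℝ)) w ≠ ∞ := by
    refine ENNReal.mul_ne_top ENNReal.ofReal_ne_top (ne_top_of_le_ne_top h ?_)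
    exact setLIntegral_le_lintegral _ _
  intro hcon
  rw [hcon, ENNReal.top_rpow_of_pos (by norm_num), top_le_iff] at h1
  exact ENNReal.mul_ne_top (ENNReal.rpow_ne_top_of_nonneg (by norm_num) (unitVol_ne_top d)) h2 h1

/-- Weighted norm of a factor in the Calderón factorization: the powers `a ^ (-(q - p))` of the
square function `a` of `F` turn `L^q` size into `L^p` size of `a`. -/
theorem lintegral_rpow_mul_ballMean_le {F : Up d → ℝ≥0∞} (hF : Measurable F) {p q : ℝ}
    (hp : 0 < p) (hpq : p < q) {a : Pt d → ℝ≥0∞} (ha : Measurable a)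
    (haF : ∀ x, coneInt (fun w => F w ^ q) x = a x ^ q) :
    ∫⁻ w, F w ^ q * ballMean (fun x => a x ^ (-(q - p))) w ∂halfMeasure d ≤ ∫⁻ x, a x ^ p := by
  have hq0 : 0 < q := by linarith
  rw [← lintegral_mul_coneInt (ha.pow_const _) (hF.pow_const q)]
  refine lintegral_mono fun x => ?_
  dsimp only
  rw [haF]
  rcases eq_or_ne (a x) 0 with h0 | h0
  · rw [h0, ENNReal.zero_rpow_of_pos hq0, mul_zero]; exact zero_le
  rcases eq_or_ne (a x) ∞ with ht | ht
  · rw [ht, ENNReal.top_rpow_of_pos hp]; exact le_top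
  rw [← ENNReal.rpow_add _ _ h0 ht]
  refine le_of_eq ?_
  congr 1
  ring

/-- The first factor of the Calderón factorization lies in the tent space with exponent one. -/
theorem lintegral_coneInt_factor_le (hd : 1 ≤ d) {F : Up d → ℝ≥0∞} (hF : Measurable F) {p q : ℝ}
    (hp : 1 < p) (hq : 0 < q) {a : Pt d → ℝ≥0∞} (ha : Measurable a)
    (haF : ∀ x, coneInt (fun w => F w ^ q) x = a x ^ q) :
    ∫⁻ x, coneInt (fun w =>
        (F w * ballAvg (fun y => a y ^ (p / 2)) w ^ (2 * (p - 1) / p)) ^ q) x ^ (1 / q) ≤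
      ENNReal.ofReal (2 ^ (2 : ℝ) * 4 ^ d * (2 / (2 - 1))) * ∫⁻ x, a x ^ p := by
  have hp0 : 0 < p := by linarith
  have hp1 : 0 < p - 1 := by linarith
  set g : Pt d → ℝ≥0∞ := fun y => a y ^ (p / 2) with hg
  have hgm : Measurable g := ha.pow_const _
  set C : ℝ≥0∞ := ENNReal.ofReal (2 ^ (2 : ℝ) * 4 ^ d * (2 / (2 - 1))) with hC
  have hC1 : 1 ≤ C := by
    rw [hC, ENNReal.one_le_ofReal]
    have h4 : (1 : ℝ) ≤ 4 ^ d := one_le_pow₀ (by norm_num)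
    norm_num
    linarith
  have hM := measurable_maxFun g
  have hq1 : (1 - 1 / p) = (p - 1) / p := by field_simp
  have hpt : ∀ x, coneInt (fun w => (F w * ballAvg g w ^ (2 * (p - 1) / p)) ^ q) x ^ (1 / q) ≤
      (a x ^ p) ^ (1 / p) * (maxFun g x ^ (2 : ℝ)) ^ (1 - 1 / p) := by
    intro x
    set m : ℝ≥0∞ := maxFun g x ^ (2 * (p - 1) / p) with hm
    have h1 : coneInt (fun w => (F w * ballAvg g w ^ (2 * (p - 1) / p)) ^ q) x ≤
        a x ^ q * m ^ q := by
      calc coneInt (fun w => (F w * ballAvg g w ^ (2 * (p - 1) / p)) ^ q) x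
          ≤ ∫⁻ w in cone x, m ^ q * (F w ^ q * ENNReal.ofReal (w.2 ^ d)⁻¹) ∂halfMeasure d := by
            refine setLIntegral_mono' (measurableSet_cone x) fun w hw => ?_
            dsimp only
            rw [ENNReal.mul_rpow_of_nonneg _ _ hq.le, ← mul_assoc, mul_comm (m ^ q)]
            gcongr
            exact ENNReal.rpow_le_rpow (ballAvg_le_maxFun g ((mem_cone_iff hw.1).1 hw))
              (by positivity)
        _ = m ^ q * coneInt (fun w => F w ^ q) x :=
            lintegral_const_mul _ ((hF.pow_const q).mul measurable_weight)
        _ = _ := by rw [haF, mul_comm]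
    calc coneInt (fun w => (F w * ballAvg g w ^ (2 * (p - 1) / p)) ^ q) x ^ (1 / q)
        ≤ (a x ^ q * m ^ q) ^ (1 / q) := by gcongr
      _ = a x * m := by
          rw [ENNReal.mul_rpow_of_nonneg _ _ (by positivity), ← ENNReal.rpow_mul,
            ← ENNReal.rpow_mul, mul_one_div_cancel hq.ne', ENNReal.rpow_one, ENNReal.rpow_one]
      _ = _ := by
          rw [← ENNReal.rpow_mul, mul_one_div_cancel hp0.ne', ENNReal.rpow_one,
            ← ENNReal.rpow_mul, hm, hq1, mul_div_assoc]
  calc ∫⁻ x, coneInt (fun w => (F w * ballAvg g w ^ (2 * (p - 1) / p)) ^ q) x ^ (1 / q)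
      ≤ ∫⁻ x, (a x ^ p) ^ (1 / p) * (maxFun g x ^ (2 : ℝ)) ^ (1 - 1 / p) := lintegral_mono hpt
    _ ≤ (∫⁻ x, a x ^ p) ^ (1 / p) * (∫⁻ x, maxFun g x ^ (2 : ℝ)) ^ (1 - 1 / p) :=
        ENNReal.lintegral_mul_norm_pow_le (ha.pow_const p).aemeasurable
          (hM.pow_const _).aemeasurable (by positivity) (by rw [hq1]; positivity) (by ring)
    _ ≤ (C * ∫⁻ x, a x ^ p) ^ (1 / p) * (C * ∫⁻ x, a x ^ p) ^ (1 - 1 / p) := by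
        have e : ∫⁻ x, maxFun g x ^ (2 : ℝ) ≤ C * ∫⁻ x, a x ^ p := by
          refine (lintegral_maxFun_rpow_le hd hgm one_lt_two).trans (le_of_eq ?_)
          congr 1
          refine lintegral_congr fun x => ?_
          rw [hg, ← ENNReal.rpow_mul, div_mul_cancel₀ _ two_ne_zero]
        gcongr
        · exact le_mul_of_one_le_left' hC1
        · rw [hq1]; positivity
    _ = C * ∫⁻ x, a x ^ p := by
        rw [← ENNReal.rpow_add_of_nonneg _ _ (by positivity) (by rw [hq1]; positivity),
          add_sub_cancel, ENNReal.rpow_one]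

/-- Interpolation for the positive operator. A function `F` with square function `a ∈ L^p` is
factored as `F₀ ^ (1 - θ) * F₁ ^ θ` with `F₀` in the tent space with exponent `1` and `F₁` in the
one with exponent `q`, by multiplying with powers of an average of `a`; Hölder's inequality then
transfers the bounds at the endpoints, with constants bounded independently of `p` and `q`. -/
theorem lintegral_coneInt_posOp_le_of_lt (hd : 1 ≤ d) {γ : ℝ} (hγ : 0 < γ) :
    ∃ A : ℝ≥0∞, A ≠ ∞ ∧ ∀ (p q : ℝ), 1 < p → p < q → ∀ (F : Up d → ℝ≥0∞), Measurable F →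
      ∫⁻ x, coneInt (fun z => posOp γ F z ^ q) x ^ (p / q) ≤
        A ^ p * ∫⁻ x, coneInt (fun w => F w ^ q) x ^ (p / q) := by
  obtain ⟨A₁, hA₁, hone⟩ := lintegral_coneInt_posOp_le_of_one hd hγ
  obtain ⟨A₂, hA₂, hdual⟩ := lintegral_mul_coneInt_posOp_le d hγ
  set C : ℝ≥0∞ := ENNReal.ofReal (2 ^ (2 : ℝ) * 4 ^ d * (2 / (2 - 1))) with hC
  have hCt : C ≠ ∞ := ENNReal.ofReal_ne_top
  set D : ℝ≥0∞ := 1 + A₁ * C + A₂ with hD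
  have hDt : D ≠ ∞ := by rw [hD]; finiteness
  refine ⟨D, hDt, ?_⟩
  intro p q hp hpq F hF
  have hp0 : 0 < p := by linarith
  have hp1 : 0 < p - 1 := by linarith
  have hq : 1 < q := by linarith
  have hq0 : 0 < q := by linarith
  have hq1 : 0 < q - 1 := by linarith
  have hqp : 0 < q - p := by linarith
  set a : Pt d → ℝ≥0∞ := fun x => coneInt (fun w => F w ^ q) x ^ (1 / q) with hadef
  have ha : Measurable a := (measurable_coneInt (hF.pow_const q)).pow_const _
  have haF : ∀ x, coneInt (fun w => F w ^ q) x = a x ^ q := fun x => by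
    rw [hadef, ← ENNReal.rpow_mul, one_div, inv_mul_cancel₀ hq0.ne', ENNReal.rpow_one]
  set N := ∫⁻ x, a x ^ p with hN
  have hNeq : ∫⁻ x, coneInt (fun w => F w ^ q) x ^ (p / q) = N := by
    refine lintegral_congr fun x => ?_
    rw [haF, ← ENNReal.rpow_mul, mul_div_cancel₀ _ hq0.ne']
  rw [hNeq]
  have hD1 : 1 ≤ D := by rw [hD, add_assoc]; exact le_self_add
  rcases eq_or_ne N ∞ with hNt | hNt
  · rw [hNt, ENNReal.mul_top]
    · exact le_top
    · exact (zero_lt_one.trans_le (ENNReal.one_le_rpow hD1 hp0)).ne'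
  set g : Pt d → ℝ≥0∞ := fun y => a y ^ (p / 2) with hg
  have hgm : Measurable g := ha.pow_const _
  have hg2 : ∫⁻ x, g x ^ (2 : ℝ) ≠ ∞ := by
    have : ∫⁻ x, g x ^ (2 : ℝ) = N := lintegral_congr fun x => by
      rw [hg, ← ENNReal.rpow_mul, div_mul_cancel₀ _ two_ne_zero]
    rw [this]; exact hNt
  have hGm : Measurable (ballAvg g) := measurable_ballAvg hgm
  set θ : ℝ := q * (p - 1) / (p * (q - 1)) with hθ
  have hθ0 : 0 ≤ θ := by positivity
  have hθ1 : 1 - θ = (q - p) / (p * (q - 1)) := by rw [hθ]; field_simp; ring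
  have hθ1' : 0 ≤ 1 - θ := by rw [hθ1]; positivity
  set α : ℝ := 2 * (p - 1) / p with hα
  set β : ℝ := -(2 * (q - p) / (p * q)) with hβ
  set l : ℝ := 2 * (q - p) / p with hl
  have hl0 : 0 < l := by positivity
  have hαβ : α * (1 - θ) + β * θ = 0 := by rw [hθ1, hα, hβ, hθ]; field_simp; ring
  have hβq : β * q = -l := by rw [hβ, hl]; field_simp
  set F₀ : Up d → ℝ≥0∞ := fun w => F w * ballAvg g w ^ α with hF₀
  set F₁ : Up d → ℝ≥0∞ := fun w => F w * ballAvg g w ^ β with hF₁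
  have hF₀m : Measurable F₀ := hF.mul (hGm.pow_const _)
  have hF₁m : Measurable F₁ := hF.mul (hGm.pow_const _)
  -- Jensen's inequality bounds the negative power of the average in `F₁`.
  have hneg : ∀ w : Up d, 0 < w.2 →
      ballAvg g w ^ (-l) ≤ (unitVol d)⁻¹ * ballMean (fun x => a x ^ (-(q - p))) w := by
    intro w hw
    refine (ballAvg_rpow_neg_le hgm hl0 hw).trans (le_of_eq ?_)
    unfold ballAvg
    have : ∀ x, g x ^ (-l) = a x ^ (-(q - p)) := fun x => by
      rw [hg, ← ENNReal.rpow_mul, hl]; congr 1; field_simp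
    simp_rw [this]
  have hweight := lintegral_rpow_mul_ballMean_le hF hp0 hpq ha haF
  have hVm : Measurable (ballMean fun x => a x ^ (-(q - p))) :=
    measurable_ballMean (ha.pow_const _)
  -- The factorization could only fail where the average of `g` is zero or infinite. The latter is
  -- excluded, and where the average is zero, `F` vanishes almost everywhere.
  have hfac : ∀ᵐ w ∂halfMeasure d, F w ≤ F₀ w ^ (1 - θ) * F₁ w ^ θ := by
    filter_upwards [ae_halfMeasure_pos d, ae_lt_top ((hF.pow_const q).mul hVm)
      (ne_top_of_le_ne_top hNt hweight)] with w hw hfin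
    rcases eq_or_ne (F w) 0 with hF0 | hF0
    · rw [hF0]; exact zero_le
    have hGt : ballAvg g w ≠ ∞ := ENNReal.mul_ne_top
      (ENNReal.inv_ne_top.2 (unitVol_ne_zero d)) (ballMean_ne_top hgm hg2 hw)
    have hG0 : ballAvg g w ≠ 0 := by
      intro h0
      have h1 := hneg w hw
      rw [h0, ENNReal.zero_rpow_of_neg (by linarith), top_le_iff] at h1
      have h2 : ballMean (fun x => a x ^ (-(q - p))) w = ∞ := by
        by_contra hcon
        exact ENNReal.mul_ne_top (ENNReal.inv_ne_top.2 (unitVol_ne_zero d)) hcon h1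
      rw [Pi.mul_apply, h2, ENNReal.mul_top] at hfin
      · exact lt_irrefl _ hfin
      · simp [ENNReal.rpow_eq_zero_iff, hF0, hq0.le]
    refine le_of_eq ?_
    rw [hF₀, hF₁]
    dsimp only
    rw [ENNReal.mul_rpow_of_nonneg _ _ hθ1', ENNReal.mul_rpow_of_nonneg _ _ hθ0,
      mul_mul_mul_comm, ← ENNReal.rpow_add_of_nonneg _ _ hθ1' hθ0, sub_add_cancel,
      ENNReal.rpow_one, ← ENNReal.rpow_mul, ← ENNReal.rpow_mul, ← ENNReal.rpow_add _ _ hG0 hGt,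
      hαβ, ENNReal.rpow_zero, mul_one]
  have hbound₀ : ∫⁻ x, coneInt (fun z => posOp γ F₀ z ^ q) x ^ (1 / q) ≤ A₁ * C * N := by
    refine (hone q hq F₀ hF₀m).trans ?_
    rw [mul_assoc]
    gcongr
    exact lintegral_coneInt_factor_le hd hF hp hq0 ha haF
  have hbound₁ : ∫⁻ x, coneInt (fun z => posOp γ F₁ z ^ q) x ≤ A₂ ^ q * N := by
    have h1 := hdual q hq F₁ hF₁m (fun _ => 1) measurable_const
    simp only [one_mul] at h1
    refine h1.trans ?_
    gcongr
    calc ∫⁻ x, maxFun (fun _ => 1) x * coneInt (fun w => F₁ w ^ q) x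
        ≤ ∫⁻ x, coneInt (fun w => F₁ w ^ q) x :=
          lintegral_mono fun x => mul_le_of_le_one_left' (maxFun_one_le x)
      _ = unitVol d * ∫⁻ w, F₁ w ^ q ∂halfMeasure d := lintegral_coneInt_eq (hF₁m.pow_const q)
      _ ≤ unitVol d * ∫⁻ w, (unitVol d)⁻¹ * (F w ^ q * ballMean (fun x => a x ^ (-(q - p))) w)
            ∂halfMeasure d := by
          gcongr 1
          refine lintegral_mono_ae ?_
          filter_upwards [ae_halfMeasure_pos d] with w hw
          rw [hF₁]
          dsimp only
          rw [ENNReal.mul_rpow_of_nonneg _ _ hq0.le, ← ENNReal.rpow_mul, hβq, mul_left_comm]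
          gcongr
          exact hneg w hw
      _ = ∫⁻ w, F w ^ q * ballMean (fun x => a x ^ (-(q - p))) w ∂halfMeasure d := by
          rw [lintegral_const_mul' _ _ (ENNReal.inv_ne_top.2 (unitVol_ne_zero d)), ← mul_assoc,
            ENNReal.mul_inv_cancel (unitVol_ne_zero d) (unitVol_ne_top d), one_mul]
      _ ≤ N := hweight
  have hP₀ := measurable_posOp γ hF₀m
  have hP₁ := measurable_posOp γ hF₁m
  have hexp : (1 - θ) * p + θ * p / q = 1 := by rw [hθ1, hθ]; field_simp; ring
  have e₀ : 0 ≤ (1 - θ) * p := by positivity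
  have e₁ : 0 ≤ θ * p / q := by positivity
  calc ∫⁻ x, coneInt (fun z => posOp γ F z ^ q) x ^ (p / q)
      ≤ ∫⁻ x, (coneInt (fun z => posOp γ F₀ z ^ q) x ^ (1 / q)) ^ ((1 - θ) * p) *
          coneInt (fun z => posOp γ F₁ z ^ q) x ^ (θ * p / q) := by
        refine lintegral_mono fun x => ?_
        have h1 : coneInt (fun z => posOp γ F z ^ q) x ≤
            coneInt (fun z => posOp γ F₀ z ^ q) x ^ (1 - θ) *
              coneInt (fun z => posOp γ F₁ z ^ q) x ^ θ := by
          refine (coneInt_mono (fun z _ => ?_) x).trans (coneInt_mul_rpow_le (hP₀.pow_const q)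
            (hP₁.pow_const q) hθ1' hθ0 (sub_add_cancel _ _) x)
          calc posOp γ F z ^ q ≤ (posOp γ F₀ z ^ (1 - θ) * posOp γ F₁ z ^ θ) ^ q := by
                gcongr
                exact (posOp_mono_ae γ hfac z).trans (posOp_mul_rpow_le γ hF₀m hF₁m hθ1' hθ0
                  (sub_add_cancel _ _) z)
            _ = _ := by
                rw [ENNReal.mul_rpow_of_nonneg _ _ hq0.le, ← ENNReal.rpow_mul,
                  ← ENNReal.rpow_mul, ← ENNReal.rpow_mul, ← ENNReal.rpow_mul, mul_comm q,
                  mul_comm q]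
        calc coneInt (fun z => posOp γ F z ^ q) x ^ (p / q)
            ≤ (coneInt (fun z => posOp γ F₀ z ^ q) x ^ (1 - θ) *
              coneInt (fun z => posOp γ F₁ z ^ q) x ^ θ) ^ (p / q) := by gcongr
          _ = _ := by
              rw [ENNReal.mul_rpow_of_nonneg _ _ (by positivity), ← ENNReal.rpow_mul,
                ← ENNReal.rpow_mul, ← ENNReal.rpow_mul]
              congr 2 <;> ring
    _ ≤ (∫⁻ x, coneInt (fun z => posOp γ F₀ z ^ q) x ^ (1 / q)) ^ ((1 - θ) * p) *
          (∫⁻ x, coneInt (fun z => posOp γ F₁ z ^ q) x) ^ (θ * p / q) :=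
        ENNReal.lintegral_mul_norm_pow_le
          ((measurable_coneInt (hP₀.pow_const q)).pow_const _).aemeasurable
          (measurable_coneInt (hP₁.pow_const q)).aemeasurable e₀ e₁ hexp
    _ ≤ (D * N) ^ ((1 - θ) * p) * (D ^ q * N) ^ (θ * p / q) := by
        gcongr
        · refine hbound₀.trans ?_
          gcongr
          rw [hD, add_assoc, add_left_comm]
          exact le_self_add
        · refine hbound₁.trans ?_
          gcongr
          exact le_add_self
    _ = D ^ p * N := by
        rw [ENNReal.mul_rpow_of_nonneg _ _ e₀, ENNReal.mul_rpow_of_nonneg _ _ e₁,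
          mul_mul_mul_comm, ← ENNReal.rpow_add_of_nonneg _ _ e₀ e₁, hexp, ENNReal.rpow_one,
          ← ENNReal.rpow_mul, ← ENNReal.rpow_add_of_nonneg _ _ e₀ (by positivity)]
        congr 2
        field_simp
        ring

/-- The tent space estimate for the positive operator, for all exponents. -/
theorem lintegral_coneInt_posOp_le (hd : 1 ≤ d) {γ : ℝ} (hγ : 0 < γ) :
    ∃ A : ℝ≥0∞, A ≠ ∞ ∧ ∀ (p q : ℝ), 1 ≤ p → 1 < q → ∀ (F : Up d → ℝ≥0∞), Measurable F →
      ∫⁻ x, coneInt (fun z => posOp γ F z ^ q) x ^ (p / q) ≤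
        (A * ENNReal.ofReal p ^ (1 / q)) ^ p * ∫⁻ x, coneInt (fun w => F w ^ q) x ^ (p / q) := by
  obtain ⟨A₁, hA₁, h₁⟩ := lintegral_coneInt_posOp_le_of_one hd hγ
  obtain ⟨A₂, hA₂, h₂⟩ := lintegral_coneInt_posOp_le_of_lt hd hγ
  obtain ⟨A₃, hA₃, h₃⟩ := lintegral_coneInt_posOp_le_of_ge hd hγ
  refine ⟨A₁ + A₂ + A₃, by finiteness, ?_⟩
  intro p q hp hq F hF
  have hp0 : 0 < p := by linarith
  have hq0 : 0 < q := by linarith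
  have hpow : 1 ≤ ENNReal.ofReal p ^ (1 / q) :=
    ENNReal.one_le_rpow (by rwa [ENNReal.one_le_ofReal]) (by positivity)
  rcases le_or_gt q p with hqp | hpq
  · refine (h₃ p q hq hqp F hF).trans ?_
    gcongr
    exact le_add_self
  · have hle : ∫⁻ x, coneInt (fun z => posOp γ F z ^ q) x ^ (p / q) ≤
        (A₁ + A₂ + A₃) ^ p * ∫⁻ x, coneInt (fun w => F w ^ q) x ^ (p / q) := by
      rcases eq_or_lt_of_le hp with rfl | hp1
      · refine (h₁ q hq F hF).trans ?_
        rw [ENNReal.rpow_one, add_assoc]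
        gcongr
        exact le_self_add
      · refine (h₂ p q hp1 hpq F hF).trans ?_
        gcongr
        rw [add_right_comm]
        exact le_add_self
    refine hle.trans ?_
    gcongr
    exact le_mul_of_one_le_right' hpow

variable {X : Type*} [NormedAddCommGroup X]

/-! ### Tent space norms and compactly supported functions -/

theorem tentENorm_eq {p q : ℝ} (hp : 0 < p) (f : Up d → X) :
    tentENorm p q f = (∫⁻ x, coneInt (fun w => ‖f w‖ₑ ^ q) x ^ (p / q)) ^ (1 / p) := by
  rw [tentENorm, eLpNorm_eq_lintegral_rpow_enorm_toReal (by simpa using hp) ENNReal.ofReal_ne_top,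
    ENNReal.toReal_ofReal hp.le]
  congr 1
  refine lintegral_congr fun x => ?_
  rw [enorm_eq_self, show areaFun q f x = coneInt (fun w => ‖f w‖ₑ ^ q) x ^ (1 / q) from rfl,
    ← ENNReal.rpow_mul]
  congr 1
  ring

theorem ae_lt_top_of_lintegral_coneInt {H : Up d → ℝ≥0∞} (hH : Measurable H) {q r : ℝ}
    (hq : 0 < q) (hr : 0 < r) (h : ∫⁻ x, coneInt (fun w => H w ^ q) x ^ r ≠ ∞) :
    ∀ᵐ w ∂halfMeasure d, H w < ∞ := by
  set T : Set (Up d) := {w | H w = ∞} with hT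
  have hTm : MeasurableSet T := hH (measurableSet_singleton ∞)
  have h1m : Measurable (T.indicator fun _ => (1 : ℝ≥0∞)) := measurable_const.indicator hTm
  have h0 : ∀ᵐ x : Pt d, coneInt (T.indicator fun _ => 1) x = 0 := by
    filter_upwards [ae_lt_top ((measurable_coneInt (hH.pow_const q)).pow_const r) h] with x hx
    have hle : ∞ * coneInt (T.indicator fun _ => 1) x ≤ coneInt (fun w => H w ^ q) x := by
      refine (lintegral_const_mul ∞ (h1m.mul measurable_weight)).symm.trans_le ?_
      refine lintegral_mono fun w => ?_
      rw [Pi.mul_apply, ← mul_assoc]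
      gcongr
      dsimp only
      by_cases hw : w ∈ T
      · rw [show H w = ∞ from hw, ENNReal.top_rpow_of_pos hq]; exact le_top
      · rw [Set.indicator_of_notMem hw, mul_zero]; exact zero_le
    by_contra hcon
    rw [ENNReal.top_mul hcon, top_le_iff] at hle
    rw [hle, ENNReal.top_rpow_of_pos hr] at hx
    exact lt_irrefl _ hx
  have h2 := lintegral_coneInt_eq h1m
  rw [lintegral_congr_ae h0, lintegral_zero, lintegral_indicator_const hTm, one_mul, eq_comm,
    mul_eq_zero] at h2
  have h3 : halfMeasure d T = 0 := h2.resolve_left (unitVol_ne_zero d)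
  filter_upwards [measure_eq_zero_iff_ae_notMem.1 h3] with w hw
  exact lt_top_iff_ne_top.2 hw

theorem exists_subset_box {S : Set (Up d)} (hS : IsCompact S) (h : S ⊆ halfSpace d) :
    ∃ n, S ⊆ box d n := by
  set U : ℕ → Set (Up d) := fun n =>
    {w | dist w.1 0 < n ∧ ((n : ℝ) + 1)⁻¹ < w.2 ∧ w.2 < n} with hU
  have hUo : ∀ n, IsOpen (U n) := fun n =>
    (isOpen_lt (continuous_fst.dist continuous_const) continuous_const).inter
      ((isOpen_lt continuous_const continuous_snd).inter
        (isOpen_lt continuous_snd continuous_const))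
  have hUb : ∀ n, U n ⊆ box d n := fun n w hw => ⟨hw.1.le, hw.2.1.le, hw.2.2.le⟩
  have hmono : Monotone U := by
    intro m n hmn w hw
    have h : (m : ℝ) ≤ n := by exact_mod_cast hmn
    refine ⟨hw.1.trans_le h, lt_of_le_of_lt ?_ hw.2.1, hw.2.2.trans_le h⟩
    gcongr
  have hcov : S ⊆ ⋃ n, U n := by
    intro w hw
    obtain ⟨n, hn⟩ := (eventually_mem_box (h hw)).exists
    refine Set.mem_iUnion.2 ⟨n + 1, ?_, ?_, ?_⟩
    · push_cast
      linarith [hn.1]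
    · push_cast
      refine lt_of_lt_of_le ?_ hn.2.1
      gcongr
      linarith
    · push_cast
      linarith [hn.2.2]
  obtain ⟨n, hn⟩ := hS.elim_directed_cover U hUo hcov hmono.directed_le
  exact ⟨n, hn.trans (hUb n)⟩

/-- Elements of `C_c ⊗ X` are continuous, and bounded with support in one of the boxes. -/
theorem ccTensor_continuous_and_le_box {𝕜 : Type*} [RCLike 𝕜] [NormedSpace 𝕜 X] {f : Up d → X}
    (hf : f ∈ ccTensor 𝕜 d X) : Continuous f ∧ ∃ (n : ℕ) (M : ℝ≥0∞), M ≠ ∞ ∧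
      ∀ w, ‖f w‖ₑ ≤ (box d n).indicator (fun _ => M) w := by
  induction hf using Submodule.span_induction with
  | mem f hf =>
    obtain ⟨φ, x, hφ, hc, hs, rfl⟩ := hf
    refine ⟨hφ.smul continuous_const, ?_⟩
    obtain ⟨n, hn⟩ := exists_subset_box hc hs
    obtain ⟨M, hM⟩ := hc.exists_bound_of_continuous hφ
    refine ⟨n, ENNReal.ofReal M * ‖x‖ₑ, ENNReal.mul_ne_top ENNReal.ofReal_ne_top enorm_ne_top,
      fun w => ?_⟩
    by_cases hw : w ∈ box d n
    · rw [Set.indicator_of_mem hw, enorm_smul]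
      gcongr
      rw [← ofReal_norm]
      exact ENNReal.ofReal_le_ofReal (hM w)
    · have : φ w = 0 := image_eq_zero_of_notMem_tsupport fun h => hw (hn h)
      simp [this]
  | zero => exact ⟨continuous_const, 0, 0, by simp, fun w => by simp⟩
  | add f g _ _ hf hg =>
    obtain ⟨hfc, n₁, M₁, hM₁, h₁⟩ := hf
    obtain ⟨hgc, n₂, M₂, hM₂, h₂⟩ := hg
    refine ⟨hfc.add hgc, max n₁ n₂, M₁ + M₂, ENNReal.add_ne_top.2 ⟨hM₁, hM₂⟩, fun w => ?_⟩
    have key : ∀ (n : ℕ) (M : ℝ≥0∞), n ≤ max n₁ n₂ → (box d n).indicator (fun _ => M) w ≤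
        (box d (max n₁ n₂)).indicator (fun _ => M) w := fun n M hn =>
      Set.indicator_le_indicator_of_subset (f := fun _ => M) (box_mono d hn)
        (fun _ => zero_le) w
    calc ‖(f + g) w‖ₑ ≤ ‖f w‖ₑ + ‖g w‖ₑ := enorm_add_le _ _
      _ ≤ (box d (max n₁ n₂)).indicator (fun _ => M₁) w +
          (box d (max n₁ n₂)).indicator (fun _ => M₂) w :=
        add_le_add ((h₁ w).trans (key _ _ (le_max_left _ _)))
          ((h₂ w).trans (key _ _ (le_max_right _ _)))
      _ = _ := by rw [← Pi.add_apply, ← Set.indicator_add']; rfl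
  | smul c f _ hf =>
    obtain ⟨hfc, n, M, hM, h⟩ := hf
    refine ⟨hfc.const_smul c, n, ‖c‖ₑ * M, ENNReal.mul_ne_top enorm_ne_top hM, fun w => ?_⟩
    rw [Pi.smul_apply, enorm_smul]
    have := h w
    by_cases hw : w ∈ box d n
    · rw [Set.indicator_of_mem hw] at this ⊢
      gcongr
    · rw [Set.indicator_of_notMem hw, nonpos_iff_eq_zero] at this
      rw [this, mul_zero]
      exact zero_le

theorem tentENorm_lt_top_of_mem_ccTensor {𝕜 : Type*} [RCLike 𝕜] [NormedSpace 𝕜 X] {p q : ℝ}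
    (hp : 0 < p) (hq : 0 < q) {f : Up d → X} (hf : f ∈ ccTensor 𝕜 d X) :
    tentENorm p q f < ∞ := by
  obtain ⟨-, n, M, hM, hle⟩ := ccTensor_continuous_and_le_box hf
  rw [tentENorm_eq hp]
  exact ENNReal.rpow_lt_top_of_nonneg (by positivity)
    (lintegral_coneInt_rpow_ne_top_of_le_box hM hle hq (by positivity))

/-! ### From the positive operator to the kernel operator -/

theorem enorm_kernel_le {ε κ γ C : ℝ} (hγε : 2 * γ ≤ ε) (hγκ : γ ≤ κ) (hC : 0 < C)
    {K : Up d → Up d → ℝ} (hK : KernelDecay ε κ C K) {z w : Up d} (hz : 0 < z.2) (hw : 0 < w.2) :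
    ‖K z w‖ₑ ≤ ENNReal.ofReal C * ker γ z w := by
  obtain ⟨x, t⟩ := z
  obtain ⟨y, s⟩ := w
  dsimp only at hz hw
  have h := hK x y t s hz hw
  set m := min t s with hm
  set M := max t s with hM
  have hm0 : 0 < m := lt_min hz hw
  have hM0 : 0 < M := lt_max_of_lt_left hz
  have hmM : m ≤ M := min_le_max
  have e1 : min (s / t) (t / s) = m / M := by
    rcases le_total t s with hts | hts
    · rw [hm, hM, min_eq_left hts, max_eq_right hts, min_eq_right]
      exact ((div_le_one hw).2 hts).trans ((one_le_div hz).2 hts)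
    · rw [hm, hM, min_eq_right hts, max_eq_left hts, min_eq_left]
      exact ((div_le_one hz).2 hts).trans ((one_le_div hw).2 hts)
  have e2 : min (1 / t) (1 / s) = 1 / M := by
    rcases le_total t s with hts | hts
    · rw [hM, max_eq_right hts, min_eq_right (one_div_le_one_div_of_le hz hts)]
    · rw [hM, max_eq_left hts, min_eq_left (one_div_le_one_div_of_le hw hts)]
  rw [e1, e2, ← dist_eq_norm] at h
  set D := dist x y with hD
  have hD0 : 0 ≤ D := dist_nonneg
  have hρ1 : m / M ≤ 1 := (div_le_one hM0).2 hmM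
  have hb : 1 ≤ 1 + 1 / M * D := le_add_of_nonneg_right (by positivity)
  rw [ker, vert, ← mul_assoc, ← ENNReal.ofReal_mul hC.le, ← ENNReal.ofReal_mul (by positivity),
    Real.enorm_eq_ofReal_abs]
  refine ENNReal.ofReal_le_ofReal (h.trans ?_)
  calc C * (m / M) ^ ε * (1 / M) ^ d / (1 + 1 / M * D) ^ ((d : ℝ) + κ)
      ≤ C * (m / M) ^ (2 * γ) * (1 / M) ^ d / (1 + 1 / M * D) ^ ((d : ℝ) + γ) := by
        gcongr C * ?_ * (1 / M) ^ d / ?_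
        · exact Real.rpow_le_rpow_of_exponent_ge (by positivity) hρ1 hγε
        · exact Real.rpow_le_rpow_of_exponent_le hb (by linarith)
    _ = C * (m / M) ^ γ * (m ^ γ / (M + D) ^ ((d : ℝ) + γ)) := by
        have e3 : 1 + 1 / M * D = (M + D) / M := by field_simp
        rw [e3, Real.div_rpow (add_pos_of_pos_of_nonneg hM0 hD0).le hM0.le, Real.rpow_add hM0,
          Real.rpow_natCast,
          two_mul, Real.rpow_add (div_pos hm0 hM0), Real.div_rpow hm0.le hM0.le]
        field_simp
        rw [← mul_pow, one_div_mul_cancel hM0.ne', one_pow]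

variable [NormedSpace ℝ X]

theorem lintegral_enorm_kernel_smul_le {γ : ℝ} {C : ℝ≥0∞} (hC : C ≠ ∞) {K : Up d → Up d → ℝ}
    (hK : ∀ z w : Up d, 0 < z.2 → 0 < w.2 → ‖K z w‖ₑ ≤ C * ker γ z w) {f : Up d → X}
    {F : Up d → ℝ≥0∞} (hF : ∀ᵐ w ∂halfMeasure d, ‖f w‖ₑ ≤ F w) {z : Up d} (hz : 0 < z.2) :
    ∫⁻ w, ‖K z w • f w‖ₑ ∂halfMeasure d ≤ C * posOp γ F z := by
  rw [posOp, ← lintegral_const_mul' _ _ hC]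
  refine lintegral_mono_ae ?_
  filter_upwards [hF, ae_halfMeasure_pos d] with w hw hw0
  rw [enorm_smul, ← mul_assoc]
  gcongr
  exact hK z w hz hw0

theorem enorm_kernelOp_le {γ : ℝ} {C : ℝ≥0∞} (hC : C ≠ ∞) {K : Up d → Up d → ℝ}
    (hK : ∀ z w : Up d, 0 < z.2 → 0 < w.2 → ‖K z w‖ₑ ≤ C * ker γ z w) {f : Up d → X}
    {F : Up d → ℝ≥0∞} (hF : ∀ᵐ w ∂halfMeasure d, ‖f w‖ₑ ≤ F w) {z : Up d} (hz : 0 < z.2) :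
    ‖kernelOp K f z‖ₑ ≤ C * posOp γ F z :=
  (enorm_integral_le_lintegral_enorm _).trans (lintegral_enorm_kernel_smul_le hC hK hF hz)

theorem aestronglyMeasurable_kernelOp {K : Up d → Up d → ℝ}
    (hK : AEStronglyMeasurable (Function.uncurry K) ((halfMeasure d).prod (halfMeasure d)))
    {f : Up d → X} (hf : AEStronglyMeasurable f (halfMeasure d)) :
    AEStronglyMeasurable (kernelOp K f) (halfMeasure d) :=
  (hK.smul hf.comp_snd).integral_prod_right'

/-- A tent space estimate for the positive operator yields one for the kernel operator, and the
absolute convergence almost everywhere of the integral that defines it. -/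
theorem tentENorm_kernelOp_le {γ A : ℝ} (hA : 0 ≤ A) {C : ℝ} (hC : 0 < C) {p q : ℝ} (hp : 1 ≤ p)
    (hq : 1 < q)
    (hbound : ∀ F : Up d → ℝ≥0∞, Measurable F →
      ∫⁻ x, coneInt (fun z => posOp γ F z ^ q) x ^ (p / q) ≤
        (ENNReal.ofReal A * ENNReal.ofReal p ^ (1 / q)) ^ p *
          ∫⁻ x, coneInt (fun w => F w ^ q) x ^ (p / q))
    {K : Up d → Up d → ℝ}
    (hKm : AEStronglyMeasurable (Function.uncurry K) ((halfMeasure d).prod (halfMeasure d)))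
    (hK : ∀ z w : Up d, 0 < z.2 → 0 < w.2 → ‖K z w‖ₑ ≤ ENNReal.ofReal C * ker γ z w)
    {f : Up d → X} (hf : AEStronglyMeasurable f (halfMeasure d)) (hft : tentENorm p q f < ∞) :
    (∀ᵐ z ∂halfMeasure d, Integrable (fun w => K z w • f w) (halfMeasure d)) ∧
      tentENorm p q (kernelOp K f) ≤
        ENNReal.ofReal (A * C * p ^ (1 / q)) * tentENorm p q f := by
  have hp0 : 0 < p := by linarith
  have hq0 : 0 < q := by linarith
  have hCt : ENNReal.ofReal C ≠ ∞ := ENNReal.ofReal_ne_top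
  set f' := hf.mk f with hf'
  have hff' : f =ᵐ[halfMeasure d] f' := hf.ae_eq_mk
  set F : Up d → ℝ≥0∞ := fun w => ‖f' w‖ₑ with hFdef
  have hF : Measurable F := hf.stronglyMeasurable_mk.enorm
  have hle : ∀ᵐ w ∂halfMeasure d, ‖f w‖ₑ ≤ F w := by
    filter_upwards [hff'] with w hw
    rw [hw]
  have hnorm : tentENorm p q f =
      (∫⁻ x, coneInt (fun w => F w ^ q) x ^ (p / q)) ^ (1 / p) := by
    rw [tentENorm_congr p q hff', tentENorm_eq hp0]
  set B : ℝ≥0∞ := ENNReal.ofReal A * ENNReal.ofReal p ^ (1 / q) with hB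
  have hBt : B ≠ ∞ := ENNReal.mul_ne_top ENNReal.ofReal_ne_top
    (ENNReal.rpow_ne_top_of_nonneg (by positivity) ENNReal.ofReal_ne_top)
  have hb := hbound F hF
  have hPm := measurable_posOp γ hF
  constructor
  · have hfin : ∫⁻ x, coneInt (fun z => posOp γ F z ^ q) x ^ (p / q) ≠ ∞ := by
      refine ne_top_of_le_ne_top (ENNReal.mul_ne_top
        (ENNReal.rpow_ne_top_of_nonneg hp0.le hBt) ?_) hb
      rw [hnorm, ENNReal.rpow_lt_top_iff_of_pos (by positivity)] at hft
      exact hft.ne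
    filter_upwards [ae_lt_top_of_lintegral_coneInt hPm hq0 (by positivity) hfin,
      ae_halfMeasure_pos d, hKm.prodMk_left] with z hz hz0 hzm
    refine ⟨hzm.smul hf, ?_⟩
    exact (lintegral_enorm_kernel_smul_le hCt hK hle hz0).trans_lt
      (ENNReal.mul_lt_top hCt.lt_top hz)
  · have hCq : ENNReal.ofReal C ^ q ≠ ∞ := ENNReal.rpow_ne_top_of_nonneg hq0.le hCt
    rw [hnorm, tentENorm_eq hp0]
    calc (∫⁻ x, coneInt (fun w => ‖kernelOp K f w‖ₑ ^ q) x ^ (p / q)) ^ (1 / p)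
        ≤ (∫⁻ x, (ENNReal.ofReal C ^ q * coneInt (fun z => posOp γ F z ^ q) x) ^ (p / q)) ^
            (1 / p) := by
          gcongr with x
          rw [← coneInt_const_mul hCq]
          refine coneInt_mono (fun z hz => ?_) x
          rw [← ENNReal.mul_rpow_of_nonneg _ _ hq0.le]
          gcongr
          exact enorm_kernelOp_le hCt hK hle hz
      _ = (ENNReal.ofReal C ^ p *
            ∫⁻ x, coneInt (fun z => posOp γ F z ^ q) x ^ (p / q)) ^ (1 / p) := by
          rw [← lintegral_const_mul' _ _ (ENNReal.rpow_ne_top_of_nonneg hp0.le hCt)]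
          congr 1
          refine lintegral_congr fun x => ?_
          rw [ENNReal.mul_rpow_of_nonneg _ _ (by positivity), ← ENNReal.rpow_mul,
            mul_div_cancel₀ _ hq0.ne']
      _ ≤ (ENNReal.ofReal C ^ p * (B ^ p *
            ∫⁻ x, coneInt (fun w => F w ^ q) x ^ (p / q))) ^ (1 / p) := by gcongr
      _ = ENNReal.ofReal C * (B *
            (∫⁻ x, coneInt (fun w => F w ^ q) x ^ (p / q)) ^ (1 / p)) := by
          rw [ENNReal.mul_rpow_of_nonneg _ _ (by positivity),
            ENNReal.mul_rpow_of_nonneg _ _ (by positivity), ← ENNReal.rpow_mul,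
            ← ENNReal.rpow_mul, mul_one_div_cancel hp0.ne', ENNReal.rpow_one, ENNReal.rpow_one]
      _ = _ := by
          rw [hB, ENNReal.ofReal_mul (by positivity), ENNReal.ofReal_mul hA,
            ENNReal.ofReal_rpow_of_pos hp0]
          ring

/-- The kernel operator as a linear map of a space of classes of functions, given by absolutely
convergent integrals. -/
noncomputable def kernelLinearMap {𝕜 : Type*} [RCLike 𝕜] [NormedSpace 𝕜 X] [IsScalarTower ℝ 𝕜 X]
    {p q : ℝ} (hp : 1 ≤ p) (hq : 1 < q) (K : Up d → Up d → ℝ)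
    (hKm : AEStronglyMeasurable (Function.uncurry K) ((halfMeasure d).prod (halfMeasure d)))
    (hint : ∀ f : tentSpace 𝕜 d X hp hq, ∀ᵐ z ∂halfMeasure d,
      Integrable (fun w => K z w • f.1 w) (halfMeasure d))
    (hfin : ∀ f : tentSpace 𝕜 d X hp hq, tentENorm p q (kernelOp K f.1) < ∞) :
    tentSpace 𝕜 d X hp hq →ₗ[𝕜] tentSpace 𝕜 d X hp hq where
  toFun f := ⟨AEEqFun.mk (kernelOp K f.1)
      (aestronglyMeasurable_kernelOp hKm f.1.aestronglyMeasurable), by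
    change tentENorm p q _ < ∞
    rw [tentENorm_congr p q (AEEqFun.coeFn_mk _ _)]
    exact hfin f⟩
  map_add' f g := by
    ext1
    refine AEEqFun.mk_eq_mk.2 ?_
    filter_upwards [hint f, hint g] with z hf hg
    change kernelOp K _ z = kernelOp K _ z + kernelOp K _ z
    rw [kernelOp, kernelOp, kernelOp, ← integral_add hf hg]
    refine integral_congr_ae ?_
    filter_upwards [AEEqFun.coeFn_add f.1 g.1] with w hw
    rw [Submodule.coe_add, hw, Pi.add_apply, smul_add]
  map_smul' c f := by
    have : SMulCommClass ℝ 𝕜 X := IsScalarTower.to_smulCommClass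
    ext1
    refine AEEqFun.mk_eq_mk.2 (Filter.Eventually.of_forall fun z => ?_)
    change kernelOp K _ z = c • kernelOp K _ z
    rw [kernelOp, kernelOp, ← integral_smul]
    refine integral_congr_ae ?_
    filter_upwards [AEEqFun.coeFn_smul c f.1] with w hw
    rw [Submodule.coe_smul, hw, Pi.smul_apply, smul_comm]

theorem kernelOp_congr (K : Up d → Up d → ℝ) {f g : Up d → X} (h : f =ᵐ[halfMeasure d] g) :
    kernelOp K f = kernelOp K g := by
  funext z
  refine integral_congr_ae ?_
  filter_upwards [h] with w hw
  rw [hw]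

/-- The Carleson function of `𝒦 f` is bounded pointwise by the one of `f`, because the Carleson
estimate for the positive operator only involves balls concentric to the given one. -/
theorem carlesonFun_kernelOp_le {γ : ℝ} {A : ℝ≥0∞} {C : ℝ} {q : ℝ} (hq : 1 < q)
    (hcarl : ∀ F : Up d → ℝ≥0∞, Measurable F → ∀ (c : Pt d) (r : ℝ), 0 < r → ∀ N : ℝ≥0∞,
      (∀ R, r ≤ R → ∫⁻ w in tent (Metric.ball c R), F w ^ q ∂halfMeasure d ≤
        volume (Metric.ball c R) * N) →
      ∫⁻ z in tent (Metric.ball c r), posOp γ F z ^ q ∂halfMeasure d ≤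
        A ^ q * (volume (Metric.ball c r) * N))
    {K : Up d → Up d → ℝ}
    (hK : ∀ z w : Up d, 0 < z.2 → 0 < w.2 → ‖K z w‖ₑ ≤ ENNReal.ofReal C * ker γ z w)
    {f : Up d → X} (hf : Continuous f) (x : Pt d) :
    carlesonFun q (kernelOp K f) x ≤ A * ENNReal.ofReal C * carlesonFun q f x := by
  have hq0 : 0 < q := by linarith
  have hCt : ENNReal.ofReal C ≠ ∞ := ENNReal.ofReal_ne_top
  have hCq : ENNReal.ofReal C ^ q ≠ ∞ := ENNReal.rpow_ne_top_of_nonneg hq0.le hCt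
  set N : ℝ≥0∞ := carlesonFun q f x ^ q with hN
  have hF : Measurable fun w : Up d => ‖f w‖ₑ := hf.enorm.measurable
  refine iSup₂_le fun c r => iSup₂_le fun hr hx => ?_
  have hv0 := volume_ball_ne_zero c hr
  have hvt := volume_ball_ne_top c r
  have h1 : ∀ R, r ≤ R → ∫⁻ w in tent (Metric.ball c R), ‖f w‖ₑ ^ q ∂halfMeasure d ≤
      volume (Metric.ball c R) * N := by
    intro R hR
    have hR0 : 0 < R := hr.trans_le hR
    have h2 : ((volume (Metric.ball c R))⁻¹ *
        ∫⁻ z in tent (Metric.ball c R), ‖f z‖ₑ ^ q ∂halfMeasure d) ^ (1 / q) ≤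
        carlesonFun q f x :=
      le_iSup₂_of_le c R (le_iSup₂_of_le hR0 (Metric.ball_subset_ball hR hx) le_rfl)
    have h3 : (volume (Metric.ball c R))⁻¹ *
        ∫⁻ z in tent (Metric.ball c R), ‖f z‖ₑ ^ q ∂halfMeasure d ≤ N := by
      have := ENNReal.rpow_le_rpow h2 hq0.le
      rwa [← ENNReal.rpow_mul, one_div, inv_mul_cancel₀ hq0.ne', ENNReal.rpow_one] at this
    calc ∫⁻ w in tent (Metric.ball c R), ‖f w‖ₑ ^ q ∂halfMeasure d
        = volume (Metric.ball c R) * ((volume (Metric.ball c R))⁻¹ *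
            ∫⁻ z in tent (Metric.ball c R), ‖f z‖ₑ ^ q ∂halfMeasure d) := by
          rw [← mul_assoc, ENNReal.mul_inv_cancel (volume_ball_ne_zero c hR0)
            (volume_ball_ne_top c R), one_mul]
      _ ≤ _ := by gcongr
  have h2 : ∫⁻ z in tent (Metric.ball c r), ‖kernelOp K f z‖ₑ ^ q ∂halfMeasure d ≤
      ENNReal.ofReal C ^ q * (A ^ q * (volume (Metric.ball c r) * N)) := by
    calc ∫⁻ z in tent (Metric.ball c r), ‖kernelOp K f z‖ₑ ^ q ∂halfMeasure d
        ≤ ∫⁻ z in tent (Metric.ball c r),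
            ENNReal.ofReal C ^ q * posOp γ (fun w => ‖f w‖ₑ) z ^ q ∂halfMeasure d := by
          refine setLIntegral_mono' (measurableSet_tent _) fun z hz => ?_
          rw [← ENNReal.mul_rpow_of_nonneg _ _ hq0.le]
          gcongr
          exact enorm_kernelOp_le hCt hK (Filter.Eventually.of_forall fun _ => le_rfl)
            (mem_tent_iff.1 hz).1
      _ ≤ _ := by
          rw [lintegral_const_mul' _ _ hCq]
          gcongr
          exact hcarl _ hF c r hr N h1
  calc ((volume (Metric.ball c r))⁻¹ *
        ∫⁻ z in tent (Metric.ball c r), ‖kernelOp K f z‖ₑ ^ q ∂halfMeasure d) ^ (1 / q)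
      ≤ ((volume (Metric.ball c r))⁻¹ *
          (ENNReal.ofReal C ^ q * (A ^ q * (volume (Metric.ball c r) * N)))) ^ (1 / q) := by
        gcongr
    _ = ((A * ENNReal.ofReal C * carlesonFun q f x) ^ q) ^ (1 / q) := by
        congr 1
        rw [ENNReal.mul_rpow_of_nonneg _ _ hq0.le, ENNReal.mul_rpow_of_nonneg _ _ hq0.le, ← hN]
        calc (volume (Metric.ball c r))⁻¹ *
              (ENNReal.ofReal C ^ q * (A ^ q * (volume (Metric.ball c r) * N)))
            = (volume (Metric.ball c r))⁻¹ * volume (Metric.ball c r) *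
                (A ^ q * ENNReal.ofReal C ^ q * N) := by ring
          _ = _ := by rw [ENNReal.inv_mul_cancel hv0 hvt, one_mul]
    _ = _ := by rw [← ENNReal.rpow_mul, mul_one_div_cancel hq0.ne', ENNReal.rpow_one]

end Tent

open Tent in
theorem lemma3p5 (d : ℕ) (hd : 1 ≤ d) (ε κ : ℝ) (hε : 0 < ε) (hκ : 0 < κ) :
    ∃ A : ℝ, 0 < A ∧
      ∀ (𝕜 : Type*) [RCLike 𝕜] (X : Type*) [NormedAddCommGroup X] [NormedSpace ℝ X]
        [NormedSpace 𝕜 X] [IsScalarTower ℝ 𝕜 X] [CompleteSpace X]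
        (q : ℝ) (hq : 1 < q) (C : ℝ) (_ : 0 < C)
        (K : EuclideanSpace ℝ (Fin d) × ℝ → EuclideanSpace ℝ (Fin d) × ℝ → ℝ)
        (_ : AEStronglyMeasurable (Function.uncurry K)
          ((Tent.halfMeasure d).prod (Tent.halfMeasure d)))
        (_ : Tent.KernelDecay ε κ C K),
        (∀ f ∈ Tent.ccTensor 𝕜 d X, ∀ᵐ z ∂Tent.halfMeasure d,
          Integrable (fun w => K z w • f w) (Tent.halfMeasure d)) ∧
        (∀ (p : ℝ) (hp : 1 ≤ p),
          ∃ T : Tent.tentSpace 𝕜 d X hp hq →ₗ[𝕜] Tent.tentSpace 𝕜 d X hp hq,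
            (∀ f ∈ Tent.ccTensor 𝕜 d X, ∃ g : Tent.tentSpace 𝕜 d X hp hq,
              g.1 =ᵐ[Tent.halfMeasure d] f ∧
              (T g).1 =ᵐ[Tent.halfMeasure d] Tent.kernelOp K f) ∧
            (∀ g : Tent.tentSpace 𝕜 d X hp hq,
              Tent.tentENorm p q (T g).1 ≤
                ENNReal.ofReal (A * C * p ^ (1 / q)) * Tent.tentENorm p q g.1)) ∧
        (∀ p : ℝ≥0∞, 1 ≤ p → ∀ f ∈ Tent.ccTensor 𝕜 d X,
          eLpNorm (Tent.carlesonFun q (Tent.kernelOp K f)) p volume ≤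
            ENNReal.ofReal (A * C) * eLpNorm (Tent.carlesonFun q f) p volume) := by
  -- One half of the vertical decay is kept as such, the other half is spent on replacing
  -- `max(t, s)^γ` by `min(t, s)^γ` in the kernel.
  set γ : ℝ := min κ (ε / 2) with hγdef
  have hγ : 0 < γ := lt_min hκ (by positivity)
  have hγκ : γ ≤ κ := min_le_left _ _
  have hγε : 2 * γ ≤ ε := by
    have : γ ≤ ε / 2 := min_le_right _ _
    linarith
  obtain ⟨A₁, hA₁, htent⟩ := lintegral_coneInt_posOp_le hd hγ
  obtain ⟨A₂, hA₂, hcarl⟩ := setLIntegral_tent_posOp_rpow_le hd hγ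
  set A : ℝ := 1 + A₁.toReal + A₂.toReal with hAdef
  have hA0 : 0 < A := by positivity
  have hA₁le : A₁ ≤ ENNReal.ofReal A := by
    rw [← ENNReal.ofReal_toReal hA₁]
    refine ENNReal.ofReal_le_ofReal ?_
    linarith [ENNReal.toReal_nonneg (a := A₂)]
  have hA₂le : A₂ ≤ ENNReal.ofReal A := by
    rw [← ENNReal.ofReal_toReal hA₂]
    refine ENNReal.ofReal_le_ofReal ?_
    linarith [ENNReal.toReal_nonneg (a := A₁)]
  refine ⟨A, hA0, ?_⟩
  intro 𝕜 _ X _ _ _ _ _ q hq C hC K hKm hKd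
  have hK : ∀ z w : Up d, 0 < z.2 → 0 < w.2 → ‖K z w‖ₑ ≤ ENNReal.ofReal C * ker γ z w :=
    fun z w hz hw => enorm_kernel_le hγε hγκ hC hKd hz hw
  have hmain : ∀ p : ℝ, 1 ≤ p → ∀ f : Up d → X, AEStronglyMeasurable f (halfMeasure d) →
      tentENorm p q f < ∞ →
      (∀ᵐ z ∂halfMeasure d, Integrable (fun w => K z w • f w) (halfMeasure d)) ∧
      tentENorm p q (kernelOp K f) ≤
        ENNReal.ofReal (A * C * p ^ (1 / q)) * tentENorm p q f := by
    intro p hp f hf hft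
    refine tentENorm_kernelOp_le hA0.le hC hp hq (fun F hF => ?_) hKm hK hf hft
    refine (htent p q hp hq F hF).trans ?_
    gcongr
  refine ⟨fun f hf => ?_, fun p hp => ?_, fun p _ f hf => ?_⟩
  · exact (hmain 1 le_rfl f (ccTensor_continuous_and_le_box hf).1.aestronglyMeasurable
      (tentENorm_lt_top_of_mem_ccTensor one_pos (by linarith) hf)).1
  · have hbd : ∀ g : tentSpace 𝕜 d X hp hq, _ := fun g =>
      hmain p hp g.1 g.1.aestronglyMeasurable g.2
    refine ⟨kernelLinearMap hp hq K hKm (fun g => (hbd g).1) fun g =>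
      (hbd g).2.trans_lt (ENNReal.mul_lt_top ENNReal.ofReal_lt_top g.2), fun f hf => ?_,
      fun g => ?_⟩
    · have hfm : AEStronglyMeasurable f (halfMeasure d) :=
        (ccTensor_continuous_and_le_box hf).1.aestronglyMeasurable
      have hae := AEEqFun.coeFn_mk f hfm
      refine ⟨⟨AEEqFun.mk f hfm, ?_⟩, hae, ?_⟩
      · change tentENorm p q _ < ∞
        rw [tentENorm_congr p q hae]
        exact tentENorm_lt_top_of_mem_ccTensor (by linarith) (by linarith) hf
      · refine (AEEqFun.coeFn_mk _ _).trans ?_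
        rw [kernelOp_congr K hae]
    · refine le_trans (le_of_eq ?_) (hbd g).2
      exact tentENorm_congr p q (AEEqFun.coeFn_mk _ _)
  · have hpt := carlesonFun_kernelOp_le hq (hcarl q hq) hK (ccTensor_continuous_and_le_box hf).1
    refine (eLpNorm_le_nnreal_smul_eLpNorm_of_ae_le_mul' (c := (A * C).toNNReal)
      (g := carlesonFun q f) (Filter.Eventually.of_forall fun x => ?_) p)
    rw [enorm_eq_self, enorm_eq_self]
    refine (hpt x).trans ?_
    change _ ≤ ENNReal.ofReal (A * C) * _
    rw [ENNReal.ofReal_mul hA0.le]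
    gcongr
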